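/- **Setting.** Let $\Omega\subset\mathbb R^d$, $d\in\{2,3\}$, be a bounded Lipschitz domain, $A\in L^\infty(\Omega,\mathbb R^{d\times d})$ symmetric with $\alpha_{\min}|\xi|^2\le A(x)\xi\cdot\xi\le\alpha_{\max}|\xi|^2$ for a.e. $x\in\Omega$ and all $\xi$ ($0<\alpha_{\min}\le\alpha_{\max}<\infty$), $f\in L^2(\Omega)$, and $g\in H^{1/2}(\partial\Omega)$. For open $S\subset\Omega$ put $a_S(v,w)=\int_S A\nabla v\cdot\nabla w\,dx$, $F_S(v)=\int_S fv\,dx$, $\|v\|_{a,S}^2=a_S(v,v)$, $a=a_\Omega$, $F=F_\Omega$, $\|\cdot\|_a=\|\cdot\|_{a,\Omega}$. Let $u\in H^1(\Omega)$, $u|_{\partial\Omega}=g$, be the weak solution: $a(u,v)=F(v)$ for all $v\in H^1_0(\Omega)$. Let $H_a(S)=\{v\in H^1(S): a_S(v,\varphi)=0\ \forall\varphi\in H^1_0(S)\}$. **Decomposition.** Let $\Omega=\bigcup_{i=1}^M\omega_i$ with $\omega_i$ open, and $\omega_i\subset\omega_i^*\subset\Omega$ with $\omega_i^*$ open; every point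 of $\Omega$ lies in at most $\kappa$ of the $\omega_i$ and at most $\kappa^*$ of the $\omega_i^*$. Let $\chi_i\in W^{1,\infty}(\Omega)$ be continuous, $0\le\chi_i\le1$, $\chi_i=0$ on $\Omega\setminus\omega_i$, $\sum_i\chi_i=1$ on $\Omega$. For each $i$ let $\tilde\omega_i\subset\omega_i$ be a Lipschitz domain on which $\chi_i=1$, and let $R_i\subset R_i^*\subset\omega_i^*$ be open with $\tilde\omega_i\cup R_i=\omega_i$, $\partial\tilde\omega_i\cap\Omega\subset R_i$, and $R_i^*$ bounded with Lipschitz boundary. Let $\eta_i\in W^{1,\infty}(\omega_i^*)$ be continuous with values in $[0,1]$, $\eta_i=1$ on $\omega_i\setminus R_i$, $\eta_i=0$ on $\omega_i^*\setminus\tilde\omega_i$, and put $\chi_i^R=\chi_i-\eta_i$. Call $i$ a boundary subdomain if $\partial\omega_i^*\cap\partial\Omega\ne\emptyset$, and an interior subdomain otherwise. For interior $i$, $R_i^*$ is connected; for boundary $i$, the only locally constant function on $R_i^*$ in $H^1(R_i^*)$ with zero trace on $\partial R_i^*\cap\partial\Omega$ is $0$. **Local spaces and widths.** For boundary $i$ let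 $H_i=H_i'=\{v\in H_a(R_i^*): v=0\text{ on }\partial R_i^*\cap\partial\Omega\}$. For interior $i$ let $H_i=H_a(R_i^*)$ and let $H_i'$ be the set of $v\in H_a(R_i^*)$ with $$\Big(\int_{R_i}A\nabla\chi_i^R\cdot\nabla\chi_i^R\,dx\Big)^{-1}\int_{R_i}A\nabla(\chi_i^Rv)\cdot\nabla\chi_i^R\,dx=0 .$$ The Kolmogorov $n$-width is $$d_n(R_i,R_i^*)=\inf_{Q\subset H^1_0(R_i),\ \dim Q\le n}\ \sup_{v\in H_i'}\ \inf_{q\in Q}\frac{\|\chi_i^Rv-q\|_{a,R_i}}{\|v\|_{a,R_i^*}}\qquad(0/0:=0).$$ **Method.** Let $n_i\ge1$. Let $(v_{i,k},\lambda_{i,k})\in H_i\times\mathbb R$, $k=1,\dots,n_i$, be the first $n_i$ eigenpairs (ordered by nondecreasing eigenvalue, counted with multiplicity, eigenfunctions linearly independent) of $$a_{R_i^*}(v,\varphi)=\lambda\,a_{R_i}(\chi_i^Rv,\chi_i^R\varphi)\qquad\forall\varphi\in H_i .$$ Let $v_{i,k}^{\rm ext}=v_{i,k}$ on $R_i^*\setminus\tilde\omega_i$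 and $v_{i,k}^{\rm ext}=\tilde v_{i,k}$ on $\tilde\omega_i$, where $\tilde v_{i,k}\in H_a(\tilde\omega_i)$ satisfies $\tilde v_{i,k}=v_{i,k}$ on $\partial\tilde\omega_i$ (where $v_{i,k}$ is defined) and $\tilde v_{i,k}=0$ on $\partial\tilde\omega_i\cap\partial\Omega$. Put $S_i=\operatorname{span}\{v_{i,1}^{\rm ext}|_{\omega_i},\dots,v_{i,n_i}^{\rm ext}|_{\omega_i}\}$. Let $\psi_i\in H^1_0(\omega_i^*)$ satisfy $a_{\omega_i^*}(\psi_i,w)=F_{\omega_i^*}(w)$ for all $w\in H_0^1(\omega_i^*)$. For boundary $i$ let $\psi_i^b\in H^1(\omega_i^*)$ satisfy $\psi_i^b=g$ on $\partial\omega_i^*\cap\partial\Omega$ and $a_{\omega_i^*}(\psi_i^b,w)=0$ for all $w\in H^1(\omega_i^*)$ with $w=0$ on $\partial\omega_i^*\cap\partial\Omega$. Let $u_i^p=\psi_i$ for interior and $u_i^p=\psi_i+\psi_i^b$ for boundary $i$. Put $u^p=\sum_i\chi_iu_i^p$ and $S=\{\sum_i\chi_i\phi_i:\phi_i\in S_i\}$.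 The GFEM solution is $u^G=u^p+u^s$ with $u^s\in S$ and $a(u^s,v)=F(v)-a(u^p,v)$ for all $v\in S$. **Theorem.** Put $$d_{\mathbf n}=\max_{1\le i\le M}\begin{cases}d_{n_i-1}(R_i,R_i^*)&\text{if }i\text{ is an interior subdomain},\\ d_{n_i}(R_i,R_i^*)&\text{if }i\text{ is a boundary subdomain}.\end{cases}$$ Then $d_{\mathbf n}<\infty$ and $$\|u-u^G\|_a\le\sqrt{\kappa\kappa^*}\;d_{\mathbf n}\;\|u\|_a .$$ Here zero traces on a part $\Gamma$ of the boundary of $S$ are understood as membership in the closure in $H^1(S)$ of the functions vanishing in a neighbourhood of $\Gamma$, and the Dirichlet datum $g$ is given by an $H^1(\Omega)$ function. -/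

import Mathlib

open MeasureTheory Set
open scoped ENNReal Matrix ContDiff

noncomputable section

namespace RingGFEM

/-- Euclidean space `ℝ^d`. -/
abbrev E (d : ℕ) : Type := EuclideanSpace ℝ (Fin d)

variable {d : ℕ}

/-! ### Domains -/

/-- The boundary of `S` is locally the graph of a Lipschitz function over a hyperplane, with `S`
lying (locally) strictly on one side of the graph. -/
def HasLipschitzBoundary (S : Set (E d)) : Prop :=
  ∀ p ∈ frontier S, ∃ (e : E d) (γ : E d → ℝ) (K : NNReal) (r : ℝ),
    ‖e‖ = 1 ∧ LipschitzWith K γ ∧ 0 < r ∧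
      ∀ x ∈ Metric.ball p r, x ∈ S ↔ γ (x - inner ℝ e x • e) < inner ℝ e x

/-- A bounded open set with Lipschitz boundary (not necessarily connected). -/
structure IsLipschitzOpen (S : Set (E d)) : Prop where
  isOpen : IsOpen S
  isBounded : Bornology.IsBounded S
  lipschitz : HasLipschitzBoundary S

/-- A bounded Lipschitz domain. -/
structure IsLipschitzDomain (S : Set (E d)) : Prop extends IsLipschitzOpen S where
  isConnected : IsConnected S

/-! ### Sobolev spaces

Functions are total functions on `ℝ^d`; only their values on the set `S` at hand matter, and
restriction to a subset is implicit. -/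

/-- Smooth functions with compact support in `S`. -/
def IsTestFunction (S : Set (E d)) (φ : E d → ℝ) : Prop :=
  ContDiff ℝ ∞ φ ∧ HasCompactSupport φ ∧ tsupport φ ⊆ S

/-- `G` is a weak gradient of `v` on `S`. -/
def IsWeakGrad (S : Set (E d)) (v : E d → ℝ) (G : E d → E d) : Prop :=
  ∀ φ : E d → ℝ, IsTestFunction S φ →
    ∫ x in S, v x • gradient φ x = -∫ x in S, φ x • G x

/-- `v ∈ H¹(S)`. -/
def MemH1 (S : Set (E d)) (v : E d → ℝ) : Prop :=
  MemLp v 2 (volume.restrict S) ∧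
    ∃ G : E d → E d, MemLp G 2 (volume.restrict S) ∧ IsWeakGrad S v G

open Classical in
/-- The square integrable weak gradient of `v` on `S` (unique up to null sets for `S` open and
`v ∈ H¹(S)`). -/
def weakGrad (S : Set (E d)) (v : E d → ℝ) : E d → E d :=
  if h : ∃ G : E d → E d, MemLp G 2 (volume.restrict S) ∧ IsWeakGrad S v G
  then h.choose else 0

/-- The square of the `H¹(S)`-norm. -/
def h1NormSq (S : Set (E d)) (v : E d → ℝ) : ℝ :=
  (∫ x in S, (v x) ^ 2) + ∫ x in S, ‖weakGrad S v x‖ ^ 2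

/-- `v ∈ H¹₀(S)`, the closure of the test functions in `H¹(S)`. -/
def MemH10 (S : Set (E d)) (v : E d → ℝ) : Prop :=
  MemH1 S v ∧ ∀ ε : ℝ, 0 < ε → ∃ φ : E d → ℝ, IsTestFunction S φ ∧ h1NormSq S (v - φ) < ε

/-- `v ∈ H¹(S)` and `v = 0` on the part `Γ` of the boundary of `S`: `v` is a limit in `H¹(S)` of
functions of `H¹(S)` that vanish in a neighbourhood of `Γ`. -/
def VanishesOn (S Γ : Set (E d)) (v : E d → ℝ) : Prop :=
  MemH1 S v ∧ ∀ ε : ℝ, 0 < ε → ∃ (w : E d → ℝ) (U : Set (E d)), MemH1 S w ∧ IsOpen U ∧ Γ ⊆ U ∧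
    (∀ x ∈ U ∩ S, w x = 0) ∧ h1NormSq S (v - w) < ε

/-- `f ∈ W^{1,∞}(S)`, with `f` the continuous representative. -/
def MemW1Inf (S : Set (E d)) (f : E d → ℝ) : Prop :=
  ContinuousOn f S ∧ MemLp f ∞ (volume.restrict S) ∧
    ∃ G : E d → E d, MemLp G ∞ (volume.restrict S) ∧ IsWeakGrad S f G

/-! ### The elliptic problem -/

/-- The coefficient: measurable, symmetric and uniformly elliptic and bounded a.e. on `Ω`. -/
structure IsElliptic (Ω : Set (E d)) (A : E d → Matrix (Fin d) (Fin d) ℝ) (αmin αmax : ℝ) :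
    Prop where
  measurable : ∀ i j, AEStronglyMeasurable (fun x => A x i j) (volume.restrict Ω)
  pos : 0 < αmin
  le : αmin ≤ αmax
  symm : ∀ᵐ x ∂(volume.restrict Ω), (A x).IsSymm
  bounds : ∀ᵐ x ∂(volume.restrict Ω), ∀ ξ : Fin d → ℝ,
    αmin * (ξ ⬝ᵥ ξ) ≤ (A x *ᵥ ξ) ⬝ᵥ ξ ∧ (A x *ᵥ ξ) ⬝ᵥ ξ ≤ αmax * (ξ ⬝ᵥ ξ)

/-- `a_S(v, w) = ∫_S (A ∇v) · ∇w`. -/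
def form (A : E d → Matrix (Fin d) (Fin d) ℝ) (S : Set (E d)) (v w : E d → ℝ) : ℝ :=
  ∫ x in S, (A x *ᵥ (weakGrad S v x).ofLp) ⬝ᵥ (weakGrad S w x).ofLp

/-- `F_S(v) = ∫_S f v`. -/
def load (f : E d → ℝ) (S : Set (E d)) (v : E d → ℝ) : ℝ := ∫ x in S, f x * v x

/-- The energy (semi)norm `‖v‖_{a,S} = a_S(v, v)^{1/2}`. -/
def energyNorm (A : E d → Matrix (Fin d) (Fin d) ℝ) (S : Set (E d)) (v : E d → ℝ) : ℝ :=
  Real.sqrt (form A S v v)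

/-- `u` is the weak solution of `-div(A∇u) = f` in `Ω`, `u = g` on `∂Ω`. The Dirichlet datum is
given by a function `g ∈ H¹(Ω)`, of which only the trace on `∂Ω` enters. -/
structure IsWeakSolution (Ω : Set (E d)) (A : E d → Matrix (Fin d) (Fin d) ℝ) (f g u : E d → ℝ) :
    Prop where
  memH1 : MemH1 Ω u
  dirichlet : MemH10 Ω (u - g)
  eq : ∀ v, MemH10 Ω v → form A Ω u v = load f Ω v

/-- The operator-harmonic functions `H_a(S)`. -/
def Harmonic (A : E d → Matrix (Fin d) (Fin d) ℝ) (S : Set (E d)) : Set (E d → ℝ) :=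
  {v | MemH1 S v ∧ ∀ φ, MemH10 S φ → form A S v φ = 0}

/-! ### Subdomains, oversampling domains and rings -/

/-- The sets and cut-off functions attached to one subdomain: the subdomain `W` (for `ω`), the
oversampling domain `Ws` (for `ω^*`), the inner domain `Wt` (for `ω̃`), the ring `R`, the oversampling ring `Rs`
(for `R^*`), the partition of unity function `χ` and the inner cut-off function `η`. -/
structure Patch (d : ℕ) where
  W : Set (E d)
  Ws : Set (E d)
  Wt : Set (E d)
  R : Set (E d)
  Rs : Set (E d)
  χ : E d → ℝ
  η : E d → ℝ

namespace Patch

/-- The ring cut-off function `χ^R = χ - η`. -/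
def χR (P : Patch d) : E d → ℝ := P.χ - P.η

/-- Boundary subdomains: `∂ω^* ∩ ∂Ω ≠ ∅`. -/
def IsBoundary (Ω : Set (E d)) (P : Patch d) : Prop := (frontier P.Ws ∩ frontier Ω).Nonempty

/-- The geometric assumptions on one subdomain. -/
structure Admissible (Ω : Set (E d)) (P : Patch d) : Prop where
  isOpen_W : IsOpen P.W
  isOpen_Ws : IsOpen P.Ws
  isOpen_R : IsOpen P.R
  W_subset : P.W ⊆ P.Ws
  Ws_subset : P.Ws ⊆ Ω
  R_subset : P.R ⊆ P.Rs
  Rs_subset : P.Rs ⊆ P.Ws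
  Wt_lipschitz : IsLipschitzDomain P.Wt
  Wt_union_R : P.Wt ∪ P.R = P.W
  frontier_Wt : frontier P.Wt ∩ Ω ⊆ P.R
  Rs_lipschitz : IsLipschitzOpen P.Rs
  /-- The oversampling ring of an interior subdomain is connected. -/
  Rs_connected : ¬ P.IsBoundary Ω → IsConnected P.Rs
  /-- For boundary subdomains, the Dirichlet part `∂R^* ∩ ∂Ω` is not negligible: no nonzero
  locally constant function on `R^*` has zero trace there. -/
  Rs_dirichlet : P.IsBoundary Ω → ∀ v, VanishesOn P.Rs (frontier P.Rs ∩ frontier Ω) v →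
    weakGrad P.Rs v =ᵐ[volume.restrict P.Rs] 0 → v =ᵐ[volume.restrict P.Rs] 0
  χ_mem : MemW1Inf Ω P.χ
  χ_range : ∀ x ∈ Ω, 0 ≤ P.χ x ∧ P.χ x ≤ 1
  χ_support : ∀ x ∈ Ω, x ∉ P.W → P.χ x = 0
  χ_inner : ∀ x ∈ P.Wt, P.χ x = 1
  η_mem : MemW1Inf P.Ws P.η
  η_range : ∀ x ∈ P.Ws, 0 ≤ P.η x ∧ P.η x ≤ 1
  η_one : ∀ x ∈ P.W, x ∉ P.R → P.η x = 1
  η_zero : ∀ x ∈ P.Ws, x ∉ P.Wt → P.η x = 0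

variable (Ω : Set (E d)) (A : E d → Matrix (Fin d) (Fin d) ℝ) (P : Patch d)

/-- The functional `M^R`. (As `χ^R` vanishes on `ω \ R`, the integrals over `ω` are integrals
over `R`.) -/
def MR (v : E d → ℝ) : ℝ :=
  (form A P.R P.χR P.χR)⁻¹ * form A P.R (P.χR * v) P.χR

/-- `H_{a,0}(R^*)`, for interior subdomains. -/
def Ha0 : Set (E d → ℝ) := {v | v ∈ Harmonic A P.Rs ∧ P.MR A v = 0}

/-- `H_{a,0}^b(R^*)`, for boundary subdomains. -/
def Hab : Set (E d → ℝ) :=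
  {v | v ∈ Harmonic A P.Rs ∧ VanishesOn P.Rs (frontier P.Rs ∩ frontier Ω) v}

open Classical in
/-- The space of the eigenproblem that defines the method: `H_a(R^*)` for interior subdomains
(constants included), `H_{a,0}^b(R^*)` for boundary subdomains. -/
def eigenSpace : Set (E d → ℝ) :=
  if P.IsBoundary Ω then P.Hab Ω A else Harmonic A P.Rs

/-- `(v, μ)` is an eigenpair: `0 ≠ v ∈ H`, and
`a_{R^*}(v, φ) = μ a_R(χ^R v, χ^R φ)` for all `φ ∈ H`, with `H` the space above. -/
def IsEigenpair (v : E d → ℝ) (μ : ℝ) : Prop :=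
  v ∈ P.eigenSpace Ω A ∧ ¬ v =ᵐ[volume.restrict P.Rs] 0 ∧
    ∀ φ ∈ P.eigenSpace Ω A, form A P.Rs v φ = μ * form A P.R (P.χR * v) (P.χR * φ)

/-- `(v k, μ k)`, `k < n`, are the first `n` eigenpairs: linearly independent, with eigenvalues in
nondecreasing order, and every further eigenfunction has an eigenvalue that is at least as large. -/
structure IsFirstEigenpairs (n : ℕ) (v : Fin n → E d → ℝ) (μ : Fin n → ℝ) : Prop where
  eigenpair : ∀ k, P.IsEigenpair Ω A (v k) (μ k)
  monotone : Monotone μ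
  linearIndependent : ∀ c : Fin n → ℝ,
    (∑ k, c k • v k) =ᵐ[volume.restrict P.Rs] 0 → c = 0
  first : ∀ w ν, P.IsEigenpair Ω A w ν →
    (¬ ∃ c : Fin n → ℝ, w =ᵐ[volume.restrict P.Rs] ∑ k, c k • v k) → ∀ k, μ k ≤ ν

/-- `vt ∈ H¹(ω̃)` is the operator-harmonic function in `ω̃` with `vt = v` on `∂ω̃` (and `vt = 0` on
`∂ω̃ ∩ ∂Ω`, which is empty for interior subdomains), for `v` given on `R^*`. -/
structure IsHarmonicFilling (v vt : E d → ℝ) : Prop where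
  harmonic : vt ∈ Harmonic A P.Wt
  trace : VanishesOn (P.Wt ∩ P.Rs) (frontier P.Wt) (vt - v)
  dirichlet : VanishesOn P.Wt (frontier P.Wt ∩ frontier Ω) vt

open Classical in
/-- The extension `v^ext`: `vt` in `ω̃`, and `v` in `R^* \ ω̃`. -/
def ext (v vt : E d → ℝ) : E d → ℝ := P.Wt.piecewise vt v

/-- The Kolmogorov `n`-width of `v ↦ χ^R v`, `H → H¹₀(R)`, where `H` carries the norm of
`a_{R^*}` and `H¹₀(R)` that of `a_R`. The subspaces of dimension at most `n` are the spans of `n`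
functions. -/
def nWidthOn (H : Set (E d → ℝ)) (n : ℕ) : ℝ≥0∞ :=
  ⨅ (q : Fin n → E d → ℝ) (_ : ∀ k, MemH10 P.R (q k)), ⨆ u ∈ H,
    ⨅ v ∈ Submodule.span ℝ (Set.range q),
      ENNReal.ofReal (energyNorm A P.R (P.χR * u - v)) / ENNReal.ofReal (energyNorm A P.Rs u)

open Classical in
/-- The ring `n`-width `d_n(R, R^*)`, on `H_{a,0}^b(R^*)` for boundary subdomains and on
`H_{a,0}(R^*)` for interior ones. -/
def nWidth (n : ℕ) : ℝ≥0∞ :=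
  P.nWidthOn A (if P.IsBoundary Ω then P.Hab Ω A else P.Ha0 A) n

end Patch

/-! ### The ring-based method -/

/-- The functions computed on one subdomain: the particular functions `ψ`, `ψb`, the `n`
eigenpairs `(v k, μ k)` on the oversampling ring and the fillings `vt k`. -/
structure LocalData (d n : ℕ) where
  ψ : E d → ℝ
  ψb : E d → ℝ
  μ : Fin n → ℝ
  v : Fin n → E d → ℝ
  vt : Fin n → E d → ℝ

/-- The local problems of the method on one subdomain. -/
structure LocalData.Solves {n : ℕ} (L : LocalData d n) (Ω : Set (E d))
    (A : E d → Matrix (Fin d) (Fin d) ℝ) (f g : E d → ℝ) (P : Patch d) : Prop where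
  ψ_mem : MemH10 P.Ws L.ψ
  ψ_eq : ∀ w, MemH10 P.Ws w → form A P.Ws L.ψ w = load f P.Ws w
  ψb_dirichlet : P.IsBoundary Ω →
    MemH1 P.Ws L.ψb ∧ VanishesOn P.Ws (frontier P.Ws ∩ frontier Ω) (L.ψb - g)
  ψb_eq : P.IsBoundary Ω →
    ∀ w, VanishesOn P.Ws (frontier P.Ws ∩ frontier Ω) w → form A P.Ws L.ψb w = 0
  eigenpairs : P.IsFirstEigenpairs Ω A n L.v L.μ
  filling : ∀ k, P.IsHarmonicFilling Ω A (L.v k) (L.vt k)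

open Classical in
/-- The local particular function: `ψ` for interior and `ψ + ψb` for boundary subdomains. -/
def LocalData.particular {n : ℕ} (L : LocalData d n) (Ω : Set (E d)) (P : Patch d) : E d → ℝ :=
  if P.IsBoundary Ω then L.ψ + L.ψb else L.ψ

/-- The local approximation space: the span of the extended eigenfunctions. -/
def LocalData.space {n : ℕ} (L : LocalData d n) (P : Patch d) : Submodule ℝ (E d → ℝ) :=
  Submodule.span ℝ (Set.range fun k => P.ext (L.v k) (L.vt k))

/-- The global approximation space `{∑ χ_i φ_i : φ_i ∈ S_i}`. -/
def globalSpace {M : ℕ} {n : Fin M → ℕ} (P : Fin M → Patch d) (L : ∀ i, LocalData d (n i)) :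
    Set (E d → ℝ) :=
  {w | ∃ φ : Fin M → E d → ℝ, (∀ i, φ i ∈ (L i).space (P i)) ∧ w = ∑ i, (P i).χ * φ i}

/-- The global particular function `u^p = ∑ χ_i u_i^p`. -/
def globalParticular {M : ℕ} {n : Fin M → ℕ} (Ω : Set (E d)) (P : Fin M → Patch d)
    (L : ∀ i, LocalData d (n i)) : E d → ℝ :=
  ∑ i, (P i).χ * (L i).particular Ω (P i)

/-- `uG = u^p + u^s`, `u^s` in the global approximation space `S`, is the GFEM solution:
`a(u^s, v) = F(v) - a(u^p, v)` for all `v ∈ S`. -/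
def IsGFEMSolution {M : ℕ} {n : Fin M → ℕ} (Ω : Set (E d)) (A : E d → Matrix (Fin d) (Fin d) ℝ)
    (f : E d → ℝ) (P : Fin M → Patch d) (L : ∀ i, LocalData d (n i)) (uG : E d → ℝ) : Prop :=
  ∃ us ∈ globalSpace P L, uG =ᵐ[volume.restrict Ω] globalParticular Ω P L + us ∧
    ∀ v ∈ globalSpace P L, form A Ω us v = load f Ω v - form A Ω (globalParticular Ω P L) v

open Classical in
/-- The maximum over the subdomains of `d_{n_i - 1}(R_i, R_i^*)` (interior subdomains) and
`d_{n_i}(R_i, R_i^*)` (boundary subdomains). -/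
def maxWidth {M : ℕ} (Ω : Set (E d)) (A : E d → Matrix (Fin d) (Fin d) ℝ) (P : Fin M → Patch d)
    (n : Fin M → ℕ) : ℝ≥0∞ :=
  ⨆ i, (P i).nWidth Ω A (if (P i).IsBoundary Ω then n i else n i - 1)

end RingGFEM

end

noncomputable section

namespace RingGFEM

section

variable {d : ℕ}

/-! ### Test functions -/

/-! On each patch subtract the particular function. The remainder z = u - u_i^p is operator-harmonic
on ω*, has zero trace on ∂ω* ∩ ∂Ω and, by orthogonality, at most the energy of u on ω*
(`LocalData.Solves.exists_remainder`). Everything rests on approximating such a z by extended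
eigenfunctions, in the energy of χ(z - φ).

The approximation takes place on the ring. On the operator-harmonic functions on R* with zero trace
on the Dirichlet part, let a be the energy on R*, B(v,w) = a_R(χ^R v, χ^R w), and N the L² form on
R*. Caccioppoli's inequality (`IsRing.bForm_self_le`) bounds B by N, and Rellich's theorem
(`IsLipschitzOpen.exists_subseq`) makes N compact relative to a + N. Let y be z minus its
B-projection onto the first n eigenfunctions v_k. Then B(y,y) ≤ D² a(y,y) for every D above the
width (`IsCompactPair.le_of_width`). Otherwise B/a attains on the B-complement of the v_k a maximum
σ > D² at some w. This w is an eigenfunction with eigenvalue 1/σ outside the span of the v_k, so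
every listed eigenvalue is at most 1/σ, and σa ≤ B on the (n+1)-dimensional span of the v_k and w. A
nontrivial combination is annihilated by the at most n functionals that express orthogonality to a
nearly optimal width space. There B ≤ D² a, so its energy vanishes, it is a null vector, and linear
independence fails. No spectral theorem is needed, only the existence of one maximiser.

For interior patches the constants lie in the kernel of a. Since n ≥ 1, the constant 1 is a
combination of the listed eigenfunctions (`IsCompactPair.exists_kernel_combination`), and the
constraint M^R v = 0 is B(1,v) = 0. This constraint uses up one functional, hence the index n - 1.
If B(1,1) = 0, then B vanishes on the diagonal and there is nothing to prove.

Passing from the ring to Ω loses nothing (`IsFilled.exists_extension`): χ v^ext differs from the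
zero extension of χ^R v by a function of H¹₀(ω̃), and is operator-harmonic on ω̃, so it has the
smaller energy. Finite overlap, used once for the ω_i and once for the ω_i*, sums the local errors,
and Galerkin orthogonality (`IsGFEMSolution.aint_le`) finishes.

Weak gradients are carried as explicit data next to the functions, so that the forms are exactly
bilinear before any passage to a.e. classes. Traces enter only through closures; the bridge between
partial zero traces and H¹₀ is `HasVan.mul_hasH10`. -/

theorem enorm_integral_smul_le {α F : Type*} [MeasurableSpace α] {μ : Measure α}
    [NormedAddCommGroup F] [NormedSpace ℝ F] {f : α → ℝ} {g : α → F}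
    (hf : AEStronglyMeasurable f μ) (hg : AEStronglyMeasurable g μ) :
    ‖∫ x, f x • g x ∂μ‖ₑ ≤ eLpNorm f 2 μ * eLpNorm g 2 μ := by
  refine (enorm_integral_le_lintegral_enorm _).trans ?_
  have := eLpNorm_smul_le_mul_eLpNorm (p := 2) (q := 2) (r := 1) hg hf
  rwa [eLpNorm_one_eq_lintegral_enorm] at this

theorem integrable_smul_of_memLp_two {α F : Type*} [MeasurableSpace α] {μ : Measure α}
    [NormedAddCommGroup F] [NormedSpace ℝ F] {f : α → ℝ} {g : α → F}
    (hf : MemLp f 2 μ) (hg : MemLp g 2 μ) : Integrable (fun x => f x • g x) μ := by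
  have := MemLp.smul (p := 2) (q := 2) (r := 1) hg hf
  exact memLp_one_iff_integrable.1 this

namespace IsTestFunction

variable {S T : Set (E d)} {φ ψ : E d → ℝ}

theorem mono (h : IsTestFunction S φ) (hST : S ⊆ T) : IsTestFunction T φ :=
  ⟨h.1, h.2.1, h.2.2.trans hST⟩

theorem zero : IsTestFunction S (0 : E d → ℝ) :=
  ⟨contDiff_const, HasCompactSupport.zero, by simp [tsupport]⟩

theorem add (h : IsTestFunction S φ) (h' : IsTestFunction S ψ) : IsTestFunction S (φ + ψ) :=
  ⟨h.1.add h'.1, h.2.1.add h'.2.1,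
    (tsupport_add φ ψ).trans (union_subset h.2.2 h'.2.2)⟩

theorem smul (c : ℝ) (h : IsTestFunction S φ) : IsTestFunction S (c • φ) :=
  ⟨contDiff_const.smul h.1, h.2.1.smul_left (f := fun _ => c),
    (closure_mono (Function.support_const_smul_subset c φ)).trans h.2.2⟩

theorem mul_left (h : IsTestFunction S φ) (hψ : ContDiff ℝ ∞ ψ) : IsTestFunction S (ψ * φ) :=
  ⟨hψ.mul h.1, h.2.1.mul_left, (tsupport_mul_subset_right).trans h.2.2⟩

theorem mul_tsupport (h : IsTestFunction T φ) (hψ : ContDiff ℝ ∞ ψ) (hS : tsupport ψ ⊆ S) :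
    IsTestFunction S (ψ * φ) :=
  ⟨hψ.mul h.1, h.2.1.mul_left, (tsupport_mul_subset_left).trans hS⟩

theorem continuous (h : IsTestFunction S φ) : Continuous φ := h.1.continuous

theorem differentiable (h : IsTestFunction S φ) : Differentiable ℝ φ :=
  h.1.differentiable (by simp)

end IsTestFunction

theorem continuous_gradient {φ : E d → ℝ} (h : ContDiff ℝ ∞ φ) : Continuous (gradient φ) :=
  (InnerProductSpace.toDual ℝ (E d)).symm.continuous.comp (h.continuous_fderiv (by simp))

theorem gradient_eq_zero_of_notMem {φ : E d → ℝ} {x : E d} (h : x ∉ tsupport φ) :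
    gradient φ x = 0 := by
  have : fderiv ℝ φ x = 0 := by
    by_contra h0
    exact h (support_fderiv_subset ℝ h0)
  simp [gradient, this]

theorem gradient_add_apply {φ ψ : E d → ℝ} {x : E d} (h : DifferentiableAt ℝ φ x)
    (h' : DifferentiableAt ℝ ψ x) : gradient (φ + ψ) x = gradient φ x + gradient ψ x := by
  simp [gradient, fderiv_add h h']

theorem gradient_smul_apply {φ : E d → ℝ} {x : E d} (c : ℝ) (h : DifferentiableAt ℝ φ x) :
    gradient (c • φ) x = c • gradient φ x := by
  simp [gradient, fderiv_const_smul h]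

theorem gradient_mul_apply {φ ψ : E d → ℝ} {x : E d} (h : DifferentiableAt ℝ φ x)
    (h' : DifferentiableAt ℝ ψ x) :
    gradient (φ * ψ) x = φ x • gradient ψ x + ψ x • gradient φ x := by
  simp [gradient, fderiv_mul h h']

namespace IsTestFunction

variable {S T : Set (E d)} {φ ψ : E d → ℝ}

theorem hasCompactSupport_gradient (h : IsTestFunction S φ) : HasCompactSupport (gradient φ) :=
  HasCompactSupport.intro h.2.1 fun _ hx => gradient_eq_zero_of_notMem hx

theorem eq_zero_of_notMem (h : IsTestFunction S φ) {x : E d} (hx : x ∉ S) : φ x = 0 :=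
  image_eq_zero_of_notMem_tsupport fun hx' => hx (h.2.2 hx')

theorem gradient_eq_zero_of_notMem (h : IsTestFunction S φ) {x : E d} (hx : x ∉ S) :
    gradient φ x = 0 :=
  RingGFEM.gradient_eq_zero_of_notMem fun hx' => hx (h.2.2 hx')

theorem memLp (h : IsTestFunction S φ) (p : ℝ≥0∞) {μ : Measure (E d)}
    [IsFiniteMeasureOnCompacts μ] : MemLp φ p μ :=
  h.continuous.memLp_of_hasCompactSupport h.2.1

theorem memLp_gradient (h : IsTestFunction S φ) (p : ℝ≥0∞) {μ : Measure (E d)}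
    [IsFiniteMeasureOnCompacts μ] : MemLp (gradient φ) p μ :=
  (continuous_gradient h.1).memLp_of_hasCompactSupport h.hasCompactSupport_gradient

end IsTestFunction

/-! ### Weak gradients -/

/-- `v ∈ L²(S)` with weak gradient `G ∈ L²(S)`. -/
structure HasWG (S : Set (E d)) (v : E d → ℝ) (G : E d → E d) : Prop where
  memLp : MemLp v 2 (volume.restrict S)
  memLp_grad : MemLp G 2 (volume.restrict S)
  isWeakGrad : IsWeakGrad S v G

variable {S T : Set (E d)} {v w : E d → ℝ} {G H : E d → E d}

theorem MemH1.hasWG (h : MemH1 S v) : HasWG S v (weakGrad S v) := by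
  have hs := h.2
  refine ⟨h.1, ?_, ?_⟩
  · rw [weakGrad, dif_pos hs]; exact hs.choose_spec.1
  · rw [weakGrad, dif_pos hs]; exact hs.choose_spec.2

namespace HasWG

theorem memH1 (h : HasWG S v G) : MemH1 S v := ⟨h.memLp, G, h.memLp_grad, h.isWeakGrad⟩

theorem congr (h : HasWG S v G) (hv : v =ᵐ[volume.restrict S] w)
    (hG : G =ᵐ[volume.restrict S] H) : HasWG S w H := by
  refine ⟨h.memLp.ae_eq hv, h.memLp_grad.ae_eq hG, fun φ hφ => ?_⟩
  rw [← integral_congr_ae (f := fun x => v x • gradient φ x), h.isWeakGrad φ hφ]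
  · congr 1
    apply integral_congr_ae
    filter_upwards [hG] with x hx
    simp [hx]
  · filter_upwards [hv] with x hx
    simp [hx]

theorem zero : HasWG S (0 : E d → ℝ) 0 :=
  ⟨MemLp.zero, MemLp.zero, fun φ _ => by simp⟩

theorem add (h : HasWG S v G) (h' : HasWG S w H) : HasWG S (v + w) (G + H) := by
  refine ⟨h.memLp.add h'.memLp, h.memLp_grad.add h'.memLp_grad, fun φ hφ => ?_⟩
  have h1 := h.isWeakGrad φ hφ
  have h2 := h'.isWeakGrad φ hφ
  simp only [Pi.add_apply, add_smul, smul_add]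
  rw [integral_add, integral_add, h1, h2, neg_add]
  · exact integrable_smul_of_memLp_two (hφ.memLp 2) h.memLp_grad
  · exact integrable_smul_of_memLp_two (hφ.memLp 2) h'.memLp_grad
  · exact integrable_smul_of_memLp_two h.memLp (hφ.memLp_gradient 2)
  · exact integrable_smul_of_memLp_two h'.memLp (hφ.memLp_gradient 2)

theorem smul (c : ℝ) (h : HasWG S v G) : HasWG S (c • v) (c • G) := by
  refine ⟨h.memLp.const_smul c, h.memLp_grad.const_smul c, fun φ hφ => ?_⟩
  have h1 := h.isWeakGrad φ hφ
  simp only [Pi.smul_apply, smul_comm _ c (_ : E d), smul_assoc]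
  rw [integral_smul, integral_smul, h1, smul_neg]

theorem neg (h : HasWG S v G) : HasWG S (-v) (-G) := by
  simpa using h.smul (-1)

theorem sub (h : HasWG S v G) (h' : HasWG S w H) : HasWG S (v - w) (G - H) := by
  simpa [sub_eq_add_neg] using h.add h'.neg

theorem mono (h : HasWG S v G) (hTS : T ⊆ S) : HasWG T v G := by
  refine ⟨h.memLp.mono_measure (Measure.restrict_mono hTS le_rfl),
    h.memLp_grad.mono_measure (Measure.restrict_mono hTS le_rfl), fun φ hφ => ?_⟩
  have h1 := h.isWeakGrad φ (hφ.mono hTS)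
  -- Both integrands vanish off T, so integrals over S and over T equal those over the whole space,
  -- without measurability of either set.
  have e1 : ∀ U : Set (E d), T ⊆ U →
      ∫ x in U, v x • gradient φ x = ∫ x, v x • gradient φ x := fun U hU =>
    setIntegral_eq_integral_of_forall_compl_eq_zero fun x hx => by
      rw [hφ.gradient_eq_zero_of_notMem fun hx' => hx (hU hx'), smul_zero]
  have e2 : ∀ U : Set (E d), T ⊆ U → ∫ x in U, φ x • G x = ∫ x, φ x • G x := fun U hU =>
    setIntegral_eq_integral_of_forall_compl_eq_zero fun x hx => by
      rw [hφ.eq_zero_of_notMem fun hx' => hx (hU hx'), zero_smul]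
  rw [e1 T le_rfl, e2 T le_rfl, ← e1 S hTS, ← e2 S hTS, h1]

/-- Weak gradients are unique. -/
theorem unique (hS : IsOpen S) (h : HasWG S v G) (h' : HasWG S v H) :
    G =ᵐ[volume.restrict S] H := by
  have hd := (h.sub h').memLp_grad
  have key : ∀ᵐ x ∂(volume : Measure (E d)), x ∈ S → (G - H) x = 0 := by
    -- The difference of two gradients is a weak gradient of 0, hence orthogonal to all test
    -- functions; the fundamental lemma of the calculus of variations applies.
    refine hS.ae_eq_zero_of_integral_contDiff_smul_eq_zero ?_ ?_
    · have : LocallyIntegrable (G - H) (volume.restrict S) := hd.locallyIntegrable (by norm_num)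
      rw [locallyIntegrableOn_iff hS.isLocallyClosed]
      intro K hKS hK
      have := this.integrableOn_isCompact hK
      rwa [IntegrableOn, Measure.restrict_restrict_of_subset hKS] at this
    · intro φ h1 h2 h3
      have h0 := (h.sub h').isWeakGrad φ ⟨h1, h2, h3⟩
      simp only [sub_self, Pi.zero_apply, zero_smul, integral_zero] at h0
      rw [← setIntegral_eq_integral_of_forall_compl_eq_zero (s := S)]
      · rw [zero_eq_neg] at h0; exact h0
      · intro x hx
        rw [IsTestFunction.eq_zero_of_notMem (S := S) ⟨h1, h2, h3⟩ hx, zero_smul]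
  rw [Filter.EventuallyEq, ae_restrict_iff' hS.measurableSet]
  filter_upwards [key] with x hx hxS
  exact sub_eq_zero.1 (hx hxS)

theorem ae_eq_weakGrad (hS : IsOpen S) (h : HasWG S v G) :
    weakGrad S v =ᵐ[volume.restrict S] G :=
  h.memH1.hasWG.unique hS h

/-- Limits in `L²` of functions and weak gradients. -/
theorem of_tendsto (hv : MemLp v 2 (volume.restrict S)) (hG : MemLp G 2 (volume.restrict S))
    (h : ∀ ε : ℝ≥0∞, ε ≠ 0 → ∃ v' G', HasWG S v' G' ∧
      eLpNorm (v - v') 2 (volume.restrict S) ≤ ε ∧ eLpNorm (G - G') 2 (volume.restrict S) ≤ ε) :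
    HasWG S v G := by
  refine ⟨hv, hG, fun φ hφ => ?_⟩
  have hφ2 := hφ.memLp 2 (μ := volume.restrict S)
  have hg2 := hφ.memLp_gradient 2 (μ := volume.restrict S)
  rw [← sub_eq_zero, ← enorm_eq_zero, ← nonpos_iff_eq_zero]
  set C := eLpNorm (gradient φ) 2 (volume.restrict S) + eLpNorm φ 2 (volume.restrict S) with hC
  have hCt : C ≠ ⊤ := ENNReal.add_ne_top.2 ⟨hg2.eLpNorm_ne_top, hφ2.eLpNorm_ne_top⟩
  have key : ∀ ε : ℝ≥0∞, ε ≠ 0 →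
      ‖(∫ x in S, v x • gradient φ x) - -∫ x in S, φ x • G x‖ₑ ≤ ε * C := by
    intro ε hε
    obtain ⟨v', G', h', h1, h2⟩ := h ε hε
    -- The pair (v', G') satisfies the integration by parts formula exactly, so the defect of (v, G)
    -- is that of the differences.
    have e : (∫ x in S, v x • gradient φ x) - -∫ x in S, φ x • G x
        = (∫ x in S, (v - v') x • gradient φ x) + ∫ x in S, φ x • (G - G') x := by
      have := h'.isWeakGrad φ hφ
      simp only [Pi.sub_apply, sub_smul, smul_sub]
      rw [integral_sub (integrable_smul_of_memLp_two hv hg2)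
        (integrable_smul_of_memLp_two h'.memLp hg2),
        integral_sub (integrable_smul_of_memLp_two hφ2 hG)
        (integrable_smul_of_memLp_two hφ2 h'.memLp_grad), this]
      abel
    rw [e]
    refine (enorm_add_le _ _).trans ?_
    rw [hC, mul_add]
    refine add_le_add ?_ ?_
    · exact (enorm_integral_smul_le (hv.sub h'.memLp).1 hg2.1).trans (by gcongr)
    · refine (enorm_integral_smul_le hφ2.1 (hG.sub h'.memLp_grad).1).trans ?_
      rw [mul_comm]; gcongr
  refine le_of_forall_pos_le_add fun ε hε => ?_
  rw [zero_add]
  by_cases hC0 : C = 0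
  · exact (key 1 one_ne_zero).trans (by simp [hC0])
  · refine (key (ε / C) (ENNReal.div_ne_zero.2 ⟨hε.ne', hCt⟩)).trans ?_
    rw [ENNReal.div_mul_cancel hC0 hCt]

end HasWG

theorem integral_smul_gradient {φ ψ : E d → ℝ} (hφ : IsTestFunction univ φ)
    (hψ : ContDiff ℝ ∞ ψ) : ∫ x, ψ x • gradient φ x = -∫ x, φ x • gradient ψ x := by
  have hψd : Differentiable ℝ ψ := hψ.differentiable (by simp)
  have i1 : Integrable (fun x => ψ x • gradient φ x) :=
    (hψ.continuous.smul (continuous_gradient hφ.1)).integrable_of_hasCompactSupport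
      hφ.hasCompactSupport_gradient.smul_left
  have i2 : Integrable (fun x => φ x • gradient ψ x) :=
    (hφ.continuous.smul (continuous_gradient hψ)).integrable_of_hasCompactSupport
      hφ.2.1.smul_right
  have i3 : Integrable (fun x => ψ x * φ x) :=
    (hψ.continuous.mul hφ.continuous).integrable_of_hasCompactSupport hφ.2.1.mul_left
  refine ext_inner_right ℝ fun y => ?_
  rw [inner_neg_left, real_inner_comm, ← integral_inner i1, real_inner_comm,
    ← integral_inner i2]
  have := integral_mul_fderiv_eq_neg_fderiv_mul_of_integrable (μ := (volume : Measure (E d)))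
    (f := ψ) (g := φ) (v := y) ?_ ?_ i3 (fun x _ => hψd x) (fun x _ => hφ.differentiable x)
  · simp only [inner_smul_right, inner_gradient_right, conj_trivial]
    rw [this]
    congr 2
    ext x
    ring
  · refine (i2.const_inner y).congr (ae_of_all _ fun x => ?_)
    simp only [inner_smul_right, inner_gradient_right, conj_trivial]
    ring
  · refine (i1.const_inner y).congr (ae_of_all _ fun x => ?_)
    simp only [inner_smul_right, inner_gradient_right, conj_trivial]

theorem IsTestFunction.hasWG {φ : E d → ℝ} (hφ : IsTestFunction T φ) :
    HasWG S φ (gradient φ) := by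
  refine HasWG.mono (S := univ) ⟨hφ.memLp 2, hφ.memLp_gradient 2, fun ψ hψ => ?_⟩ (subset_univ _)
  simpa using integral_smul_gradient hψ hφ.1

theorem hasWG_const (hS : volume S ≠ ⊤) (c : ℝ) : HasWG S (fun _ => c) 0 := by
  have : IsFiniteMeasure (volume.restrict S) := ⟨by simpa using hS.lt_top⟩
  refine ⟨memLp_const c, MemLp.zero, fun φ hφ => ?_⟩
  have := integral_smul_gradient (hφ.mono (subset_univ _)) (contDiff_const (c := c))
  simp only [gradient_fun_const, smul_zero, integral_zero, neg_zero, Pi.zero_apply] at this ⊢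
  rw [setIntegral_eq_integral_of_forall_compl_eq_zero, this]
  intro x hx
  rw [hφ.gradient_eq_zero_of_notMem hx, smul_zero]

/-- Product with a smooth compactly supported function. -/
theorem HasWG.smooth_mul (h : HasWG S v G) {θ : E d → ℝ} (hθ : IsTestFunction T θ) :
    HasWG S (θ * v) (fun x => θ x • G x + v x • gradient θ x) := by
  have b1 : MemLp θ ∞ (volume.restrict S) := hθ.memLp ∞
  have b2 : MemLp (gradient θ) ∞ (volume.restrict S) := hθ.memLp_gradient ∞
  have m1 : MemLp (fun x => θ x • G x) 2 (volume.restrict S) :=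
    MemLp.smul (p := ∞) (q := 2) (r := 2) h.memLp_grad b1
  have m2 : MemLp (fun x => v x • gradient θ x) 2 (volume.restrict S) :=
    MemLp.smul (p := 2) (q := ∞) (r := 2) b2 h.memLp
  refine ⟨MemLp.smul (p := ∞) (q := 2) (r := 2) h.memLp b1, m1.add m2, fun φ hφ => ?_⟩
  have hφ2 := hφ.memLp 2 (μ := volume.restrict S)
  have hg2 := hφ.memLp_gradient 2 (μ := volume.restrict S)
  have hθφ : IsTestFunction S (θ * φ) := hφ.mul_left hθ.1
  have h0 := h.isWeakGrad _ hθφ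
  have e1 : ∀ x, v x • gradient (θ * φ) x
      = (θ * v) x • gradient φ x + φ x • (v x • gradient θ x) := fun x => by
    rw [gradient_mul_apply (hθ.differentiable x) (hφ.differentiable x), Pi.mul_apply]
    module
  have i1 : Integrable (fun x => (θ * v) x • gradient φ x) (volume.restrict S) :=
    integrable_smul_of_memLp_two (MemLp.smul (p := ∞) (q := 2) (r := 2) h.memLp b1) hg2
  have i2 := integrable_smul_of_memLp_two hφ2 m2
  have i3 := integrable_smul_of_memLp_two hφ2 m1
  rw [integral_congr_ae (ae_of_all _ e1), integral_add i1 i2] at h0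
  simp only [smul_add]
  rw [integral_add i3 i2]
  have e2 : ∫ x in S, (θ * φ) x • G x = ∫ x in S, φ x • θ x • G x := by
    congr 1; ext1 x; rw [Pi.mul_apply]; module
  rw [e2] at h0
  rw [eq_sub_of_add_eq h0]
  abel

/-- Cut-off functions. -/
theorem exists_cutoff {K : Set (E d)} (hK : IsCompact K) (hS : IsOpen S) (hKS : K ⊆ S) :
    ∃ θ : E d → ℝ, IsTestFunction S θ ∧ (∀ x, θ x ∈ Icc (0 : ℝ) 1) ∧
      ∃ O, IsOpen O ∧ K ⊆ O ∧ O ⊆ S ∧ ∀ x ∈ O, θ x = 1 := by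
  -- Two compact shells: the cut-off is 1 on L, a neighbourhood of K, and supported in L', so its
  -- topological support stays inside S.
  obtain ⟨L, hL, hKL, hLS⟩ := exists_compact_between hK hS hKS
  obtain ⟨L', hL', hLL', hLS'⟩ := exists_compact_between hL hS hLS
  obtain ⟨f, hf, hr, hs, h1⟩ := exists_contMDiff_support_eq_eq_one_iff
    (modelWithCornersSelf ℝ (E d)) (n := ⊤) isOpen_interior hL.isClosed hLL'
  have ht : tsupport f ⊆ L' := by
    rw [tsupport, hs]
    exact closure_minimal interior_subset hL'.isClosed
  refine ⟨f, ⟨hf.contDiff, HasCompactSupport.of_support_subset_isCompact hL' ?_, ht.trans hLS'⟩,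
    fun x => hr ⟨x, rfl⟩, interior L, isOpen_interior, hKL, interior_subset.trans hLS,
    fun x hx => (h1 x).1 (interior_subset hx)⟩
  rw [hs]; exact interior_subset

/-- Extension by zero of a function that vanishes off a compact subset. -/
theorem HasWG.indicator_of_compact (hS : IsOpen S) (h : HasWG S v G) {K : Set (E d)}
    (hK : IsCompact K) (hKS : K ⊆ S) (hv : ∀ x ∈ S, x ∉ K → v x = 0) :
    HasWG univ (K.indicator v) (K.indicator G) := by
  have hG : ∀ᵐ x ∂volume.restrict S, x ∉ K → G x = 0 := by
    have ho : IsOpen (S \ K) := hS.sdiff hK.isClosed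
    have h0 : HasWG (S \ K) v 0 := HasWG.zero.congr
      ((ae_restrict_iff' ho.measurableSet).2 (ae_of_all _ fun x hx => (hv x hx.1 hx.2).symm))
      (ae_eq_refl _)
    have := (h.mono sdiff_subset).unique ho h0
    rw [Filter.EventuallyEq, ae_restrict_iff' ho.measurableSet] at this
    rw [ae_restrict_iff' hS.measurableSet]
    filter_upwards [this] with x hx hxS hxK
    exact hx ⟨hxS, hxK⟩
  have hKm := hK.measurableSet
  have mono := h.mono hKS
  refine ⟨?_, ?_, fun φ hφ => ?_⟩
  · rw [Measure.restrict_univ, memLp_indicator_iff_restrict hKm]; exact mono.memLp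
  · rw [Measure.restrict_univ, memLp_indicator_iff_restrict hKm]; exact mono.memLp_grad
  -- For an arbitrary φ on the whole space, θφ is a test function in S that agrees with φ near K,
  -- where the integrands live.
  · obtain ⟨θ, hθ, -, O, hO, hKO, -, hO1⟩ := exists_cutoff hK hS hKS
    have h0 := h.isWeakGrad _ (hφ.mul_tsupport hθ.1 hθ.2.2)
    have e0 : ∀ x ∈ K, gradient (θ * φ) x = gradient φ x := fun x hx => by
      refine Filter.EventuallyEq.gradient_eq ?_
      filter_upwards [hO.mem_nhds (hKO hx)] with y hy
      simp [hO1 y hy]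
    have e1 : ∫ x in S, v x • gradient (θ * φ) x
        = ∫ x in univ, K.indicator v x • gradient φ x := by
      rw [Measure.restrict_univ]
      refine Eq.trans ?_ (setIntegral_eq_integral_of_forall_compl_eq_zero (s := S) ?_)
      · refine setIntegral_congr_fun hS.measurableSet fun x hx => ?_
        by_cases hxK : x ∈ K
        · simp [hxK, e0 x hxK]
        · simp [hxK, hv x hx hxK]
      · intro x hx
        rw [indicator_of_notMem fun hx' => hx (hKS hx'), zero_smul]
    have e2 : ∫ x in S, (θ * φ) x • G x = ∫ x in univ, φ x • K.indicator G x := by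
      rw [Measure.restrict_univ]
      refine Eq.trans ?_ (setIntegral_eq_integral_of_forall_compl_eq_zero (s := S) ?_)
      · refine integral_congr_ae ?_
        filter_upwards [hG] with x hx
        by_cases hxK : x ∈ K
        · simp [hxK, hO1 x (hKO hxK)]
        · simp [hxK, hx hxK]
      · intro x hx
        rw [indicator_of_notMem fun hx' => hx (hKS hx'), smul_zero]
    rw [← e1, ← e2, h0]

end

section

variable {d : ℕ}

/-! ### Mollification -/

theorem eLpNorm_two_sq {α F : Type*} [MeasurableSpace α] [NormedAddCommGroup F] (f : α → F)
    (μ : Measure α) : eLpNorm f 2 μ ^ 2 = ∫⁻ x, ‖f x‖ₑ ^ 2 ∂μ := by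
  have := eLpNorm_nnreal_pow_eq_lintegral (μ := μ) (f := f) (p := 2) two_ne_zero
  simpa using this

/-- Averages of translates. -/
theorem eLpNorm_average_translate_sub_le {F : Type*} [NormedAddCommGroup F] [NormedSpace ℝ F]
    [CompleteSpace F]
    (ν : Measure (E d)) [IsProbabilityMeasure ν] {G : E d → F} (hG : StronglyMeasurable G)
    (hint : ∀ x, Integrable (fun z => G (x - z)) ν) (V : Set (E d)) {δ : ℝ≥0∞}
    (h : ∀ᵐ z ∂ν, eLpNorm (fun x => G (x - z) - G x) 2 (volume.restrict V) ≤ δ) :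
    eLpNorm (fun x => (∫ z, G (x - z) ∂ν) - G x) 2 (volume.restrict V) ≤ δ := by
  have hm : StronglyMeasurable (Function.uncurry fun x z : E d => G (x - z) - G x) := by
    refine StronglyMeasurable.sub ?_ ?_
    · exact hG.comp_measurable (measurable_fst.sub measurable_snd)
    · exact hG.comp_measurable measurable_fst
  have hm2 : Measurable (Function.uncurry fun x z : E d => ‖G (x - z) - G x‖ₑ ^ 2) :=
    hm.enorm.pow_const 2
  have hz : ∀ x : E d, StronglyMeasurable fun z : E d => G (x - z) - G x := fun x =>
    hm.comp_measurable (measurable_const.prodMk measurable_id)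
  -- Minkowski's integral inequality in squared form: Jensen for the probability measure ν, then
  -- Tonelli.
  suffices H : eLpNorm (fun x => (∫ z, G (x - z) ∂ν) - G x) 2 (volume.restrict V) ^ 2 ≤ δ ^ 2 by
    exact (ENNReal.pow_le_pow_left_iff two_ne_zero).1 H
  rw [eLpNorm_two_sq]
  calc ∫⁻ x in V, ‖(∫ z, G (x - z) ∂ν) - G x‖ₑ ^ 2
      ≤ ∫⁻ x in V, ∫⁻ z, ‖G (x - z) - G x‖ₑ ^ 2 ∂ν := by
        refine lintegral_mono fun x => ?_
        have e : (∫ z, G (x - z) ∂ν) - G x = ∫ z, (G (x - z) - G x) ∂ν := by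
          rw [integral_sub (hint x) (integrable_const _)]; simp
        rw [e, ← eLpNorm_two_sq]
        gcongr
        refine (enorm_integral_le_lintegral_enorm _).trans ?_
        rw [← eLpNorm_one_eq_lintegral_enorm]
        exact eLpNorm_le_eLpNorm_of_exponent_le (by norm_num) (hz x).aestronglyMeasurable
    _ = ∫⁻ z, (∫⁻ x in V, ‖G (x - z) - G x‖ₑ ^ 2) ∂ν :=
        lintegral_lintegral_swap hm2.aemeasurable
    _ ≤ ∫⁻ _, δ ^ 2 ∂ν := by
        refine lintegral_mono_ae ?_
        filter_upwards [h] with z hz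
        rw [← eLpNorm_two_sq]
        gcongr
    _ = δ ^ 2 := by simp

/-- Translation is continuous in L². This is continuity of composition with a continuous family of
measure preserving maps, taken at z = 0. -/
theorem exists_eLpNorm_translate_sub_le {F : Type*} [NormedAddCommGroup F]
    {G : E d → F} (hG : MemLp G 2 volume) {ε : ℝ≥0∞} (hε : ε ≠ 0) :
    ∃ δ > 0, ∀ z : E d, ‖z‖ < δ → eLpNorm (fun x => G (x - z) - G x) 2 volume ≤ ε := by
  let T : C(E d, C(E d, E d)) := ContinuousMap.curry ⟨fun p => p.2 - p.1, by fun_prop⟩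
  have hT : ∀ z, MeasurePreserving (T z) volume volume := fun z =>
    measurePreserving_sub_right volume z
  have hc : Continuous fun z => Lp.compMeasurePreserving (T z) (hT z) (hG.toLp G) :=
    Continuous.compMeasurePreservingLp continuous_const T.continuous hT (by norm_num)
  have h0 := hc.tendsto 0
  rw [EMetric.tendsto_nhds] at h0
  have := h0 ε (pos_iff_ne_zero.2 hε)
  obtain ⟨δ, hδ, h⟩ := Metric.eventually_nhds_iff.1 this
  refine ⟨δ, hδ, fun z hz => ?_⟩
  have h1 := (h (y := z) (by simpa using hz)).le
  rw [Lp.toLp_compMeasurePreserving, Lp.toLp_compMeasurePreserving, Lp.edist_toLp_toLp] at h1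
  refine le_trans (le_of_eq (congrArg (fun f => eLpNorm f 2 volume) ?_)) h1
  ext x
  simp [T]

/-- The mollifying measure. -/
def bumpMeasure {c : E d} (b : ContDiffBump c) : Measure (E d) :=
  volume.withDensity fun z => ENNReal.ofReal (b.normed volume z)

/-! ### Averaging against a normalised bump. -/

section bump
variable {c : E d} (b : ContDiffBump c)

theorem measurable_bump_ofReal : Measurable fun z => (b.normed volume z).toNNReal :=
  b.continuous_normed.measurable.real_toNNReal

theorem integral_bumpMeasure {F : Type*} [NormedAddCommGroup F] [NormedSpace ℝ F]
    (G : E d → F) : ∫ z, G z ∂bumpMeasure b = ∫ z, b.normed volume z • G z := by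
  have := integral_withDensity_eq_integral_smul (μ := volume) (measurable_bump_ofReal b) G
  rw [bumpMeasure]
  refine this.trans ?_
  congr 1; ext z
  rw [NNReal.smul_def, Real.coe_toNNReal _ (b.nonneg_normed z)]

instance : IsProbabilityMeasure (bumpMeasure b) := by
  constructor
  rw [bumpMeasure, withDensity_apply _ MeasurableSet.univ, Measure.restrict_univ,
    ← ofReal_integral_eq_lintegral_ofReal b.integrable_normed
      (ae_of_all _ b.nonneg_normed), b.integral_normed, ENNReal.ofReal_one]

theorem integrable_bumpMeasure {F : Type*} [NormedAddCommGroup F] [NormedSpace ℝ F]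
    {G : E d → F} (hG : LocallyIntegrable G volume) : Integrable G (bumpMeasure b) := by
  have := integrable_withDensity_iff_integrable_smul (μ := volume) (measurable_bump_ofReal b)
    (g := G)
  rw [bumpMeasure]
  refine this.2 ?_
  have h := hG.integrable_smul_left_of_hasCompactSupport b.continuous_normed
    (b.hasCompactSupport_normed (μ := volume))
  refine h.congr (ae_of_all _ fun z => ?_)
  simp only [NNReal.smul_def, Real.coe_toNNReal _ (b.nonneg_normed z)]

theorem ae_bumpMeasure : ∀ᵐ z ∂bumpMeasure b, z ∈ Metric.ball c b.rOut := by
  rw [bumpMeasure, ae_withDensity_iff (b.continuous_normed (μ := volume)).measurable.ennreal_ofReal]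
  refine ae_of_all _ fun z hz => ?_
  have hs : Function.support (b.normed (volume : Measure (E d))) = Metric.ball c b.rOut :=
    b.support_normed_eq
  rw [← hs]
  intro h0
  simp [h0] at hz

/-- `x ↦ ∫ G(x - z) dν(z)`. -/
def bumpAverage {F : Type*} [NormedAddCommGroup F] [NormedSpace ℝ F] (G : E d → F) (x : E d) : F :=
  ∫ z, b.normed volume z • G (x - z)

theorem bumpAverage_eq {F : Type*} [NormedAddCommGroup F] [NormedSpace ℝ F] (G : E d → F)
    (x : E d) : bumpAverage b G x = ∫ t, b.normed volume (x - t) • G t := by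
  rw [bumpAverage, ← integral_sub_left_eq_self _ volume x]
  simp

theorem bumpAverage_congr {F : Type*} [NormedAddCommGroup F] [NormedSpace ℝ F] {G H : E d → F}
    (h : G =ᵐ[volume] H) : bumpAverage b G = bumpAverage b H := by
  ext x
  rw [bumpAverage_eq, bumpAverage_eq]
  refine integral_congr_ae ?_
  filter_upwards [h] with t ht
  rw [ht]

/-- Tonelli requires a jointly measurable integrand, so G is replaced by a strongly measurable
representative; the averages, being integrals, do not change. -/
theorem eLpNorm_bumpAverage_sub_le {F : Type*} [NormedAddCommGroup F] [NormedSpace ℝ F]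
    [CompleteSpace F] {G : E d → F} (hG : MemLp G 2 volume) (V : Set (E d)) {δ : ℝ≥0∞}
    (h : ∀ z ∈ Metric.ball c b.rOut,
      eLpNorm (fun x => G (x - z) - G x) 2 (volume.restrict V) ≤ δ) :
    eLpNorm (fun x => bumpAverage b G x - G x) 2 (volume.restrict V) ≤ δ := by
  set G' := hG.1.mk G with hG'
  have hGG : G =ᵐ[volume] G' := hG.1.ae_eq_mk
  have hm : StronglyMeasurable G' := hG.1.stronglyMeasurable_mk
  have hL : MemLp G' 2 volume := hG.ae_eq hGG
  have hI : ∀ x, Integrable (fun z => G' (x - z)) (bumpMeasure b) := fun x => by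
    refine integrable_bumpMeasure b ?_
    have : MemLp (fun z => G' (x - z)) 2 volume :=
      hL.comp_measurePreserving (Measure.measurePreserving_sub_left volume x)
    exact this.locallyIntegrable (by norm_num)
  have hGV : G =ᵐ[volume.restrict V] G' := ae_restrict_of_ae hGG
  have key := eLpNorm_average_translate_sub_le (bumpMeasure b) hm hI V (δ := δ) ?_
  · refine le_trans (le_of_eq (eLpNorm_congr_ae ?_)) key
    filter_upwards [hGV] with x hx
    rw [integral_bumpMeasure, hx, bumpAverage_congr b hGG]
    rfl
  · filter_upwards [ae_bumpMeasure b] with z hz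
    refine le_trans (le_of_eq (eLpNorm_congr_ae ?_)) (h z hz)
    have h2 : ∀ᵐ x ∂(volume : Measure (E d)), G (x - z) = G' (x - z) :=
      (measurePreserving_sub_right volume z).quasiMeasurePreserving.ae hGG
    filter_upwards [hGV, ae_restrict_of_ae h2] with x h1 h2
    rw [h1, h2]

open scoped Convolution in
theorem bumpAverage_eq_convolution (G : E d → ℝ) :
    bumpAverage b G = (b.normed volume) ⋆[ContinuousLinearMap.lsmul ℝ ℝ, volume] G := by
  ext x
  rfl

theorem contDiff_bumpAverage {G : E d → ℝ} (hG : LocallyIntegrable G volume) :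
    ContDiff ℝ ∞ (bumpAverage b G) := by
  rw [bumpAverage_eq_convolution]
  exact b.hasCompactSupport_normed.contDiff_convolution_left _ b.contDiff_normed hG

/-- For fixed x the kernel t ↦ ρ(x - t) is a test function. Differentiation under the integral falls
on ρ, and the weak gradient identity moves it to v. -/
theorem gradient_bumpAverage {v : E d → ℝ} {G : E d → E d} (h : HasWG univ v G) (x : E d) :
    gradient (bumpAverage b v) x = bumpAverage b G x := by
  have hv := h.memLp.locallyIntegrable (by norm_num)
  have hG := h.memLp_grad.locallyIntegrable (by norm_num)
  rw [Measure.restrict_univ] at hv hG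
  set ρ := b.normed volume with hρ
  have hρs : ContDiff ℝ ∞ ρ := b.contDiff_normed
  have hρc : HasCompactSupport ρ := b.hasCompactSupport_normed
  have hd := hρc.hasFDerivAt_convolution_left (μ := volume)
    (ContinuousLinearMap.lsmul ℝ ℝ) (hρs.of_le (by simp)) hv x
  have hgr : ∀ t, gradient (fun t => ρ (x - t)) t = - gradient ρ (x - t) := fun t => by
    have h1 : HasFDerivAt (fun t => x - t) (-ContinuousLinearMap.id ℝ (E d)) t := by
      simpa using (hasFDerivAt_id t).const_sub x
    have h2 : HasFDerivAt ρ (fderiv ℝ ρ (x - t)) (x - t) :=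
      (hρs.differentiable (by simp) _).hasFDerivAt
    have h3 := (HasFDerivAt.comp t h2 h1).fderiv
    refine ext_inner_right ℝ fun y => ?_
    rw [inner_neg_left, inner_gradient_left, inner_gradient_left]
    have : fderiv ℝ (fun t => ρ (x - t)) t = _ := h3
    rw [this]
    simp
  have htest : IsTestFunction univ fun t => ρ (x - t) :=
    ⟨hρs.comp (contDiff_const.sub contDiff_id),
      hρc.comp_homeomorph (Homeomorph.subLeft x), subset_univ _⟩
  have hw := h.isWeakGrad _ htest
  rw [Measure.restrict_univ] at hw
  simp only [hgr, smul_neg, integral_neg, neg_inj] at hw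
  rw [bumpAverage_eq, ← hw]
  have hcont : Continuous (gradient ρ) := continuous_gradient hρs
  have hcs : HasCompactSupport (gradient ρ) :=
    IsTestFunction.hasCompactSupport_gradient (S := univ) ⟨hρs, hρc, subset_univ _⟩
  have i1 : Integrable fun t => v t • gradient ρ (x - t) := by
    exact hv.integrable_smul_right_of_hasCompactSupport
      (hcont.comp (continuous_const.sub continuous_id))
      (hcs.comp_homeomorph (Homeomorph.subLeft x))
  refine ext_inner_right ℝ fun y => ?_
  rw [inner_gradient_left, bumpAverage_eq_convolution, hd.fderiv, real_inner_comm,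
    ← integral_inner i1, convolution_eq_swap, ContinuousLinearMap.integral_apply]
  · refine integral_congr_ae (ae_of_all _ fun t => ?_)
    simp only [ContinuousLinearMap.precompL_apply, inner_smul_right, inner_gradient_right,
      conj_trivial]
    simp [mul_comm]
  · have : ConvolutionExistsAt (fderiv ℝ ρ) v x
      (ContinuousLinearMap.precompL (E d) (ContinuousLinearMap.lsmul ℝ ℝ)) volume :=
      (hρc.fderiv ℝ).convolutionExists_left _ (hρs.continuous_fderiv (by simp)) hv x
    exact this.integrable_swap

end bump

/-- Compactly supported `H¹` functions are limits of test functions. -/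
theorem HasWG.exists_testFunction {v : E d → ℝ} {G : E d → E d} (h : HasWG univ v G)
    {K S : Set (E d)} (hK : IsCompact K) (hS : IsOpen S) (hKS : K ⊆ S)
    (hv : ∀ x, x ∉ K → v x = 0) {ε : ℝ≥0∞} (hε : ε ≠ 0) :
    ∃ φ, IsTestFunction S φ ∧ eLpNorm (v - φ) 2 volume ≤ ε ∧
      eLpNorm (G - gradient φ) 2 volume ≤ ε := by
  have hv2 := h.memLp
  have hG2 := h.memLp_grad
  rw [Measure.restrict_univ] at hv2 hG2
  obtain ⟨r, hr, hrS⟩ := hK.exists_cthickening_subset_open hS hKS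
  obtain ⟨δ₁, hδ₁, h₁⟩ := exists_eLpNorm_translate_sub_le hv2 hε
  obtain ⟨δ₂, hδ₂, h₂⟩ := exists_eLpNorm_translate_sub_le hG2 hε
  -- The radius r keeps the support of the average inside S; δ₁ and δ₂ make the translation errors
  -- of v and of G at most ε.
  set s := min r (min δ₁ δ₂) with hs
  have hs0 : 0 < s := lt_min hr (lt_min hδ₁ hδ₂)
  let b : ContDiffBump (0 : E d) := ⟨s / 2, s, by positivity, by linarith⟩
  have hsupp : Function.support (bumpAverage b v) ⊆ Metric.cthickening r K := by
    intro x hx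
    by_contra hxK
    refine hx ?_
    rw [bumpAverage]
    refine integral_eq_zero_of_ae (ae_of_all _ fun z => ?_)
    by_cases hz : z ∈ Metric.ball (0 : E d) s
    · have : x - z ∉ K := fun hxz => hxK (Metric.mem_cthickening_of_dist_le x (x - z) r K hxz (by
        have : ‖z‖ < s := by simpa using hz
        simpa using (this.le.trans (min_le_left _ _))))
      simp [hv _ this]
    · have : b.normed volume z = 0 := by
        rw [← Function.notMem_support, b.support_normed_eq]; exact hz
      simp [this]
  have hcl : IsClosed (Metric.cthickening r K) := Metric.isClosed_cthickening
  have e : gradient (bumpAverage b v) = bumpAverage b G := funext (gradient_bumpAverage b h)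
  refine ⟨bumpAverage b v, ⟨contDiff_bumpAverage b (hv2.locallyIntegrable (by norm_num)),
    HasCompactSupport.of_support_subset_isCompact hK.cthickening hsupp,
    (closure_minimal hsupp hcl).trans hrS⟩, ?_, ?_⟩
  · rw [← eLpNorm_neg, neg_sub]
    have := eLpNorm_bumpAverage_sub_le b hv2 univ (δ := ε) fun z hz => by
      rw [Measure.restrict_univ]
      exact h₁ z (lt_of_lt_of_le (show ‖z‖ < s by simpa [b] using hz) ((min_le_right _ _).trans (min_le_left _ _)))
    rwa [Measure.restrict_univ] at this
  · rw [← eLpNorm_neg, neg_sub, e]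
    have := eLpNorm_bumpAverage_sub_le b hG2 univ (δ := ε) fun z hz => by
      rw [Measure.restrict_univ]
      exact h₂ z (lt_of_lt_of_le (show ‖z‖ < s by simpa [b] using hz) ((min_le_right _ _).trans (min_le_right _ _)))
    rwa [Measure.restrict_univ] at this

end

section

variable {d : ℕ}

/-! ### Product and chain rules -/

theorem eq_zero_of_enorm_le_mul {F : Type*} [NormedAddCommGroup F] {x : F} {C : ℝ≥0∞}
    (hC : C ≠ ⊤) (h : ∀ ε : ℝ≥0∞, ε ≠ 0 → ‖x‖ₑ ≤ ε * C) : x = 0 := by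
  rw [← enorm_eq_zero, ← nonpos_iff_eq_zero]
  refine le_of_forall_pos_le_add fun ε hε => ?_
  rw [zero_add]
  by_cases hC0 : C = 0
  · exact (h 1 one_ne_zero).trans (by simp [hC0])
  · refine (h (ε / C) (ENNReal.div_ne_zero.2 ⟨hε.ne', hC⟩)).trans ?_
    rw [ENNReal.div_mul_cancel hC0 hC]

variable {S U K R : Set (E d)} {v w c : E d → ℝ} {G H k : E d → E d}

/-- The support lies in the smaller open set R while closeness is measured on all of U. This is what
later produces members of H¹₀(R) from functions given on U. -/
theorem HasWG.exists_testFunction_of_compact (hU : IsOpen U) (h : HasWG U v G)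
    (hK : IsCompact K) (hR : IsOpen R) (hKR : K ⊆ R) (hRU : R ⊆ U)
    (hv : ∀ x ∈ U, x ∉ K → v x = 0) {ε : ℝ≥0∞} (hε : ε ≠ 0) :
    ∃ φ, IsTestFunction R φ ∧ eLpNorm (v - φ) 2 (volume.restrict U) ≤ ε ∧
      eLpNorm (G - gradient φ) 2 (volume.restrict U) ≤ ε := by
  have hi := h.indicator_of_compact hU hK (hKR.trans hRU) hv
  have ev : ∀ x ∈ U, K.indicator v x = v x := fun x hx => by
    by_cases hxK : x ∈ K
    · simp [hxK]
    · simp [hxK, hv x hx hxK]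
  have ev' : K.indicator v =ᵐ[volume.restrict U] v :=
    (ae_restrict_iff' hU.measurableSet).2 (ae_of_all _ ev)
  have eG : K.indicator G =ᵐ[volume.restrict U] G :=
    ((hi.mono (subset_univ U)).congr ev' (ae_eq_refl _)).unique hU h
  obtain ⟨φ, hφ, h1, h2⟩ := hi.exists_testFunction hK hR hKR
    (fun x hx => indicator_of_notMem hx _) hε
  refine ⟨φ, hφ, ?_, ?_⟩
  · refine le_trans (le_of_eq (eLpNorm_congr_ae (ev'.symm.sub (ae_eq_refl φ)))) ?_
    exact (eLpNorm_mono_measure _ Measure.restrict_le_self).trans h1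
  · refine le_trans (le_of_eq (eLpNorm_congr_ae (eG.symm.sub (ae_eq_refl (gradient φ))))) ?_
    exact (eLpNorm_mono_measure _ Measure.restrict_le_self).trans h2

/-- Integration by parts between two H¹ functions needs compact support of only one of them:
approximate that one by test functions and use Cauchy–Schwarz for the errors. -/
theorem HasWG.integral_smul_compact (hU : IsOpen U) (h : HasWG U v G) (hw : HasWG U w H)
    (hK : IsCompact K) (hKU : K ⊆ U) (hw0 : ∀ x ∈ U, x ∉ K → w x = 0) :
    ∫ x in U, v x • H x = -∫ x in U, w x • G x := by
  rw [← add_eq_zero_iff_eq_neg]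
  refine eq_zero_of_enorm_le_mul (C := eLpNorm v 2 (volume.restrict U)
    + eLpNorm G 2 (volume.restrict U))
    (ENNReal.add_ne_top.2 ⟨h.memLp.eLpNorm_ne_top, h.memLp_grad.eLpNorm_ne_top⟩) fun ε hε => ?_
  obtain ⟨φ, hφ, h1, h2⟩ := hw.exists_testFunction_of_compact hU hK hU hKU le_rfl hw0 hε
  have hφ2 := hφ.memLp 2 (μ := volume.restrict U)
  have hg2 := hφ.memLp_gradient 2 (μ := volume.restrict U)
  have e : (∫ x in U, v x • H x) + ∫ x in U, w x • G x
      = (∫ x in U, v x • (H - gradient φ) x) + ∫ x in U, (w - φ) x • G x := by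
    have := h.isWeakGrad φ hφ
    simp only [Pi.sub_apply, sub_smul, smul_sub]
    rw [integral_sub (integrable_smul_of_memLp_two h.memLp hw.memLp_grad)
      (integrable_smul_of_memLp_two h.memLp hg2),
      integral_sub (integrable_smul_of_memLp_two hw.memLp h.memLp_grad)
      (integrable_smul_of_memLp_two hφ2 h.memLp_grad), this]
    abel
  rw [e, mul_add]
  refine (enorm_add_le _ _).trans (add_le_add ?_ ?_)
  · refine (enorm_integral_smul_le h.memLp.1 (hw.memLp_grad.sub hg2).1).trans ?_
    rw [mul_comm]; gcongr
  · exact (enorm_integral_smul_le (hw.memLp.sub hφ2).1 h.memLp_grad.1).trans (by gcongr)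

/-- Product rule. -/
theorem HasWG.isWeakGrad_mul (hU : IsOpen U) (hc : HasWG U c k) (h : HasWG U v G) :
    IsWeakGrad U (c * v) (fun x => c x • G x + v x • k x) := by
  intro φ hφ
  -- The product rule follows by testing the weak gradient of v with φc, an H¹ function of compact
  -- support.
  have hφc := hc.smooth_mul hφ
  have h0 := h.integral_smul_compact hU hφc hφ.2.1 hφ.2.2 fun x _ hx => by
    rw [Pi.mul_apply, image_eq_zero_of_notMem_tsupport hx, zero_mul]
  obtain ⟨C, hC⟩ := hφ.2.1.exists_bound_of_continuous hφ.continuous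
  obtain ⟨C', hC'⟩ := hφ.hasCompactSupport_gradient.exists_bound_of_continuous
    (continuous_gradient hφ.1)
  have m1 : MemLp (fun x => v x • φ x) 2 (volume.restrict U) :=
    (hφ.memLp ∞).smul h.memLp
  have m1' : MemLp (fun x => φ x • c x) 2 (volume.restrict U) :=
    MemLp.smul (p := ∞) (q := 2) (r := 2) hc.memLp (hφ.memLp ∞)
  have m2 : MemLp (fun x => c x • gradient φ x) 2 (volume.restrict U) :=
    MemLp.smul (p := 2) (q := ∞) (r := 2) (hφ.memLp_gradient ∞) hc.memLp
  have i1 : Integrable (fun x => φ x • v x • k x) (volume.restrict U) := by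
    refine (integrable_smul_of_memLp_two m1 hc.memLp_grad).congr (ae_of_all _ fun x => ?_)
    simp only [smul_eq_mul]; module
  have i2 : Integrable (fun x => (c * v) x • gradient φ x) (volume.restrict U) := by
    refine (integrable_smul_of_memLp_two h.memLp m2).congr (ae_of_all _ fun x => ?_)
    simp only [Pi.mul_apply]; module
  have i3 : Integrable (fun x => φ x • c x • G x) (volume.restrict U) := by
    refine (integrable_smul_of_memLp_two m1' h.memLp_grad).congr (ae_of_all _ fun x => ?_)
    simp only [smul_eq_mul]; module
  have e1 : ∫ x in U, v x • (φ x • k x + c x • gradient φ x)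
      = (∫ x in U, φ x • v x • k x) + ∫ x in U, (c * v) x • gradient φ x := by
    rw [← integral_add i1 i2]
    congr 1; ext1 x; simp only [Pi.mul_apply]; module
  have e2 : ∫ x in U, (φ * c) x • G x = ∫ x in U, φ x • c x • G x := by
    congr 1; ext1 x; simp only [Pi.mul_apply]; module
  rw [e1, e2] at h0
  simp only [smul_add]
  rw [integral_add i3 i1, eq_sub_of_add_eq' h0]
  abel

/-- A function of `H¹` that is bounded by `C` together with its weak gradient. -/
structure HasBddWG (U : Set (E d)) (c : E d → ℝ) (k : E d → E d) (C : ℝ) : Prop extends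
    HasWG U c k where
  bound : ∀ᵐ x ∂volume.restrict U, |c x| ≤ C
  bound_grad : ∀ᵐ x ∂volume.restrict U, ‖k x‖ ≤ C

theorem MemLp.smul_of_bound {α F : Type*} [MeasurableSpace α] {μ : Measure α}
    [NormedAddCommGroup F] [NormedSpace ℝ F] {f : α → ℝ} {g : α → F} {C : ℝ}
    (hf : AEStronglyMeasurable f μ) (hb : ∀ᵐ x ∂μ, |f x| ≤ C) (hg : MemLp g 2 μ) :
    MemLp (fun x => f x • g x) 2 μ := by
  refine hg.of_le_mul (c := C) (hf.smul hg.1) ?_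
  filter_upwards [hb] with x hx
  rw [norm_smul]
  gcongr
  exact hx

theorem MemLp.smul_of_bound_right {α F : Type*} [MeasurableSpace α] {μ : Measure α}
    [NormedAddCommGroup F] [NormedSpace ℝ F] {f : α → ℝ} {g : α → F} {C : ℝ}
    (hf : MemLp f 2 μ) (hb : ∀ᵐ x ∂μ, ‖g x‖ ≤ C) (hg : AEStronglyMeasurable g μ) :
    MemLp (fun x => f x • g x) 2 μ := by
  refine hf.of_le_mul (c := C) (hf.1.smul hg) ?_
  filter_upwards [hb] with x hx
  rw [norm_smul, mul_comm]
  gcongr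

theorem HasBddWG.mul (hU : IsOpen U) {C : ℝ} (hc : HasBddWG U c k C) (h : HasWG U v G) :
    HasWG U (c * v) (fun x => c x • G x + v x • k x) :=
  ⟨MemLp.smul_of_bound hc.memLp.1 hc.bound h.memLp,
    (MemLp.smul_of_bound hc.memLp.1 hc.bound h.memLp_grad).add
      (MemLp.smul_of_bound_right h.memLp hc.bound_grad hc.memLp_grad.1),
    hc.toHasWG.isWeakGrad_mul hU h⟩

theorem HasBddWG.mono {C : ℝ} {V : Set (E d)} (hc : HasBddWG U c k C) (hV : V ⊆ U) :
    HasBddWG V c k C :=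
  ⟨hc.toHasWG.mono hV, ae_restrict_of_ae_restrict_of_subset hV hc.bound,
    ae_restrict_of_ae_restrict_of_subset hV hc.bound_grad⟩

theorem HasBddWG.mul_self (hU : IsOpen U) {C : ℝ} (hc : HasBddWG U c k C) :
    HasBddWG U (c * c) (fun x => c x • k x + c x • k x) (2 * C ^ 2 + C ^ 2) := by
  refine ⟨hc.mul hU hc.toHasWG, ?_, ?_⟩
  · filter_upwards [hc.bound] with x hx
    rw [Pi.mul_apply, abs_mul]
    nlinarith [abs_nonneg (c x)]
  · filter_upwards [hc.bound, hc.bound_grad] with x hx hx'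
    refine (norm_add_le _ _).trans ?_
    rw [norm_smul, Real.norm_eq_abs]
    nlinarith [abs_nonneg (c x), norm_nonneg (k x),
      mul_le_mul hx hx' (norm_nonneg _) ((abs_nonneg _).trans hx)]

theorem HasBddWG.sub {C C' : ℝ} {c' : E d → ℝ} {k' : E d → E d} (hc : HasBddWG U c k C)
    (hc' : HasBddWG U c' k' C') : HasBddWG U (c - c') (k - k') (C + C') := by
  refine ⟨hc.toHasWG.sub hc'.toHasWG, ?_, ?_⟩
  · filter_upwards [hc.bound, hc'.bound] with x hx hx'
    exact (abs_sub _ _).trans (add_le_add hx hx')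
  · filter_upwards [hc.bound_grad, hc'.bound_grad] with x hx hx'
    exact (norm_sub_le _ _).trans (add_le_add hx hx')

theorem ae_norm_le_eLpNorm_top {α F : Type*} [MeasurableSpace α] {μ : Measure α}
    [NormedAddCommGroup F] {f : α → F} (hf : MemLp f ∞ μ) :
    ∀ᵐ x ∂μ, ‖f x‖ ≤ (eLpNorm f ∞ μ).toReal := by
  filter_upwards [enorm_ae_le_eLpNormEssSup f μ] with x hx
  rw [← eLpNorm_exponent_top] at hx
  rw [← toReal_enorm]
  exact ENNReal.toReal_mono hf.eLpNorm_ne_top hx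

theorem MemW1Inf.exists_hasBddWG (hU : volume U ≠ ⊤) (h : MemW1Inf U c) :
    ∃ k C, HasBddWG U c k C := by
  have : IsFiniteMeasure (volume.restrict U) := ⟨by simpa using hU.lt_top⟩
  obtain ⟨-, h1, k, h2, h3⟩ := h
  refine ⟨k, max (eLpNorm c ∞ (volume.restrict U)).toReal
    (eLpNorm k ∞ (volume.restrict U)).toReal,
    ⟨⟨h1.mono_exponent le_top, h2.mono_exponent le_top, h3⟩, ?_, ?_⟩⟩
  · filter_upwards [ae_norm_le_eLpNorm_top h1] with x hx
    exact hx.trans (le_max_left _ _)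
  · filter_upwards [ae_norm_le_eLpNorm_top h2] with x hx
    exact hx.trans (le_max_right _ _)

/-- Chain rule. -/
theorem HasWG.comp (hU : IsOpen U) (hUf : volume U ≠ ⊤) (hc : HasWG U c k) {f f' : ℝ → ℝ} {C : ℝ}
    {L : NNReal} (hf : ContDiff ℝ ∞ f) (hf' : ∀ t, HasDerivAt f (f' t) t)
    (hC : ∀ t, |f' t| ≤ C) (hL : LipschitzWith L f') :
    HasWG U (f ∘ c) (fun x => f' (c x) • k x) := by
  have : IsFiniteMeasure (volume.restrict U) := ⟨by simpa using hUf.lt_top⟩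
  have hC0 : 0 ≤ C := (abs_nonneg _).trans (hC 0)
  have hfL : ∀ s t, |f s - f t| ≤ C * |s - t| := fun s t => by
    have := Convex.norm_image_sub_le_of_norm_hasDerivWithin_le (f := f) (f' := f') (s := univ)
      (x := t) (y := s) (C := C) (fun x _ => (hf' x).hasDerivWithinAt) (fun x _ => hC x)
      convex_univ trivial trivial
    simpa using this
  have bd : ∀ g : E d → ℝ, MemLp g 2 (volume.restrict U) →
      MemLp (fun x => f (g x)) 2 (volume.restrict U) := fun g hg => by
    refine ((memLp_const |f 0|).add (hg.norm.const_mul C)).of_le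
      (hf.continuous.comp_aestronglyMeasurable hg.1) (ae_of_all _ fun x => ?_)
    have := hfL (g x) 0
    have h2 : |f (g x)| ≤ |f 0| + C * |g x| := by
      have := abs_sub_abs_le_abs_sub (f (g x)) (f 0)
      simp only [sub_zero] at *
      linarith
    simpa using h2.trans (le_abs_self _)
  have bd' : ∀ (g : E d → ℝ) (P : E d → E d), AEStronglyMeasurable g (volume.restrict U) →
      MemLp P 2 (volume.restrict U) → MemLp (fun x => f' (g x) • P x) 2 (volume.restrict U) :=
    fun g P hg hP => MemLp.smul_of_bound (hL.continuous.comp_aestronglyMeasurable hg)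
      (ae_of_all _ fun x => hC _) hP
  refine ⟨bd c hc.memLp, bd' c k hc.memLp.1 hc.memLp_grad, fun φ hφ => ?_⟩
  -- Replacing c by θc changes nothing on the support of φ and gives compact support, so that test
  -- functions approximate it.
  obtain ⟨θ, hθ, -, O, hO, hKO, -, hO1⟩ := exists_cutoff hφ.2.1 hU hφ.2.2
  have hφ2 := hφ.memLp 2 (μ := volume.restrict U)
  have hg2 := hφ.memLp_gradient 2 (μ := volume.restrict U)
  obtain ⟨B, hB⟩ := hφ.2.1.exists_bound_of_continuous hφ.continuous
  have hB0 : 0 ≤ B := (norm_nonneg _).trans (hB 0)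
  have hψ := hc.smooth_mul hθ
  set ψ := θ * c with hψd
  set P : E d → E d := fun x => θ x • k x + c x • gradient θ x with hPd
  have eψ : ∀ x ∈ tsupport φ, ψ x = c x := fun x hx => by simp [hψd, hO1 x (hKO hx)]
  have eP : ∀ x ∈ tsupport φ, P x = k x := fun x hx => by
    have : gradient θ x = 0 := by
      have h1 : θ =ᶠ[nhds x] fun _ => 1 := by
        filter_upwards [hO.mem_nhds (hKO hx)] with y hy using hO1 y hy
      rw [h1.gradient_eq, gradient_fun_const]
    simp [hPd, hO1 x (hKO hx), this]
  have e1 : ∫ x in U, (f ∘ c) x • gradient φ x = ∫ x in U, f (ψ x) • gradient φ x := by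
    congr 1; ext1 x
    by_cases hx : x ∈ tsupport φ
    · simp [eψ x hx]
    · simp [gradient_eq_zero_of_notMem hx]
  have e2 : ∫ x in U, φ x • f' (c x) • k x = ∫ x in U, φ x • f' (ψ x) • P x := by
    congr 1; ext1 x
    by_cases hx : x ∈ tsupport φ
    · simp [eψ x hx, eP x hx]
    · simp [image_eq_zero_of_notMem_tsupport hx]
  rw [e1, e2, ← add_eq_zero_iff_eq_neg]
  set b₁ := eLpNorm (gradient φ) 2 (volume.restrict U)
  set b₂ := eLpNorm φ 2 (volume.restrict U)
  set b₃ := eLpNorm P 2 (volume.restrict U)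
  refine eq_zero_of_enorm_le_mul (C := ENNReal.ofReal C * b₁ + (ENNReal.ofReal C * b₂
      + ENNReal.ofReal (B * L) * b₃)) ?_ fun ε hε => ?_
  · have h1 := hg2.eLpNorm_ne_top
    have h2 := hφ2.eLpNorm_ne_top
    have h3 := hψ.memLp_grad.eLpNorm_ne_top
    finiteness
  obtain ⟨η, hη, h1, h2⟩ := hψ.exists_testFunction_of_compact hU hθ.2.1 hU hθ.2.2 le_rfl
    (fun x _ hx => by rw [hψd, Pi.mul_apply, image_eq_zero_of_notMem_tsupport hx, zero_mul]) hε
  have hη2 := hη.memLp 2 (μ := volume.restrict U)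
  have hηg := hη.memLp_gradient 2 (μ := volume.restrict U)
  have hcomp : ∫ x in U, f (η x) • gradient φ x = -∫ x in U, φ x • f' (η x) • gradient η x := by
    have h0 := integral_smul_gradient (hφ.mono (subset_univ _)) (hf.comp hη.1)
    have e3 : ∀ x, gradient (f ∘ η) x = f' (η x) • gradient η x := fun x => by
      have := (hf' (η x)).comp_hasFDerivAt x (hη.differentiable x).hasFDerivAt
      simp [gradient, this.fderiv]
    rw [setIntegral_eq_integral_of_forall_compl_eq_zero,
      setIntegral_eq_integral_of_forall_compl_eq_zero]
    · simpa only [e3, Function.comp] using h0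
    · intro x hx; rw [hφ.eq_zero_of_notMem hx, zero_smul]
    · intro x hx; rw [hφ.gradient_eq_zero_of_notMem hx, smul_zero]
  have mφ : MemLp (fun x => φ x * f' (η x)) 2 (volume.restrict U) := by
    refine hφ2.of_le_mul (c := C) (hφ2.1.mul
      (hL.continuous.comp_aestronglyMeasurable hη2.1)) (ae_of_all _ fun x => ?_)
    rw [norm_mul, mul_comm]
    gcongr
    exact hC _
  have aφ : AEStronglyMeasurable (fun x => φ x * (f' (ψ x) - f' (η x))) (volume.restrict U) :=
    hφ2.1.mul ((hL.continuous.comp_aestronglyMeasurable hψ.memLp.1).sub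
      (hL.continuous.comp_aestronglyMeasurable hη2.1))
  have bφ : ∀ x, ‖φ x * (f' (ψ x) - f' (η x))‖ ≤ (B * L) * ‖(ψ - η) x‖ := fun x => by
    rw [norm_mul, mul_assoc]
    have := hL.dist_le_mul (ψ x) (η x)
    rw [Real.dist_eq, Real.dist_eq] at this
    exact mul_le_mul (hB x) this (norm_nonneg _) hB0
  have mφ' : MemLp (fun x => φ x * (f' (ψ x) - f' (η x))) 2 (volume.restrict U) :=
    (hψ.memLp.sub hη2).of_le_mul aφ (ae_of_all _ bφ)
  have mf : MemLp (fun x => f (ψ x) - f (η x)) 2 (volume.restrict U) :=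
    (bd _ hψ.memLp).sub (bd _ hη2)
  -- Compare with the classical chain rule for the test function η. The bound on f' controls the
  -- first two differences. The third is at most BL|ψ - η||P| pointwise, thanks to the Lipschitz
  -- bound on f', so no a.e. convergent subsequence is needed.
  have e : (∫ x in U, f (ψ x) • gradient φ x) + ∫ x in U, φ x • f' (ψ x) • P x
      = (∫ x in U, (f (ψ x) - f (η x)) • gradient φ x)
        + ((∫ x in U, (φ x * f' (η x)) • (P - gradient η) x)
        + ∫ x in U, (φ x * (f' (ψ x) - f' (η x))) • P x) := by
    have i1 := integrable_smul_of_memLp_two (bd _ hψ.memLp) hg2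
    have i2 := integrable_smul_of_memLp_two (bd _ hη2) hg2
    have i3 := integrable_smul_of_memLp_two hφ2 (bd' ψ P hψ.memLp.1 hψ.memLp_grad)
    have i4 := integrable_smul_of_memLp_two hφ2 (bd' η _ hη2.1 hηg)
    rw [← integral_add (integrable_smul_of_memLp_two mφ (hψ.memLp_grad.sub hηg))
      (integrable_smul_of_memLp_two mφ' hψ.memLp_grad)]
    have e3 : ∫ x in U, ((φ x * f' (η x)) • (P - gradient η) x
        + (φ x * (f' (ψ x) - f' (η x))) • P x)
        = (∫ x in U, φ x • f' (ψ x) • P x) - ∫ x in U, φ x • f' (η x) • gradient η x := by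
      rw [← integral_sub i3 i4]
      congr 1; ext1 x; simp only [Pi.sub_apply]; module
    rw [e3]
    simp only [sub_smul]
    rw [integral_sub i1 i2, hcomp]
    abel
  rw [e, mul_add, mul_add]
  refine (enorm_add_le _ _).trans (add_le_add ?_ ((enorm_add_le _ _).trans (add_le_add ?_ ?_)))
  · refine (enorm_integral_smul_le mf.1 hg2.1).trans ?_
    rw [← mul_assoc]
    gcongr
    refine (eLpNorm_le_mul_eLpNorm_of_ae_le_mul (g := ψ - η) (c := C)
      (ae_of_all _ fun x => hfL _ _) 2).trans ?_
    rw [mul_comm]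
    gcongr
  · refine (enorm_integral_smul_le mφ.1 (hψ.memLp_grad.sub hηg).1).trans ?_
    rw [mul_comm ε]
    gcongr
    refine eLpNorm_le_mul_eLpNorm_of_ae_le_mul (ae_of_all _ fun x => ?_) 2
    rw [norm_mul, mul_comm]
    gcongr
    exact hC _
  · refine (enorm_integral_smul_le mφ'.1 hψ.memLp_grad.1).trans ?_
    rw [← mul_assoc]
    gcongr
    refine (eLpNorm_le_mul_eLpNorm_of_ae_le_mul (ae_of_all _ bφ) 2).trans ?_
    rw [mul_comm]
    gcongr

theorem tendsto_eLpNorm_of_dominated {α F F' : Type*} [MeasurableSpace α] {μ : Measure α}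
    [NormedAddCommGroup F] [NormedAddCommGroup F'] {f : ℕ → α → F} {g : α → F'} {C : ℝ}
    (hf : ∀ n, AEStronglyMeasurable (f n) μ) (hg : MemLp g 2 μ)
    (hb : ∀ n, ∀ᵐ x ∂μ, ‖f n x‖ ≤ C * ‖g x‖)
    (h : ∀ᵐ x ∂μ, Filter.Tendsto (fun n => f n x) Filter.atTop (nhds 0)) :
    Filter.Tendsto (fun n => eLpNorm (f n) 2 μ) Filter.atTop (nhds 0) := by
  have h0 : Filter.Tendsto (fun n => ∫⁻ x, ‖f n x‖ₑ ^ 2 ∂μ) Filter.atTop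
      (nhds (∫⁻ _, 0 ∂μ)) := by
    refine tendsto_lintegral_of_dominated_convergence' (fun x => (ENNReal.ofReal C * ‖g x‖ₑ) ^ 2)
      (fun n => (hf n).enorm.pow_const 2) (fun n => ?_) ?_ ?_
    · filter_upwards [hb n] with x hx
      gcongr
      rw [← ofReal_norm, ← ofReal_norm, ← ENNReal.ofReal_mul' (norm_nonneg _)]
      exact ENNReal.ofReal_le_ofReal hx
    · simp_rw [mul_pow]
      rw [lintegral_const_mul'' _ (hg.1.enorm.pow_const 2), ← eLpNorm_two_sq]
      have := hg.eLpNorm_ne_top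
      finiteness
    · filter_upwards [h] with x hx
      have := ENNReal.Tendsto.pow (n := 2) hx.enorm
      simpa using this
  simp only [← eLpNorm_two_sq, lintegral_zero] at h0
  rw [ENNReal.tendsto_nhds_zero] at h0 ⊢
  intro ε hε
  filter_upwards [h0 (ε ^ 2) (pos_iff_ne_zero.2 (pow_ne_zero 2 hε.ne'))] with n hn
  exact (ENNReal.pow_le_pow_left_iff two_ne_zero).1 hn

/-- Smooth truncation of small values. -/
theorem exists_truncation : ∃ C : ℝ, 0 ≤ C ∧ ∀ ε : ℝ, 0 < ε → ∃ f f' : ℝ → ℝ, ∃ L : NNReal,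
    ContDiff ℝ ∞ f ∧ (∀ t, HasDerivAt f (f' t) t) ∧ LipschitzWith L f' ∧ (∀ t, |f' t| ≤ C) ∧
      (∀ t, |t| ≤ ε → f t = 0) ∧ (∀ t, |f t - t| ≤ C * ε) ∧ (∀ t, 2 * ε < |t| → f' t = 1) ∧
      f' 0 = 0 := by
  -- With g(t) = t b(t), the truncation is f(t) = t - ε g(t/ε). As g is the identity on [-1, 1] and
  -- vanishes beyond 2, f kills |t| ≤ ε and is the identity for |t| > 2ε. By scaling, f' = 1 -
  -- g'(t/ε) is bounded uniformly in ε; only its Lipschitz constant depends on ε.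
  let b : ContDiffBump (0 : ℝ) := ⟨1, 2, one_pos, one_lt_two⟩
  let g : ℝ → ℝ := fun t => t * b t
  have hg : ContDiff ℝ ∞ g := contDiff_id.mul b.contDiff
  have hgc : HasCompactSupport g := b.hasCompactSupport.mul_left
  have hg' : ContDiff ℝ ∞ (deriv g) := (contDiff_infty_iff_deriv.1 hg).2
  obtain ⟨L, hL⟩ := hg'.lipschitzWith_of_hasCompactSupport hgc.deriv (by simp)
  obtain ⟨C₁, hC₁⟩ := hgc.deriv.exists_bound_of_continuous hg'.continuous
  obtain ⟨C₂, hC₂⟩ := hgc.exists_bound_of_continuous hg.continuous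
  have h1 : 0 ≤ C₁ := (norm_nonneg _).trans (hC₁ 0)
  have h2 : 0 ≤ C₂ := (norm_nonneg _).trans (hC₂ 0)
  have hgt : ∀ t, |t| ≤ 1 → g t = t := fun t ht => by
    have : b t = 1 := b.one_of_mem_closedBall (by simpa [b] using ht)
    simp [g, this]
  refine ⟨1 + C₁ + C₂, by positivity, fun ε hε => ⟨fun t => t - ε * g (t / ε),
    fun t => 1 - deriv g (t / ε), L * ‖ε⁻¹‖₊, ?_, ?_, ?_, ?_, ?_, ?_, ?_, ?_⟩⟩
  · exact contDiff_id.sub (contDiff_const.mul (hg.comp (contDiff_id.div_const ε)))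
  · intro t
    have h3 : HasDerivAt (fun t => g (t / ε)) (deriv g (t / ε) * (1 / ε)) t :=
      HasDerivAt.comp t ((hg.differentiable (by simp)) _).hasDerivAt
        ((hasDerivAt_id t).div_const ε)
    have := (hasDerivAt_id t).sub (h3.const_mul ε)
    have e : 1 - deriv g (t / ε) = 1 - ε * (deriv g (t / ε) * (1 / ε)) := by
      field_simp
    simp only [e]
    exact this
  · have h4 : LipschitzWith ‖ε⁻¹‖₊ fun t : ℝ => t / ε := by
      refine LipschitzWith.of_dist_le_mul fun s t => ?_
      rw [Real.dist_eq, Real.dist_eq, ← sub_div, abs_div, div_eq_inv_mul]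
      simp
    have := hL.comp h4
    refine LipschitzWith.of_dist_le_mul fun s t => ?_
    have h5 := this.dist_le_mul s t
    rw [Real.dist_eq] at h5 ⊢
    refine le_trans (le_of_eq ?_) h5
    rw [← abs_neg]
    congr 1
    simp
  · intro t
    have := hC₁ (t / ε)
    rw [Real.norm_eq_abs] at this
    refine (abs_sub _ _).trans ?_
    rw [abs_one]; linarith
  · intro t ht
    simp only
    rw [hgt _ (by rw [abs_div, abs_of_pos hε]; exact (div_le_one hε).2 ht)]
    field_simp
    ring
  · intro t
    have := hC₂ (t / ε)
    rw [Real.norm_eq_abs] at this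
    rw [show t - ε * g (t / ε) - t = -(ε * g (t / ε)) by ring, abs_neg, abs_mul, abs_of_pos hε,
      mul_comm]
    gcongr
    linarith
  · intro t ht
    have : t / ε ∉ tsupport g := by
      intro h
      have h3 : tsupport g ⊆ Metric.closedBall 0 2 := by
        refine (tsupport_mul_subset_right).trans ?_
        rw [b.tsupport_eq]
      have := h3 h
      rw [mem_closedBall_zero_iff, Real.norm_eq_abs, abs_div, abs_of_pos hε, div_le_iff₀ hε] at this
      linarith
    have h0 : deriv g (t / ε) = 0 := by
      by_contra h0
      exact this (support_deriv_subset h0)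
    simp [h0]
  · have : g =ᶠ[nhds 0] id := by
      filter_upwards [Metric.ball_mem_nhds (0 : ℝ) one_pos] with t ht
      exact hgt t (by simpa using (mem_ball_zero_iff.1 ht).le)
    simp [this.deriv_eq]

end

section

variable {d : ℕ}

/-! ### Translations -/

variable {S V K T : Set (E d)} {v w : E d → ℝ} {G H : E d → E d}

theorem eLpNorm_translate_le {F : Type*} [NormedAddCommGroup F] {f : E d → F} {z : E d}
    (hT : MeasurableSet T) (hf : AEStronglyMeasurable f (volume.restrict T))
    (h : ∀ x ∈ K, x - z ∈ T) :
    eLpNorm (fun x => f (x - z)) 2 (volume.restrict K) ≤ eLpNorm f 2 (volume.restrict T) := by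
  have hp := (measurePreserving_sub_right (volume : Measure (E d)) z).restrict_preimage hT
  rw [← eLpNorm_comp_measurePreserving hf hp]
  exact eLpNorm_mono_measure _ (Measure.restrict_mono h le_rfl)

/-- The fundamental theorem of calculus along the segment from x to x - z, Jensen on [0, 1], and
Tonelli; each intermediate translate of K stays in T. -/
theorem eLpNorm_translate_sub_le_of_test {φ : E d → ℝ} (hφ : IsTestFunction univ φ) {z : E d}
    (hT : MeasurableSet T) (h : ∀ x ∈ K, ∀ s ∈ Icc (0 : ℝ) 1, x - s • z ∈ T) :
    eLpNorm (fun x => φ (x - z) - φ x) 2 (volume.restrict K) ≤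
      ‖z‖ₑ * eLpNorm (gradient φ) 2 (volume.restrict T) := by
  have hc := continuous_gradient hφ.1
  have hprob : IsProbabilityMeasure ((volume : Measure ℝ).restrict (Ioc 0 1)) :=
    ⟨by simp⟩
  have hFTC : ∀ x, φ (x - z) - φ x
      = ∫ s in Ioc (0 : ℝ) 1, inner ℝ (gradient φ (x - s • z)) (-z) := fun x => by
    have hd : ∀ s ∈ uIcc (0 : ℝ) 1, HasDerivAt (fun s : ℝ => φ (x - s • z))
        (inner ℝ (gradient φ (x - s • z)) (-z)) s := fun s _ => by
      have h1 : HasDerivAt (fun s : ℝ => x - s • z) (-z) s := by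
        simpa using ((hasDerivAt_id s).smul_const z).const_sub x
      rw [inner_gradient_left]
      exact (hφ.differentiable _).hasFDerivAt.comp_hasDerivAt s h1
    have := intervalIntegral.integral_eq_sub_of_hasDerivAt hd (Continuous.intervalIntegrable
      (by fun_prop) _ _)
    rw [intervalIntegral.integral_of_le zero_le_one] at this
    rw [this]; simp
  have hmeas : Measurable (Function.uncurry fun (x : E d) (s : ℝ) =>
      ‖gradient φ (x - s • z)‖ₑ ^ 2) := by
    have : Continuous (Function.uncurry fun (x : E d) (s : ℝ) => gradient φ (x - s • z)) := by
      unfold Function.uncurry; fun_prop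
    exact this.measurable.enorm.pow_const 2
  rw [← ENNReal.pow_le_pow_left_iff two_ne_zero, eLpNorm_two_sq]
  calc ∫⁻ x in K, ‖φ (x - z) - φ x‖ₑ ^ 2
      ≤ ∫⁻ x in K, ‖z‖ₑ ^ 2 * ∫⁻ s in Ioc (0 : ℝ) 1, ‖gradient φ (x - s • z)‖ₑ ^ 2 := by
        refine lintegral_mono fun x => ?_
        rw [← eLpNorm_two_sq, ← mul_pow]
        gcongr
        rw [hFTC x]
        refine (enorm_integral_le_lintegral_enorm _).trans ?_
        calc ∫⁻ s in Ioc (0 : ℝ) 1, ‖inner ℝ (gradient φ (x - s • z)) (-z)‖ₑ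
            ≤ ∫⁻ s in Ioc (0 : ℝ) 1, ‖z‖ₑ * ‖gradient φ (x - s • z)‖ₑ := by
              refine lintegral_mono fun s => ?_
              have := norm_inner_le_norm (𝕜 := ℝ) (gradient φ (x - s • z)) (-z)
              rw [norm_neg, mul_comm] at this
              rw [← ofReal_norm, ← ofReal_norm, ← ofReal_norm, ← ENNReal.ofReal_mul (norm_nonneg _)]
              exact ENNReal.ofReal_le_ofReal this
          _ = ‖z‖ₑ * eLpNorm (fun s : ℝ => gradient φ (x - s • z)) 1
                (volume.restrict (Ioc 0 1)) := by
              rw [lintegral_const_mul' _ _ enorm_ne_top, eLpNorm_one_eq_lintegral_enorm]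
          _ ≤ _ := by
              gcongr
              exact eLpNorm_le_eLpNorm_of_exponent_le (by norm_num)
                (Continuous.aestronglyMeasurable (by fun_prop))
    _ = ‖z‖ₑ ^ 2 * ∫⁻ x in K, ∫⁻ s in Ioc (0 : ℝ) 1, ‖gradient φ (x - s • z)‖ₑ ^ 2 :=
        lintegral_const_mul' _ _ (by finiteness)
    _ = ‖z‖ₑ ^ 2 * ∫⁻ s in Ioc (0 : ℝ) 1, ∫⁻ x in K, ‖gradient φ (x - s • z)‖ₑ ^ 2 := by
        rw [lintegral_lintegral_swap hmeas.aemeasurable]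
    _ ≤ ‖z‖ₑ ^ 2 * ∫⁻ s in Ioc (0 : ℝ) 1, eLpNorm (gradient φ) 2 (volume.restrict T) ^ 2 := by
        refine mul_le_mul_right ?_ _
        refine setLIntegral_mono measurable_const fun s hs => ?_
        rw [← eLpNorm_two_sq]
        gcongr
        exact eLpNorm_translate_le hT hc.aestronglyMeasurable
          fun x hx => h x hx s (Ioc_subset_Icc_self hs)
    _ = _ := by simp [mul_pow]

/-- Monotone convergence along a compact exhaustion, which reduces estimates on an open set to
compact sets, where cut-off functions are available. -/
theorem eLpNorm_restrict_le_of_compact {F : Type*} [NormedAddCommGroup F] {f : E d → F}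
    (hV : IsOpen V) {C : ℝ≥0∞}
    (h : ∀ K, IsCompact K → K ⊆ V → eLpNorm f 2 (volume.restrict K) ≤ C) :
    eLpNorm f 2 (volume.restrict V) ≤ C := by
  obtain ⟨F, hF, hFV, hU, hm⟩ := hV.exists_iUnion_isClosed
  set K : ℕ → Set (E d) := fun n => F n ∩ Metric.closedBall 0 n with hK
  have hKm : Monotone K := fun m n hmn => inter_subset_inter (hm hmn)
    (Metric.closedBall_subset_closedBall (by exact_mod_cast hmn))
  have hKU : ⋃ n, K n = V := by
    rw [← hU]
    refine subset_antisymm (iUnion_mono fun n => inter_subset_left) fun x hx => ?_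
    obtain ⟨n, hn⟩ := mem_iUnion.1 hx
    obtain ⟨m, hmx⟩ := exists_nat_ge ‖x‖
    refine mem_iUnion.2 ⟨max n m, hm (le_max_left _ _) hn, ?_⟩
    rw [mem_closedBall_zero_iff]
    exact hmx.trans (by exact_mod_cast le_max_right n m)
  rw [← ENNReal.pow_le_pow_left_iff two_ne_zero, eLpNorm_two_sq, ← hKU,
    setLIntegral_iUnion_of_directed _ hKm.directed_le]
  refine iSup_le fun n => ?_
  rw [← eLpNorm_two_sq]
  gcongr
  exact h _ ((isCompact_closedBall _ _).inter_left (hF n)) (inter_subset_left.trans (hFV n))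

/-- On a compact K the swept set T is compact in S. Cutting w off near T does not change it on T and
makes it a limit of test functions, for which the difference quotient estimate holds. -/
theorem HasWG.eLpNorm_translate_sub_le (hS : IsOpen S) (h : HasWG S w G) (hV : IsOpen V)
    {z : E d} (hz : ∀ x ∈ V, ∀ s ∈ Icc (0 : ℝ) 1, x - s • z ∈ S) :
    eLpNorm (fun x => w (x - z) - w x) 2 (volume.restrict V) ≤
      ‖z‖ₑ * eLpNorm G 2 (volume.restrict S) := by
  refine eLpNorm_restrict_le_of_compact hV fun K hK hKV => ?_
  set T := (fun p : E d × ℝ => p.1 - p.2 • z) '' (K ×ˢ Icc (0 : ℝ) 1) with hTd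
  have hT : IsCompact T := (hK.prod isCompact_Icc).image (by fun_prop)
  have hTS : T ⊆ S := by
    rintro _ ⟨⟨x, s⟩, ⟨hx, hs⟩, rfl⟩
    exact hz x (hKV hx) s hs
  have hKT : ∀ x ∈ K, ∀ s ∈ Icc (0 : ℝ) 1, x - s • z ∈ T := fun x hx s hs =>
    ⟨(x, s), ⟨hx, hs⟩, rfl⟩
  have hKT1 : ∀ x ∈ K, x - z ∈ T := fun x hx => by
    simpa using hKT x hx 1 (by simp)
  have hKT0 : K ⊆ T := fun x hx => by simpa using hKT x hx 0 (by simp)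
  obtain ⟨θ, hθ, -, O, hO, hTO, -, hO1⟩ := exists_cutoff hT hS hTS
  have hψ := h.smooth_mul hθ
  set ψ := θ * w with hψd
  set P : E d → E d := fun x => θ x • G x + w x • gradient θ x with hPd
  have eψ : ∀ x ∈ T, ψ x = w x := fun x hx => by simp [hψd, hO1 x (hTO hx)]
  have eP : ∀ x ∈ T, P x = G x := fun x hx => by
    have : gradient θ x = 0 := by
      have h1 : θ =ᶠ[nhds x] fun _ => 1 := by
        filter_upwards [hO.mem_nhds (hTO hx)] with y hy using hO1 y hy
      rw [h1.gradient_eq, gradient_fun_const]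
    simp [hPd, hO1 x (hTO hx), this]
  have hKm := hK.measurableSet
  have hTm := hT.measurableSet
  have key : ∀ ε : ℝ≥0∞, ε ≠ 0 → eLpNorm (fun x => w (x - z) - w x) 2 (volume.restrict K)
      ≤ ‖z‖ₑ * eLpNorm G 2 (volume.restrict S) + ε * (2 + ‖z‖ₑ) := by
    intro ε hε
    obtain ⟨φ, hφ, h1, h2⟩ := hψ.exists_testFunction_of_compact hS hθ.2.1 hS hθ.2.2 le_rfl
      (fun x _ hx => by rw [hψd, Pi.mul_apply, image_eq_zero_of_notMem_tsupport hx, zero_mul]) hε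
    have hφm : AEStronglyMeasurable φ (volume.restrict T) := hφ.continuous.aestronglyMeasurable
    have hψm : AEStronglyMeasurable ψ (volume.restrict T) :=
      hψ.memLp.1.mono_measure (Measure.restrict_mono hTS le_rfl)
    have hd : AEStronglyMeasurable (ψ - φ) (volume.restrict T) := hψm.sub hφm
    have hr : volume.restrict T ≤ volume.restrict S := Measure.restrict_mono hTS le_rfl
    have a1 : eLpNorm (fun x => (ψ - φ) (x - z)) 2 (volume.restrict K) ≤ ε :=
      (eLpNorm_translate_le hTm hd hKT1).trans ((eLpNorm_mono_measure _ hr).trans h1)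
    have a2 : eLpNorm (fun x => φ (x - z) - φ x) 2 (volume.restrict K)
        ≤ ‖z‖ₑ * (eLpNorm G 2 (volume.restrict S) + ε) := by
      refine (eLpNorm_translate_sub_le_of_test (hφ.mono (subset_univ _)) hTm hKT).trans ?_
      gcongr
      have e : gradient φ = P - (P - gradient φ) := by simp
      rw [e]
      refine (eLpNorm_sub_le (hψ.memLp_grad.1.mono_measure hr)
        ((hψ.memLp_grad.1.sub (hφ.memLp_gradient 2).1).mono_measure hr) (by norm_num)).trans ?_
      refine add_le_add ?_ ((eLpNorm_mono_measure _ hr).trans h2)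
      refine le_trans (le_of_eq (eLpNorm_congr_ae ?_)) (eLpNorm_mono_measure _ hr)
      exact (ae_restrict_iff' hTm).2 (ae_of_all _ eP)
    have a3 : eLpNorm (ψ - φ) 2 (volume.restrict K) ≤ ε :=
      (eLpNorm_mono_measure _ (Measure.restrict_mono (hKT0.trans hTS) le_rfl)).trans h1
    have hz' : MeasurePreserving (fun x : E d => x - z) (volume.restrict K)
        (volume.restrict ((fun x : E d => x - z) '' K)) :=
      (measurePreserving_sub_right volume z).restrict_image_emb
        (Homeomorph.subRight z).measurableEmbedding K
    have himT : volume.restrict ((fun x : E d => x - z) '' K) ≤ volume.restrict T :=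
      Measure.restrict_mono (by rintro _ ⟨x, hx, rfl⟩; exact hKT1 x hx) le_rfl
    have m1 : AEStronglyMeasurable (fun x => (ψ - φ) (x - z)) (volume.restrict K) :=
      (hd.mono_measure himT).comp_measurePreserving hz'
    have m2 : AEStronglyMeasurable (fun x => φ (x - z) - φ x) (volume.restrict K) :=
      Continuous.aestronglyMeasurable (by have := hφ.continuous; fun_prop)
    have m3 : AEStronglyMeasurable (ψ - φ) (volume.restrict K) :=
      hd.mono_measure (Measure.restrict_mono hKT0 le_rfl)
    have e : (fun x => w (x - z) - w x) =ᵐ[volume.restrict K]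
        ((fun x => (ψ - φ) (x - z)) + fun x => φ (x - z) - φ x) - (ψ - φ) := by
      refine (ae_restrict_iff' hKm).2 (ae_of_all _ fun x hx => ?_)
      simp only [Pi.sub_apply, Pi.add_apply, eψ _ (hKT1 x hx), eψ _ (hKT0 hx)]
      ring
    rw [eLpNorm_congr_ae e]
    refine (eLpNorm_sub_le (m1.add m2) m3 (by norm_num)).trans ?_
    refine (add_le_add ((eLpNorm_add_le m1 m2 (by norm_num)).trans (add_le_add a1 a2)) a3).trans ?_
    apply le_of_eq
    ring
  refine le_of_forall_pos_le_add fun ε hε => ?_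
  have h2 : (2 + ‖z‖ₑ) ≠ 0 := by simp
  have h3 : (2 + ‖z‖ₑ) ≠ ⊤ := by finiteness
  have := key (ε / (2 + ‖z‖ₑ)) (ENNReal.div_ne_zero.2 ⟨hε.ne', h3⟩)
  rwa [ENNReal.div_mul_cancel h2 h3] at this

/-! ### Functions with vanishing weak gradient -/

/-- With zero gradient the translation estimate gives w(x - z) = w(x) for a.e. x, for each small z.
Exchanging the quantifiers by Fubini yields one x with this identity for a.e. z, and y = x - z
sweeps out the smaller ball. -/
theorem HasWG.ae_const_of_ball {p : E d} {r : ℝ} (hr : 0 < r)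
    (h : HasWG (Metric.ball p (2 * r)) w 0) :
    ∃ c : ℝ, ∀ᵐ x ∂volume.restrict (Metric.ball p (r / 2)), w x = c := by
  set B := Metric.ball p (2 * r) with hB
  have hwm := h.memLp.1
  set w' := hwm.mk w with hw'
  have hww : w =ᵐ[volume.restrict B] w' := hwm.ae_eq_mk
  have hm : StronglyMeasurable w' := hwm.stronglyMeasurable_mk
  have h' : HasWG B w' 0 := h.congr hww (ae_eq_refl _)
  have h1 : ∀ᵐ z ∂volume.restrict (Metric.ball (0 : E d) r),
      ∀ᵐ x ∂volume.restrict (Metric.ball p r), w' (x - z) = w' x := by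
    rw [ae_restrict_iff' measurableSet_ball]
    refine ae_of_all _ fun z hz => ?_
    have := h'.eLpNorm_translate_sub_le Metric.isOpen_ball (V := Metric.ball p r)
      Metric.isOpen_ball (z := z) ?_
    · simp only [eLpNorm_zero, mul_zero, nonpos_iff_eq_zero] at this
      rw [eLpNorm_eq_zero_iff _ two_ne_zero] at this
      · filter_upwards [this] with x hx
        exact sub_eq_zero.1 hx
      · exact ((hm.comp_measurable (measurable_id.sub_const z)).sub hm).aestronglyMeasurable
    · intro x hx s hs
      rw [hB, Metric.mem_ball, dist_eq_norm] at *
      have h3 : ‖s • z‖ ≤ ‖z‖ := by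
        rw [norm_smul, Real.norm_eq_abs, abs_of_nonneg hs.1]
        exact mul_le_of_le_one_left (norm_nonneg _) hs.2
      have h4 : ‖z‖ < r := by simpa using hz
      have := norm_sub_le (x - p) (s • z)
      rw [show x - s • z - p = x - p - s • z by abel]
      linarith
  rw [Measure.ae_ae_comm] at h1
  · have hpos : (volume.restrict (Metric.ball p r)) (Metric.ball p (r / 2)) ≠ 0 := by
      rw [Measure.restrict_apply measurableSet_ball, inter_eq_left.2
        (Metric.ball_subset_ball (by linarith))]
      exact (Metric.measure_ball_pos volume p (by positivity)).ne'
    obtain ⟨x, hx, hxz⟩ : ∃ x ∈ Metric.ball p (r / 2),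
        ∀ᵐ z ∂volume.restrict (Metric.ball (0 : E d) r), w' (x - z) = w' x := by
      by_contra hcon
      refine hpos (measure_mono_null (fun x hx => ?_) h1)
      exact fun h0 => hcon ⟨x, hx, h0⟩
    refine ⟨w' x, ?_⟩
    have hsub : Metric.ball p (r / 2) ⊆ B := Metric.ball_subset_ball (by linarith)
    rw [ae_restrict_iff' measurableSet_ball] at hxz ⊢
    have h2 : ∀ᵐ y ∂(volume : Measure (E d)), x - y ∈ Metric.ball (0 : E d) r →
        w' (x - (x - y)) = w' x :=
      (Measure.measurePreserving_sub_left volume x).quasiMeasurePreserving.ae hxz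
    rw [Filter.EventuallyEq, ae_restrict_iff' measurableSet_ball] at hww
    filter_upwards [h2, hww] with y hy hy' hyB
    rw [hy' (hsub hyB)]
    have := hy ?_
    · simpa using this
    · rw [mem_ball_zero_iff]
      rw [Metric.mem_ball, dist_eq_norm] at hx hyB
      have := norm_sub_le (x - p) (y - p)
      rw [show x - p - (y - p) = x - y by abel] at this
      linarith
  · refine measurableSet_eq_fun ?_ ?_
    · exact hm.measurable.comp (measurable_snd.sub measurable_fst)
    · exact hm.measurable.comp measurable_snd

/-- A function with vanishing weak gradient on a connected open set is constant. -/
theorem HasWG.exists_ae_eq_const (hS : IsOpen S) (hc : IsPreconnected S) (h : HasWG S w 0) :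
    ∃ c : ℝ, w =ᵐ[volume.restrict S] fun _ => c := by
  rcases S.eq_empty_or_nonempty with rfl | ⟨x₀, hx₀⟩
  · exact ⟨0, by simp [Filter.EventuallyEq]⟩
  have loc : ∀ x ∈ S, ∃ r > 0, ∃ c : ℝ, ∀ᵐ y ∂(volume : Measure (E d)),
      y ∈ Metric.ball x r → w y = c := fun x hx => by
    obtain ⟨r, hr, hrS⟩ := Metric.isOpen_iff.1 hS x hx
    obtain ⟨c, hc⟩ := HasWG.ae_const_of_ball (p := x) (r := r / 2) (w := w) (by positivity)
      (h.mono (by rwa [mul_div_cancel₀ r two_ne_zero]))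
    exact ⟨r / 2 / 2, by positivity, c, (ae_restrict_iff' measurableSet_ball).1 hc⟩
  choose! r hr c hcx using loc
  -- Balls around nearby points overlap in a nonempty open set, which has positive measure, so the
  -- local constants agree; preconnectedness propagates the equality.
  have hconst : ∀ x ∈ S, c x₀ = c x := fun x hx => by
    refine hc.induction₂ (fun x y => c x = c y) ?_ (fun x y z _ _ _ h1 h2 => h1.trans h2)
      (fun x y _ _ h1 => h1.symm) hx₀ hx
    intro x hx
    filter_upwards [inter_mem_nhdsWithin S (Metric.ball_mem_nhds x (hr x hx))] with y hy
    by_contra hne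
    have hopen : IsOpen (Metric.ball x (r x) ∩ Metric.ball y (r y)) :=
      Metric.isOpen_ball.inter Metric.isOpen_ball
    have hpos := hopen.measure_pos volume ⟨y, hy.2, Metric.mem_ball_self (hr y hy.1)⟩
    refine hpos.ne' ?_
    have := (hcx x hx).and (hcx y hy.1)
    refine measure_mono_null (fun z hz => ?_) this
    intro hcon
    exact hne ((hcon.1 hz.1).symm.trans (hcon.2 hz.2))
  refine ⟨c x₀, ?_⟩
  rw [Filter.EventuallyEq, ae_restrict_iff' hS.measurableSet]
  refine measure_null_of_locally_null _ fun x hx => ?_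
  have hxS : x ∈ S := by
    by_contra hxS
    exact hx fun h => absurd h hxS
  refine ⟨_, inter_mem_nhdsWithin _ (Metric.ball_mem_nhds x (hr x hxS)), ?_⟩
  refine measure_mono_null (fun z hz => ?_) (hcx x hxS)
  intro hcon
  exact hz.1 fun _ => by rw [hcon hz.2, hconst x hxS]

end

section

variable {d : ℕ}

/-! ### Compactness -/

variable {S V W : Set (E d)} {v w : E d → ℝ} {G H : E d → E d}

/-- Lipschitz sets satisfy a uniform cone condition. -/
theorem IsLipschitzOpen.exists_cone (hS : IsLipschitzOpen S) {p : E d} (hp : p ∈ closure S) :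
    ∃ r > 0, ∃ e : E d, ∃ ρ > 0, ∀ x ∈ S ∩ Metric.ball p r, ∀ z ∈ Metric.ball e ρ,
      ∀ s ∈ Icc (0 : ℝ) 1, x - s • z ∈ S := by
  by_cases hpS : p ∈ S
  · obtain ⟨r, hr, hrS⟩ := Metric.isOpen_iff.1 hS.isOpen p hpS
    refine ⟨r / 2, by positivity, 0, r / 2, by positivity, fun x hx z hz s hs => hrS ?_⟩
    have h1 := hx.2
    rw [Metric.mem_ball, dist_eq_norm] at h1 ⊢
    rw [mem_ball_zero_iff] at hz
    have h3 : ‖s • z‖ ≤ ‖z‖ := by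
      rw [norm_smul, Real.norm_eq_abs, abs_of_nonneg hs.1]
      exact mul_le_of_le_one_left (norm_nonneg _) hs.2
    have := norm_sub_le (x - p) (s • z)
    rw [show x - s • z - p = x - p - s • z by abel]
    linarith
  · have hpf : p ∈ frontier S := by rw [hS.isOpen.frontier_eq]; exact ⟨hp, hpS⟩
    obtain ⟨e₀, γ, K, r₀, he, hγ, hr₀, hx⟩ := hS.lipschitz p hpf
    have hK : (0 : ℝ) ≤ K := K.2
    -- The cone axis is -σe₀, so x - sz moves up by about sσ. A perturbation y of length below σt
    -- moves the base point by at most 2sσt, hence the graph by 2Ksσt, and costs at most sσt in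
    -- height. The choice 2Kt + 2t = 1 keeps the gain larger. Since ‖z‖ ≤ 2σ = r₀/4, points starting
    -- within r₀/2 of p stay in the chart.
    set σ := r₀ / 8 with hσ
    set t : ℝ := 1 / (2 * K + 2) with ht
    have ht0 : 0 < t := by positivity
    have ht1 : t ≤ 1 := by
      rw [ht, div_le_one (by positivity)]; linarith
    have hKt : 2 * K * t + 2 * t = 1 := by
      rw [ht]; field_simp
    have hσ0 : 0 < σ := by positivity
    refine ⟨r₀ / 2, by positivity, -(σ • e₀), σ * t, by positivity,
      fun x hxS z hz s hs => ?_⟩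
    set y := z + σ • e₀ with hy
    have hyn : ‖y‖ < σ * t := by
      rw [Metric.mem_ball, dist_eq_norm, sub_neg_eq_add] at hz; exact hz
    have hzy : z = y - σ • e₀ := by rw [hy]; abel
    have hee : inner ℝ e₀ e₀ = (1 : ℝ) := by rw [real_inner_self_eq_norm_sq, he]; norm_num
    have hey : |inner ℝ e₀ y| ≤ ‖y‖ := by
      have := abs_real_inner_le_norm e₀ y
      rwa [he, one_mul] at this
    have hez : inner ℝ e₀ z = inner ℝ e₀ y - σ := by
      rw [hzy, inner_sub_right, inner_smul_right, hee, mul_one]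
    have hzn : ‖z‖ ≤ 2 * σ := by
      rw [hzy]
      refine (norm_sub_le _ _).trans ?_
      rw [norm_smul, he, Real.norm_eq_abs, abs_of_pos hσ0]
      nlinarith
    have h3 : ‖s • z‖ ≤ ‖z‖ := by
      rw [norm_smul, Real.norm_eq_abs, abs_of_nonneg hs.1]
      exact mul_le_of_le_one_left (norm_nonneg _) hs.2
    have hxb : x ∈ Metric.ball p r₀ := Metric.ball_subset_ball (by linarith) hxS.2
    have hxzb : x - s • z ∈ Metric.ball p r₀ := by
      have h1 := hxS.2
      rw [Metric.mem_ball, dist_eq_norm] at h1 ⊢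
      have := norm_sub_le (x - p) (s • z)
      rw [show x - s • z - p = x - p - s • z by abel]
      linarith
    rw [hx _ hxzb]
    have h0 := (hx x hxb).1 hxS.1
    have hd : dist (x - s • z - inner ℝ e₀ (x - s • z) • e₀) (x - inner ℝ e₀ x • e₀)
        ≤ s * (2 * (σ * t)) := by
      rw [dist_eq_norm]
      have : x - s • z - inner ℝ e₀ (x - s • z) • e₀ - (x - inner ℝ e₀ x • e₀)
          = -(s • (y - inner ℝ e₀ y • e₀)) := by
        rw [inner_sub_right, inner_smul_right, hez, hzy]
        module
      rw [this, norm_neg, norm_smul, Real.norm_eq_abs, abs_of_nonneg hs.1]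
      refine mul_le_mul_of_nonneg_left ?_ hs.1
      refine (norm_sub_le _ _).trans ?_
      rw [norm_smul, he, Real.norm_eq_abs]
      linarith
    have hγ' := hγ.dist_le_mul (x - s • z - inner ℝ e₀ (x - s • z) • e₀) (x - inner ℝ e₀ x • e₀)
    rw [Real.dist_eq] at hγ'
    have h5 := (le_abs_self _).trans (hγ'.trans (mul_le_mul_of_nonneg_left hd hK))
    rw [inner_sub_right, inner_smul_right, hez] at *
    have h6 := (abs_le.1 (hey.trans hyn.le)).2
    have h7 : K * (s * (2 * (σ * t))) ≤ s * (σ - inner ℝ e₀ y) := by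
      have : K * (2 * (σ * t)) ≤ σ - inner ℝ e₀ y := by nlinarith
      calc K * (s * (2 * (σ * t))) = s * (K * (2 * (σ * t))) := by ring
        _ ≤ _ := mul_le_mul_of_nonneg_left this hs.1
    linarith

/-- On `V`, the `L²`-norm is controlled by a small multiple of the `H¹(S)`-norm and finitely many
functionals. -/
def FinitelyControlled (S V : Set (E d)) : Prop :=
  ∀ ε : ℝ≥0∞, ε ≠ 0 → ∃ Θ : Finset (E d → ℝ), (∀ θ ∈ Θ, MemLp θ 2 (volume.restrict S)) ∧
    ∃ C : ℝ≥0∞, C ≠ ⊤ ∧ ∀ w G, HasWG S w G → eLpNorm w 2 (volume.restrict V) ≤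
      ε * (eLpNorm w 2 (volume.restrict S) + eLpNorm G 2 (volume.restrict S))
        + C * ∑ θ ∈ Θ, ‖∫ x in S, θ x * w x‖ₑ

theorem FinitelyControlled.mono (h : FinitelyControlled S W) (hVW : V ⊆ W) :
    FinitelyControlled S V := fun ε hε => by
  obtain ⟨Θ, hΘ, C, hC, hw⟩ := h ε hε
  exact ⟨Θ, hΘ, C, hC, fun w G hwG =>
    (eLpNorm_mono_measure _ (Measure.restrict_mono hVW le_rfl)).trans (hw w G hwG)⟩

theorem eLpNorm_two_union_le {F : Type*} [NormedAddCommGroup F] (f : E d → F) :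
    eLpNorm f 2 (volume.restrict (V ∪ W)) ≤
      eLpNorm f 2 (volume.restrict V) + eLpNorm f 2 (volume.restrict W) := by
  rw [← ENNReal.pow_le_pow_left_iff two_ne_zero, eLpNorm_two_sq]
  refine (lintegral_union_le _ _ _).trans ?_
  rw [← eLpNorm_two_sq, ← eLpNorm_two_sq]
  generalize eLpNorm f 2 (volume.restrict V) = a
  generalize eLpNorm f 2 (volume.restrict W) = b
  calc a ^ 2 + b ^ 2 ≤ a ^ 2 + b ^ 2 + 2 * (a * b) := le_self_add
    _ = (a + b) ^ 2 := by ring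

theorem FinitelyControlled.union (h : FinitelyControlled S V) (h' : FinitelyControlled S W) :
    FinitelyControlled S (V ∪ W) := fun ε hε => by
  classical
  obtain ⟨Θ, hΘ, C, hC, hw⟩ := h (ε / 2) (ENNReal.half_pos hε).ne'
  obtain ⟨Θ', hΘ', C', hC', hw'⟩ := h' (ε / 2) (ENNReal.half_pos hε).ne'
  refine ⟨Θ ∪ Θ', fun θ hθ => ?_, C + C', ENNReal.add_ne_top.2 ⟨hC, hC'⟩, fun w G hwG => ?_⟩
  · rcases Finset.mem_union.1 hθ with h | h
    exacts [hΘ θ h, hΘ' θ h]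
  · refine (eLpNorm_two_union_le w).trans ((add_le_add (hw w G hwG) (hw' w G hwG)).trans ?_)
    have s1 : ∑ θ ∈ Θ, ‖∫ x in S, θ x * w x‖ₑ ≤ ∑ θ ∈ Θ ∪ Θ', ‖∫ x in S, θ x * w x‖ₑ :=
      Finset.sum_le_sum_of_subset Finset.subset_union_left
    have s2 : ∑ θ ∈ Θ', ‖∫ x in S, θ x * w x‖ₑ ≤ ∑ θ ∈ Θ ∪ Θ', ‖∫ x in S, θ x * w x‖ₑ :=
      Finset.sum_le_sum_of_subset Finset.subset_union_right
    calc _ ≤ ε / 2 * (eLpNorm w 2 (volume.restrict S) + eLpNorm G 2 (volume.restrict S))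
          + C * ∑ θ ∈ Θ ∪ Θ', ‖∫ x in S, θ x * w x‖ₑ
          + (ε / 2 * (eLpNorm w 2 (volume.restrict S) + eLpNorm G 2 (volume.restrict S))
          + C' * ∑ θ ∈ Θ ∪ Θ', ‖∫ x in S, θ x * w x‖ₑ) := by gcongr
      _ = (ε / 2 + ε / 2) * (eLpNorm w 2 (volume.restrict S) + eLpNorm G 2 (volume.restrict S))
          + (C + C') * ∑ θ ∈ Θ ∪ Θ', ‖∫ x in S, θ x * w x‖ₑ := by ring
      _ = _ := by rw [ENNReal.add_halves]

theorem exists_pos_ofReal_mul_le {C ε : ℝ≥0∞} (hC : C ≠ ⊤) (hε : ε ≠ 0) :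
    ∃ δ : ℝ, 0 < δ ∧ ENNReal.ofReal δ * C ≤ ε := by
  have h : Filter.Tendsto (fun δ : ℝ => ENNReal.ofReal δ * C) (nhdsWithin 0 (Ioi 0))
      (nhds (ENNReal.ofReal 0 * C)) := by
    refine ENNReal.Tendsto.mul_const ?_ (Or.inr hC)
    exact (ENNReal.continuous_ofReal.tendsto 0).mono_left nhdsWithin_le_nhds
  rw [ENNReal.ofReal_zero, zero_mul, ENNReal.tendsto_nhds_zero] at h
  obtain ⟨δ, hδ, hδ0⟩ := ((h ε (pos_iff_ne_zero.2 hε)).and self_mem_nhdsWithin).exists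
  exact ⟨δ, hδ0, hδ⟩

/-- Mollify with a bump centred at τe instead of 0: near p, translates by its support stay in S, so
the mollification error is at most of order τ times the gradient norm. The averages vary little,
with modulus controlled by the L² norm, hence are determined up to a small error by their values on
a finite net, and these values are the functionals. -/
theorem FinitelyControlled.of_cone (hS : IsOpen S) (hb : Bornology.IsBounded S) {p e : E d}
    {r ρ : ℝ} (hρ : 0 < ρ)
    (h : ∀ x ∈ S ∩ Metric.ball p r, ∀ z ∈ Metric.ball e ρ, ∀ s ∈ Icc (0 : ℝ) 1, x - s • z ∈ S) :
    FinitelyControlled S (S ∩ Metric.ball p r) := by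
  intro ε hε
  set V := S ∩ Metric.ball p r with hV
  have hVo : IsOpen V := hS.inter Metric.isOpen_ball
  have hSf : volume S ≠ ⊤ := hb.measure_lt_top.ne
  have hε2 := (ENNReal.half_pos hε).ne'
  obtain ⟨τ₀, hτ₀, hτε⟩ := exists_pos_ofReal_mul_le
    (C := ENNReal.ofReal (‖e‖ + ρ)) ENNReal.ofReal_ne_top hε2
  set τ := min τ₀ 1 with hτ
  have hτ0 : 0 < τ := lt_min hτ₀ one_pos
  let b : ContDiffBump (τ • e) := ⟨τ * ρ / 2, τ * ρ, by positivity, half_lt_self (by positivity)⟩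
  set β := b.normed volume with hβ
  have hβs : ContDiff ℝ ∞ β := b.contDiff_normed
  have hβc : HasCompactSupport β := b.hasCompactSupport_normed
  obtain ⟨L, hL⟩ := hβs.lipschitzWith_of_hasCompactSupport hβc (by simp)
  set κ : ℝ≥0∞ := volume S ^ ((2 : ℝ≥0∞).toReal⁻¹) with hκ
  have hκt : κ ≠ ⊤ := ENNReal.rpow_ne_top_of_nonneg (by positivity) hSf
  obtain ⟨δ, hδ, hδε⟩ := exists_pos_ofReal_mul_le (C := ENNReal.ofReal L * κ * κ)
    (by finiteness) hε2
  -- The net has mesh δ, small against the Lipschitz constant of the kernel and the square root κ of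
  -- the volume.
  obtain ⟨t, htS, htf, ht⟩ := finite_cover_balls_of_compact hb.isCompact_closure hδ
  classical
  have hshift : ∀ y : E d, MemLp (fun x => β (y - x)) 2 (volume.restrict S) := fun y => by
    have : HasCompactSupport fun x => β (y - x) := hβc.comp_homeomorph (Homeomorph.subLeft y)
    exact Continuous.memLp_of_hasCompactSupport (by have := hβs.continuous; fun_prop) this
  refine ⟨htf.toFinset.image fun y x => β (y - x), fun θ hθ => ?_, κ, hκt, fun w G hw => ?_⟩
  · obtain ⟨y, -, rfl⟩ := Finset.mem_image.1 hθ
    exact hshift y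
  set w₀ := S.indicator w with hw₀
  have hw₀L : MemLp w₀ 2 volume := (memLp_indicator_iff_restrict hS.measurableSet).2 hw.memLp
  have hm : ∀ y, bumpAverage b w₀ y = ∫ x in S, β (y - x) * w x := fun y => by
    rw [bumpAverage_eq, ← integral_indicator hS.measurableSet]
    congr 1; ext1 x
    by_cases hx : x ∈ S <;> simp [hw₀, hx, hβ]
  have hwV : w₀ =ᵐ[volume.restrict V] w :=
    (ae_restrict_iff' hVo.measurableSet).2 (ae_of_all _ fun x hx => indicator_of_mem hx.1 _)
  have A : eLpNorm (fun x => bumpAverage b w₀ x - w₀ x) 2 (volume.restrict V)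
      ≤ ε / 2 * eLpNorm G 2 (volume.restrict S) := by
    refine eLpNorm_bumpAverage_sub_le b hw₀L V fun z hz => ?_
    have hz1 : τ⁻¹ • z ∈ Metric.ball e ρ := by
      rw [Metric.mem_ball, dist_eq_norm] at hz ⊢
      have : τ⁻¹ • z - e = τ⁻¹ • (z - τ • e) := by
        rw [smul_sub, smul_smul, inv_mul_cancel₀ hτ0.ne', one_smul]
      rw [this, norm_smul, Real.norm_eq_abs, abs_of_pos (inv_pos.2 hτ0), inv_mul_lt_iff₀ hτ0]
      exact hz
    have hzs : ∀ x ∈ V, ∀ s ∈ Icc (0 : ℝ) 1, x - s • z ∈ S := fun x hx s hs => by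
      have := h x hx _ hz1 (s * τ) ⟨mul_nonneg hs.1 hτ0.le,
        mul_le_one₀ hs.2 hτ0.le (min_le_right _ _)⟩
      rwa [smul_smul, mul_assoc, mul_inv_cancel₀ hτ0.ne', mul_one] at this
    have e1 : (fun x => w₀ (x - z) - w₀ x) =ᵐ[volume.restrict V] fun x => w (x - z) - w x := by
      refine (ae_restrict_iff' hVo.measurableSet).2 (ae_of_all _ fun x hx => ?_)
      have h1 : x - z ∈ S := by simpa using hzs x hx 1 (by simp)
      simp only [hw₀, indicator_of_mem h1, indicator_of_mem hx.1]
    rw [eLpNorm_congr_ae e1]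
    refine (hw.eLpNorm_translate_sub_le hS hVo hzs).trans ?_
    gcongr
    refine le_trans ?_ hτε
    rw [← ofReal_norm, ← ENNReal.ofReal_mul hτ₀.le]
    refine ENNReal.ofReal_le_ofReal ?_
    rw [Metric.mem_ball, dist_eq_norm] at hz1
    have h2 : ‖τ⁻¹ • z‖ ≤ ‖e‖ + ρ := by
      have := norm_add_le (τ⁻¹ • z - e) e
      rw [sub_add_cancel] at this
      linarith
    have h3 : z = τ • τ⁻¹ • z := by rw [smul_smul, mul_inv_cancel₀ hτ0.ne', one_smul]
    rw [h3, norm_smul, Real.norm_eq_abs, abs_of_pos hτ0]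
    exact mul_le_mul (min_le_left _ _) h2 (norm_nonneg _) hτ₀.le
  set Λ := ∑ θ ∈ htf.toFinset.image fun y x => β (y - x), ‖∫ x in S, θ x * w x‖ₑ with hΛ
  set N := eLpNorm w 2 (volume.restrict S) with hN
  have B : ∀ x ∈ V, ‖bumpAverage b w₀ x‖ₑ ≤ ENNReal.ofReal (L * δ) * κ * N + Λ := by
    intro x hx
    obtain ⟨y, hyt, hxy⟩ := mem_iUnion₂.1 (ht (subset_closure hx.1))
    have e1 : bumpAverage b w₀ x
        = (∫ a in S, (β (x - a) - β (y - a)) • w a) + ∫ a in S, β (y - a) * w a := by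
      rw [hm, ← integral_add]
      · congr 1; ext1 a; simp only [smul_eq_mul]; ring
      · exact integrable_smul_of_memLp_two ((hshift x).sub (hshift y)) hw.memLp
      · exact integrable_smul_of_memLp_two (hshift y) hw.memLp
    rw [e1]
    refine (enorm_add_le _ _).trans (add_le_add ?_ ?_)
    · refine (enorm_integral_smul_le ((hshift x).sub (hshift y)).1 hw.memLp.1).trans ?_
      gcongr
      refine (eLpNorm_le_of_ae_enorm_bound (C := ENNReal.ofReal (L * δ))
        (ae_of_all _ fun a => ?_)).trans ?_
      · rw [← ofReal_norm]
        refine ENNReal.ofReal_le_ofReal ?_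
        have := hL.dist_le_mul (x - a) (y - a)
        rw [dist_sub_right, Real.dist_eq] at this
        exact this.trans (mul_le_mul_of_nonneg_left (Metric.mem_ball.1 hxy).le L.2)
      · rw [Measure.restrict_apply_univ, smul_eq_mul]
    · rw [hΛ]
      exact Finset.single_le_sum (f := fun θ : E d → ℝ => ‖∫ x in S, θ x * w x‖ₑ)
        (fun _ _ => zero_le) (Finset.mem_image.2 ⟨y, by simpa using hyt, rfl⟩)
  have C : eLpNorm (bumpAverage b w₀) 2 (volume.restrict V) ≤ ε / 2 * N + κ * Λ := by
    refine (eLpNorm_le_of_ae_enorm_bound (C := ENNReal.ofReal (L * δ) * κ * N + Λ)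
      ((ae_restrict_iff' hVo.measurableSet).2 (ae_of_all _ B))).trans ?_
    rw [Measure.restrict_apply_univ, smul_eq_mul]
    have : volume V ^ ((2 : ℝ≥0∞).toReal⁻¹) ≤ κ :=
      ENNReal.rpow_le_rpow (measure_mono inter_subset_left) (by positivity)
    refine (mul_le_mul_right this _).trans ?_
    rw [add_mul]
    refine add_le_add ?_ (le_of_eq (mul_comm _ _))
    refine le_trans (le_of_eq ?_) (mul_le_mul_left hδε N)
    rw [ENNReal.ofReal_mul (NNReal.coe_nonneg L)]
    ring
  have hbm : AEStronglyMeasurable (bumpAverage b w₀) (volume.restrict V) :=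
    (contDiff_bumpAverage b (hw₀L.locallyIntegrable (by norm_num))).continuous.aestronglyMeasurable
  have e2 : w =ᵐ[volume.restrict V] bumpAverage b w₀ - (bumpAverage b w₀ - w₀) := by
    filter_upwards [hwV] with x hx
    simp [hx]
  rw [eLpNorm_congr_ae e2]
  refine (eLpNorm_sub_le hbm (hbm.sub hw₀L.1.restrict) (by norm_num)).trans ?_
  refine (add_le_add C A).trans ?_
  calc ε / 2 * N + κ * Λ + ε / 2 * eLpNorm G 2 (volume.restrict S)
      = ε / 2 * (N + eLpNorm G 2 (volume.restrict S)) + κ * Λ := by ring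
    _ ≤ _ := by gcongr; exact ENNReal.half_le_self

/-- The property passes to subsets and finite unions and holds near each point of the closure by the
cone condition, so compactness of the closure suffices. -/
theorem IsLipschitzOpen.finitelyControlled (hS : IsLipschitzOpen S) :
    FinitelyControlled S S := by
  have hc := hS.isBounded.isCompact_closure
  have : FinitelyControlled S (S ∩ closure S) := by
    refine hc.induction_on (p := fun V => FinitelyControlled S (S ∩ V)) ?_ ?_ ?_ ?_
    · intro ε _
      exact ⟨∅, by simp, 0, by simp, by simp⟩
    · intro s t hst h
      exact h.mono (inter_subset_inter_right _ hst)
    · intro s t h h'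
      rw [inter_union_distrib_left]
      exact h.union h'
    · intro p hp
      obtain ⟨r, hr, e, ρ, hρ, h⟩ := hS.exists_cone hp
      exact ⟨_, mem_nhdsWithin_of_mem_nhds (Metric.ball_mem_nhds p hr),
        FinitelyControlled.of_cone hS.isOpen hS.isBounded hρ h⟩
  exact this.mono fun x hx => ⟨hx, subset_closure hx⟩

/-- Rellich's theorem on Lipschitz sets. -/
theorem IsLipschitzOpen.exists_subseq (hS : IsLipschitzOpen S) {w : ℕ → E d → ℝ}
    {G : ℕ → E d → E d} (hw : ∀ n, HasWG S (w n) (G n)) {M : ℝ≥0∞} (hM : M ≠ ⊤)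
    (hwM : ∀ n, eLpNorm (w n) 2 (volume.restrict S) ≤ M)
    (hGM : ∀ n, eLpNorm (G n) 2 (volume.restrict S) ≤ M) :
    ∃ ψ : ℕ → ℕ, StrictMono ψ ∧ ∀ ε : ℝ≥0∞, ε ≠ 0 → ∃ N, ∀ m ≥ N, ∀ l ≥ N,
      eLpNorm (w (ψ m) - w (ψ l)) 2 (volume.restrict S) ≤ ε := by
  -- Along an ultrafilter every bounded scalar sequence converges, so all the functionals converge
  -- simultaneously and no diagonal extraction is needed.
  set U : Ultrafilter ℕ := Filter.hyperfilter ℕ with hU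
  let W : ℕ → Lp ℝ 2 (volume.restrict S) := fun n => (hw n).memLp.toLp
  have key : Cauchy ((U : Filter ℕ).map W) := by
    refine EMetric.cauchy_iff.2 ⟨(inferInstance : ((U : Filter ℕ).map W).NeBot).ne, fun ε hε => ?_⟩
    obtain ⟨ε₂, hε₂, hε₂ε⟩ := exists_between hε
    obtain ⟨ε', hε'0, hε'⟩ : ∃ ε' : ℝ, 0 < ε' ∧ ENNReal.ofReal ε' * (4 * M + 1) ≤ ε₂ :=
      exists_pos_ofReal_mul_le (by finiteness) hε₂.ne'
    obtain ⟨Θ, hΘ, C, hC, hctrl⟩ := hS.finitelyControlled (ENNReal.ofReal ε')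
      (by simpa using hε'0)
    obtain ⟨η, hη0, hη⟩ := exists_pos_ofReal_mul_le (C := C * (Θ.card * 2)) (by finiteness)
      (ε := ENNReal.ofReal ε') (by simpa using hε'0)
    have hlim : ∀ θ ∈ Θ, ∃ a : ℝ, Filter.Tendsto (fun n => ∫ x in S, θ x * w n x) U (nhds a) := by
      intro θ hθ
      set R := (eLpNorm θ 2 (volume.restrict S) * M).toReal
      have hb : ∀ n, (∫ x in S, θ x * w n x) ∈ Icc (-R) R := fun n => by
        rw [mem_Icc, ← abs_le, ← Real.norm_eq_abs, ← toReal_enorm]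
        refine ENNReal.toReal_mono (ENNReal.mul_ne_top (hΘ θ hθ).eLpNorm_ne_top hM) ?_
        refine (enorm_integral_smul_le (hΘ θ hθ).1 (hw n).memLp.1).trans ?_
        gcongr
        exact hwM n
      obtain ⟨a, -, ha⟩ := isCompact_Icc.ultrafilter_le_nhds
        (U.map fun n => ∫ x in S, θ x * w n x)
        (Filter.tendsto_principal.2 (Filter.Eventually.of_forall hb))
      exact ⟨a, ha⟩
    choose! a ha using hlim
    have hev : ∀ᶠ n in (U : Filter ℕ), ∀ θ ∈ Θ, |(∫ x in S, θ x * w n x) - a θ| ≤ η := by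
      rw [Filter.eventually_all_finset]
      intro θ hθ
      have := (ha θ hθ).eventually (Metric.closedBall_mem_nhds (a θ) hη0)
      simpa [Real.dist_eq] using this
    refine ⟨W '' {n | ∀ θ ∈ Θ, |(∫ x in S, θ x * w n x) - a θ| ≤ η},
      Filter.image_mem_map hev, ?_⟩
    rintro _ ⟨m, hm, rfl⟩ _ ⟨l, hl, rfl⟩
    rw [Lp.edist_toLp_toLp]
    refine lt_of_le_of_lt (hctrl _ _ ((hw m).sub (hw l))) ?_
    have h1 : eLpNorm (w m - w l) 2 (volume.restrict S) ≤ 2 * M := by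
      refine (eLpNorm_sub_le (hw m).memLp.1 (hw l).memLp.1 (by norm_num)).trans ?_
      rw [two_mul]; exact add_le_add (hwM m) (hwM l)
    have h2 : eLpNorm (G m - G l) 2 (volume.restrict S) ≤ 2 * M := by
      refine (eLpNorm_sub_le (hw m).memLp_grad.1 (hw l).memLp_grad.1 (by norm_num)).trans ?_
      rw [two_mul]; exact add_le_add (hGM m) (hGM l)
    have h3 : ∑ θ ∈ Θ, ‖∫ x in S, θ x * (w m - w l) x‖ₑ ≤ Θ.card * (ENNReal.ofReal η * 2) := by
      rw [← nsmul_eq_mul, ← Finset.sum_const]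
      refine Finset.sum_le_sum fun θ hθ => ?_
      have e : ∫ x in S, θ x * (w m - w l) x
          = (∫ x in S, θ x * w m x) - ∫ x in S, θ x * w l x := by
        have := integral_sub (integrable_smul_of_memLp_two (hΘ θ hθ) (hw m).memLp)
          (integrable_smul_of_memLp_two (hΘ θ hθ) (hw l).memLp)
        simp only [smul_eq_mul] at this
        rw [← this]
        congr 1; ext1 x; simp [mul_sub]
      have h4 : ENNReal.ofReal η * 2 = ENNReal.ofReal (η * 2) := by
        rw [ENNReal.ofReal_mul hη0.le, ENNReal.ofReal_ofNat]
      rw [e, ← ofReal_norm, h4]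
      refine ENNReal.ofReal_le_ofReal ?_
      have hm' := abs_le.1 (hm θ hθ)
      have hl' := abs_le.1 (hl θ hθ)
      rw [Real.norm_eq_abs, abs_le]
      constructor <;> linarith
    calc _ ≤ ENNReal.ofReal ε' * (2 * M + 2 * M) + C * (Θ.card * (ENNReal.ofReal η * 2)) := by
          gcongr
      _ = ENNReal.ofReal ε' * (4 * M) + ENNReal.ofReal η * (C * (Θ.card * 2)) := by ring
      _ ≤ ENNReal.ofReal ε' * (4 * M) + ENNReal.ofReal ε' := by gcongr
      _ = ENNReal.ofReal ε' * (4 * M + 1) := by ring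
      _ ≤ ε₂ := hε'
      _ < ε := hε₂ε
  -- The limit along a free ultrafilter is a cluster point of the sequence in the metric space L²,
  -- hence the limit of a subsequence.
  obtain ⟨A, hA⟩ := CompleteSpace.complete key
  have hcl : MapClusterPt A Filter.atTop W := by
    have h1 : Filter.Tendsto W U (nhds A) := hA
    have h2 : (U : Filter ℕ) ≤ Filter.atTop := by
      rw [← Nat.cofinite_eq_atTop]; exact Filter.hyperfilter_le_cofinite
    exact h1.mapClusterPt.mono h2
  obtain ⟨ψ, hψ, hψA⟩ := hcl.tendsto_subseq
  refine ⟨ψ, hψ, fun ε hε => ?_⟩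
  have hcs := hψA.cauchySeq
  obtain ⟨N, hN⟩ := EMetric.cauchySeq_iff.1 hcs ε (pos_iff_ne_zero.2 hε)
  refine ⟨N, fun m hm l hl => ?_⟩
  have := (hN m hm l hl).le
  rwa [Function.comp, Function.comp, Lp.edist_toLp_toLp] at this

end

section

variable {d : ℕ}

/-! ### Functions with vanishing traces -/

variable {S T U R Γ Γ' Ω : Set (E d)} {v w c : E d → ℝ} {G H k : E d → E d}

theorem integral_norm_sq_eq {α F : Type*} [MeasurableSpace α] {μ : Measure α}
    [NormedAddCommGroup F] {f : α → F} (hf : AEStronglyMeasurable f μ) :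
    ∫ x, ‖f x‖ ^ 2 ∂μ = (eLpNorm f 2 μ).toReal ^ 2 := by
  have hm : AEStronglyMeasurable (fun x => ‖f x‖ ^ 2) μ := hf.norm.pow 2
  rw [← ENNReal.toReal_pow, eLpNorm_two_sq, integral_eq_lintegral_of_nonneg_ae
    (ae_of_all _ fun x => by positivity) hm]
  congr 1
  refine lintegral_congr fun x => ?_
  rw [ENNReal.ofReal_pow (norm_nonneg _), ofReal_norm]

theorem HasWG.h1NormSq_eq (hS : IsOpen S) (h : HasWG S v G) :
    h1NormSq S v = (eLpNorm v 2 (volume.restrict S)).toReal ^ 2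
      + (eLpNorm G 2 (volume.restrict S)).toReal ^ 2 := by
  rw [h1NormSq, integral_norm_sq_eq h.memH1.hasWG.memLp_grad.1,
    eLpNorm_congr_ae (h.ae_eq_weakGrad hS), ← integral_norm_sq_eq h.memLp.1]
  simp only [Real.norm_eq_abs, sq_abs]

theorem HasWG.h1NormSq_lt (hS : IsOpen S) (h : HasWG S v G) {δ ε : ℝ} (hδ : 0 ≤ δ)
    (hε : 2 * δ ^ 2 < ε) (h1 : eLpNorm v 2 (volume.restrict S) ≤ ENNReal.ofReal δ)
    (h2 : eLpNorm G 2 (volume.restrict S) ≤ ENNReal.ofReal δ) : h1NormSq S v < ε := by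
  rw [h.h1NormSq_eq hS]
  have a1 := ENNReal.toReal_le_of_le_ofReal hδ h1
  have a2 := ENNReal.toReal_le_of_le_ofReal hδ h2
  have b1 := pow_le_pow_left₀ ENNReal.toReal_nonneg a1 2
  have b2 := pow_le_pow_left₀ ENNReal.toReal_nonneg a2 2
  linarith

theorem HasWG.le_of_h1NormSq_lt (hS : IsOpen S) (h : HasWG S v G) {δ : ℝ} (hδ : 0 ≤ δ)
    (hh : h1NormSq S v < δ ^ 2) : eLpNorm v 2 (volume.restrict S) ≤ ENNReal.ofReal δ ∧
      eLpNorm G 2 (volume.restrict S) ≤ ENNReal.ofReal δ := by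
  rw [h.h1NormSq_eq hS] at hh
  constructor
  · rw [← ENNReal.ofReal_toReal h.memLp.eLpNorm_ne_top]
    refine ENNReal.ofReal_le_ofReal (le_of_lt (lt_of_pow_lt_pow_left₀ 2 hδ ?_))
    nlinarith [sq_nonneg (eLpNorm G 2 (volume.restrict S)).toReal]
  · rw [← ENNReal.ofReal_toReal h.memLp_grad.eLpNorm_ne_top]
    refine ENNReal.ofReal_le_ofReal (le_of_lt (lt_of_pow_lt_pow_left₀ 2 hδ ?_))
    nlinarith [sq_nonneg (eLpNorm v 2 (volume.restrict S)).toReal]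

theorem exists_pos_ofReal_le {ε : ℝ≥0∞} (hε : ε ≠ 0) : ∃ δ : ℝ, 0 < δ ∧ ENNReal.ofReal δ ≤ ε := by
  obtain ⟨δ, h, h'⟩ := exists_pos_ofReal_mul_le ENNReal.one_ne_top hε
  exact ⟨δ, h, by simpa using h'⟩

/-- `v ∈ H¹₀(S)` with weak gradient `G`. -/
structure HasH10 (S : Set (E d)) (v : E d → ℝ) (G : E d → E d) : Prop extends HasWG S v G where
  approx : ∀ ε : ℝ≥0∞, ε ≠ 0 → ∃ φ, IsTestFunction S φ ∧
    eLpNorm (v - φ) 2 (volume.restrict S) ≤ ε ∧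
    eLpNorm (G - gradient φ) 2 (volume.restrict S) ≤ ε

/-- `v ∈ H¹(S)` with weak gradient `G` and `v = 0` on `Γ`. -/
structure HasVan (S Γ : Set (E d)) (v : E d → ℝ) (G : E d → E d) : Prop extends
    HasWG S v G where
  approx : ∀ ε : ℝ≥0∞, ε ≠ 0 → ∃ w H, HasWG S w H ∧ (∃ U, IsOpen U ∧ Γ ⊆ U ∧
    ∀ x ∈ U ∩ S, w x = 0) ∧ eLpNorm (v - w) 2 (volume.restrict S) ≤ ε ∧
    eLpNorm (G - H) 2 (volume.restrict S) ≤ ε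

theorem MemH10.hasH10 (hS : IsOpen S) (h : MemH10 S v) (hG : HasWG S v G) : HasH10 S v G := by
  refine ⟨hG, fun ε hε => ?_⟩
  obtain ⟨δ, hδ, hδε⟩ := exists_pos_ofReal_le hε
  obtain ⟨φ, hφ, hn⟩ := h.2 (δ ^ 2) (by positivity)
  have := (hG.sub hφ.hasWG).le_of_h1NormSq_lt hS hδ.le hn
  exact ⟨φ, hφ, this.1.trans hδε, this.2.trans hδε⟩

theorem HasH10.memH10 (hS : IsOpen S) (h : HasH10 S v G) : MemH10 S v := by
  refine ⟨h.memH1, fun ε hε => ?_⟩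
  obtain ⟨φ, hφ, h1, h2⟩ := h.approx (ENNReal.ofReal (Real.sqrt (ε / 3)))
    (by rw [Ne, ENNReal.ofReal_eq_zero, not_le]; positivity)
  refine ⟨φ, hφ, (h.toHasWG.sub hφ.hasWG).h1NormSq_lt hS (Real.sqrt_nonneg _) ?_ h1 h2⟩
  rw [Real.sq_sqrt (by positivity)]; linarith

theorem VanishesOn.hasVan (hS : IsOpen S) (h : VanishesOn S Γ v) (hG : HasWG S v G) :
    HasVan S Γ v G := by
  refine ⟨hG, fun ε hε => ?_⟩
  obtain ⟨δ, hδ, hδε⟩ := exists_pos_ofReal_le hε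
  obtain ⟨w, U, hw, hU, hΓ, h0, hn⟩ := h.2 (δ ^ 2) (by positivity)
  have := (hG.sub hw.hasWG).le_of_h1NormSq_lt hS hδ.le hn
  exact ⟨w, _, hw.hasWG, ⟨U, hU, hΓ, h0⟩, this.1.trans hδε, this.2.trans hδε⟩

theorem HasVan.vanishesOn (hS : IsOpen S) (h : HasVan S Γ v G) : VanishesOn S Γ v := by
  refine ⟨h.memH1, fun ε hε => ?_⟩
  obtain ⟨w, H, hw, ⟨U, hU, hΓ, h0⟩, h1, h2⟩ := h.approx (ENNReal.ofReal (Real.sqrt (ε / 3)))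
    (by rw [Ne, ENNReal.ofReal_eq_zero, not_le]; positivity)
  refine ⟨w, U, hw.memH1, hU, hΓ, h0,
    (h.toHasWG.sub hw).h1NormSq_lt hS (Real.sqrt_nonneg _) ?_ h1 h2⟩
  rw [Real.sq_sqrt (by positivity)]; linarith

theorem eLpNorm_smul_le_of {α F : Type*} [MeasurableSpace α] {μ : Measure α}
    [NormedAddCommGroup F] [NormedSpace ℝ F] {f : α → F} (c : ℝ) {ε : ℝ≥0∞}
    (h : eLpNorm f 2 μ ≤ ε / (‖c‖ₑ + 1)) : eLpNorm (c • f) 2 μ ≤ ε := by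
  rw [eLpNorm_const_smul]
  calc ‖c‖ₑ * eLpNorm f 2 μ ≤ (‖c‖ₑ + 1) * (ε / (‖c‖ₑ + 1)) := by gcongr; exact le_self_add
    _ ≤ ε := ENNReal.mul_div_le

theorem div_enorm_add_one_ne_zero {c : ℝ} {ε : ℝ≥0∞} (hε : ε ≠ 0) : ε / (‖c‖ₑ + 1) ≠ 0 :=
  ENNReal.div_ne_zero.2 ⟨hε, by finiteness⟩

theorem eLpNorm_add_sub_add_le {α F : Type*} [MeasurableSpace α] {μ : Measure α}
    [NormedAddCommGroup F] {f g f' g' : α → F} {ε : ℝ≥0∞}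
    (hf : AEStronglyMeasurable (f - f') μ) (hg : AEStronglyMeasurable (g - g') μ)
    (h : eLpNorm (f - f') 2 μ ≤ ε / 2) (h' : eLpNorm (g - g') 2 μ ≤ ε / 2) :
    eLpNorm (f + g - (f' + g')) 2 μ ≤ ε := by
  rw [add_sub_add_comm]
  refine (eLpNorm_add_le hf hg (by norm_num)).trans ((add_le_add h h').trans ?_)
  rw [ENNReal.add_halves]

namespace HasH10

theorem congr (h : HasH10 S v G) (hv : v =ᵐ[volume.restrict S] w)
    (hG : G =ᵐ[volume.restrict S] H) : HasH10 S w H :=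
  ⟨h.toHasWG.congr hv hG, fun ε hε => by
    obtain ⟨φ, hφ, h1, h2⟩ := h.approx ε hε
    refine ⟨φ, hφ, le_trans (le_of_eq (eLpNorm_congr_ae ?_)) h1,
      le_trans (le_of_eq (eLpNorm_congr_ae ?_)) h2⟩
    · exact hv.symm.sub (ae_eq_refl _)
    · exact hG.symm.sub (ae_eq_refl _)⟩

theorem zero : HasH10 S (0 : E d → ℝ) 0 :=
  ⟨HasWG.zero, fun ε _ => ⟨0, IsTestFunction.zero, by simp, by
    have : gradient (0 : E d → ℝ) = 0 := gradient_const' 0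
    simp [this]⟩⟩

theorem add (h : HasH10 S v G) (h' : HasH10 S w H) : HasH10 S (v + w) (G + H) := by
  refine ⟨h.toHasWG.add h'.toHasWG, fun ε hε => ?_⟩
  obtain ⟨φ, hφ, h1, h2⟩ := h.approx (ε / 2) (ENNReal.half_pos hε).ne'
  obtain ⟨φ', hφ', h1', h2'⟩ := h'.approx (ε / 2) (ENNReal.half_pos hε).ne'
  have e : gradient (φ + φ') = gradient φ + gradient φ' :=
    funext fun x => gradient_add_apply (hφ.differentiable x) (hφ'.differentiable x)
  refine ⟨φ + φ', hφ.add hφ', ?_, ?_⟩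
  · exact eLpNorm_add_sub_add_le (h.memLp.sub (hφ.memLp 2)).1 (h'.memLp.sub (hφ'.memLp 2)).1 h1 h1'
  · rw [e]
    exact eLpNorm_add_sub_add_le (h.memLp_grad.sub (hφ.memLp_gradient 2)).1
      (h'.memLp_grad.sub (hφ'.memLp_gradient 2)).1 h2 h2'

theorem smul (a : ℝ) (h : HasH10 S v G) : HasH10 S (a • v) (a • G) := by
  refine ⟨h.toHasWG.smul a, fun ε hε => ?_⟩
  obtain ⟨φ, hφ, h1, h2⟩ := h.approx _ (div_enorm_add_one_ne_zero (c := a) hε)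
  have e : gradient (a • φ) = a • gradient φ :=
    funext fun x => gradient_smul_apply a (hφ.differentiable x)
  refine ⟨a • φ, hφ.smul a, ?_, ?_⟩
  · rw [← smul_sub]; exact eLpNorm_smul_le_of a h1
  · rw [e, ← smul_sub]; exact eLpNorm_smul_le_of a h2

theorem sum {ι : Type*} (s : Finset ι) {v : ι → E d → ℝ} {G : ι → E d → E d}
    (h : ∀ i ∈ s, HasH10 S (v i) (G i)) : HasH10 S (∑ i ∈ s, v i) (∑ i ∈ s, G i) := by
  classical
  induction s using Finset.induction_on with
  | empty => simpa using zero
  | insert a s ha ih =>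
    rw [Finset.sum_insert ha, Finset.sum_insert ha]
    exact (h a (Finset.mem_insert_self _ _)).add
      (ih fun i hi => h i (Finset.mem_insert_of_mem hi))

/-- Extension by zero. -/
theorem indicator (hS : IsOpen S) (h : HasH10 S v G) (hST : S ⊆ T) :
    HasH10 T (S.indicator v) (S.indicator G) := by
  have hm := hS.measurableSet
  have hr : (volume.restrict T).restrict S = volume.restrict S :=
    Measure.restrict_restrict_of_subset hST
  have L1 : MemLp (S.indicator v) 2 (volume.restrict T) := by
    rw [memLp_indicator_iff_restrict hm, hr]; exact h.memLp
  have L2 : MemLp (S.indicator G) 2 (volume.restrict T) := by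
    rw [memLp_indicator_iff_restrict hm, hr]; exact h.memLp_grad
  -- Test functions on S already vanish outside S, so the same ones approximate the extension; no
  -- regularity of the boundary enters.
  have ap : ∀ ε : ℝ≥0∞, ε ≠ 0 → ∃ φ, IsTestFunction T φ ∧
      eLpNorm (S.indicator v - φ) 2 (volume.restrict T) ≤ ε ∧
      eLpNorm (S.indicator G - gradient φ) 2 (volume.restrict T) ≤ ε := by
    intro ε hε
    obtain ⟨φ, hφ, h1, h2⟩ := h.approx ε hε
    have e1 : S.indicator v - φ = S.indicator (v - φ) := by
      ext x
      by_cases hx : x ∈ S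
      · simp [hx]
      · simp [hx, hφ.eq_zero_of_notMem hx]
    have e2 : S.indicator G - gradient φ = S.indicator (G - gradient φ) := by
      ext1 x
      by_cases hx : x ∈ S
      · simp [hx]
      · simp [hx, hφ.gradient_eq_zero_of_notMem hx]
    refine ⟨φ, hφ.mono hST, ?_, ?_⟩
    · rwa [e1, eLpNorm_indicator_eq_eLpNorm_restrict hm, hr]
    · rwa [e2, eLpNorm_indicator_eq_eLpNorm_restrict hm, hr]
  refine ⟨HasWG.of_tendsto L1 L2 fun ε hε => ?_, ap⟩
  obtain ⟨φ, hφ, h1, h2⟩ := ap ε hε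
  exact ⟨φ, gradient φ, hφ.hasWG, h1, h2⟩

/-- The complement of the support of a test function is an open neighbourhood of any set disjoint
from S. -/
theorem hasVan (h : HasH10 S v G) (hΓ : Disjoint Γ S) : HasVan S Γ v G := by
  refine ⟨h.toHasWG, fun ε hε => ?_⟩
  obtain ⟨φ, hφ, h1, h2⟩ := h.approx ε hε
  refine ⟨φ, _, hφ.hasWG, ⟨(tsupport φ)ᶜ, (isClosed_tsupport φ).isOpen_compl, fun x hx hx' => ?_,
    fun x hx => image_eq_zero_of_notMem_tsupport hx.1⟩, h1, h2⟩
  exact hΓ.notMem_of_mem_left hx (hφ.2.2 hx')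

end HasH10

theorem HasWG.hasVan_empty (h : HasWG S v G) : HasVan S ∅ v G :=
  ⟨h, fun ε _ => ⟨v, G, h, ⟨∅, isOpen_empty, le_rfl, by simp⟩, by simp, by simp⟩⟩

namespace HasVan

theorem zero : HasVan S Γ (0 : E d → ℝ) 0 :=
  ⟨HasWG.zero, fun ε _ => ⟨0, 0, HasWG.zero, ⟨univ, isOpen_univ, subset_univ _, by simp⟩,
    by simp, by simp⟩⟩

theorem add (h : HasVan S Γ v G) (h' : HasVan S Γ w H) : HasVan S Γ (v + w) (G + H) := by
  refine ⟨h.toHasWG.add h'.toHasWG, fun ε hε => ?_⟩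
  obtain ⟨φ, P, hφ, ⟨U, hU, hΓ, h0⟩, h1, h2⟩ := h.approx (ε / 2) (ENNReal.half_pos hε).ne'
  obtain ⟨φ', P', hφ', ⟨U', hU', hΓ', h0'⟩, h1', h2'⟩ :=
    h'.approx (ε / 2) (ENNReal.half_pos hε).ne'
  refine ⟨φ + φ', P + P', hφ.add hφ', ⟨U ∩ U', hU.inter hU', subset_inter hΓ hΓ', fun x hx => ?_⟩,
    ?_, ?_⟩
  · simp [h0 x ⟨hx.1.1, hx.2⟩, h0' x ⟨hx.1.2, hx.2⟩]
  · exact eLpNorm_add_sub_add_le (h.memLp.sub hφ.memLp).1 (h'.memLp.sub hφ'.memLp).1 h1 h1'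
  · exact eLpNorm_add_sub_add_le (h.memLp_grad.sub hφ.memLp_grad).1
      (h'.memLp_grad.sub hφ'.memLp_grad).1 h2 h2'

theorem smul (a : ℝ) (h : HasVan S Γ v G) : HasVan S Γ (a • v) (a • G) := by
  refine ⟨h.toHasWG.smul a, fun ε hε => ?_⟩
  obtain ⟨φ, P, hφ, ⟨U, hU, hΓ, h0⟩, h1, h2⟩ :=
    h.approx _ (div_enorm_add_one_ne_zero (c := a) hε)
  refine ⟨a • φ, a • P, hφ.smul a, ⟨U, hU, hΓ, fun x hx => by simp [h0 x hx]⟩, ?_, ?_⟩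
  · rw [← smul_sub]; exact eLpNorm_smul_le_of a h1
  · rw [← smul_sub]; exact eLpNorm_smul_le_of a h2

theorem neg (h : HasVan S Γ v G) : HasVan S Γ (-v) (-G) := by simpa using h.smul (-1)

theorem sub (h : HasVan S Γ v G) (h' : HasVan S Γ w H) : HasVan S Γ (v - w) (G - H) := by
  simpa [sub_eq_add_neg] using h.add h'.neg

theorem mono (h : HasVan S Γ v G) (hTS : T ⊆ S) (hΓ : Γ' ⊆ Γ) : HasVan T Γ' v G := by
  refine ⟨h.toHasWG.mono hTS, fun ε hε => ?_⟩
  obtain ⟨φ, P, hφ, ⟨U, hU, hΓ', h0⟩, h1, h2⟩ := h.approx ε hε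
  have hr : volume.restrict T ≤ volume.restrict S := Measure.restrict_mono hTS le_rfl
  exact ⟨φ, P, hφ.mono hTS, ⟨U, hU, hΓ.trans hΓ', fun x hx => h0 x ⟨hx.1, hTS hx.2⟩⟩,
    (eLpNorm_mono_measure _ hr).trans h1, (eLpNorm_mono_measure _ hr).trans h2⟩

theorem of_tendsto (hv : MemLp v 2 (volume.restrict S)) (hG : MemLp G 2 (volume.restrict S))
    (h : ∀ ε : ℝ≥0∞, ε ≠ 0 → ∃ v' G', HasVan S Γ v' G' ∧
      eLpNorm (v - v') 2 (volume.restrict S) ≤ ε ∧ eLpNorm (G - G') 2 (volume.restrict S) ≤ ε) :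
    HasVan S Γ v G := by
  refine ⟨HasWG.of_tendsto hv hG fun ε hε => ?_, fun ε hε => ?_⟩
  · obtain ⟨v', G', h', h1, h2⟩ := h ε hε
    exact ⟨v', G', h'.toHasWG, h1, h2⟩
  · obtain ⟨v', G', h', h1, h2⟩ := h (ε / 2) (ENNReal.half_pos hε).ne'
    obtain ⟨w, P, hw, hU, h1', h2'⟩ := h'.approx (ε / 2) (ENNReal.half_pos hε).ne'
    refine ⟨w, P, hw, hU, ?_, ?_⟩
    · rw [← sub_add_sub_cancel v v' w, ← ENNReal.add_halves ε]
      exact (eLpNorm_add_le (hv.sub h'.memLp).1 (h'.memLp.sub hw.memLp).1 (by norm_num)).trans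
        (add_le_add h1 h1')
    · rw [← sub_add_sub_cancel G G' P, ← ENNReal.add_halves ε]
      exact (eLpNorm_add_le (hG.sub h'.memLp_grad).1 (h'.memLp_grad.sub hw.memLp_grad).1
        (by norm_num)).trans (add_le_add h2 h2')

end HasVan

/-! ### Multiplication by cut-off functions -/

/-- The weak gradient vanishes on the zero set. -/
theorem HasWG.grad_eq_zero_of_eq_zero (hU : IsOpen U) (hUf : volume U ≠ ⊤) (hc : HasWG U c k) :
    ∀ᵐ x ∂volume.restrict U, c x = 0 → k x = 0 := by
  have : IsFiniteMeasure (volume.restrict U) := ⟨by simpa using hUf.lt_top⟩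
  obtain ⟨C, hC0, hC⟩ := exists_truncation
  have hpos : ∀ n : ℕ, (0 : ℝ) < 1 / (n + 1) := fun n => by positivity
  choose f f' L h1 h2 h3 h4 h5 h6 h7 h8 using fun n : ℕ => hC _ (hpos n)
  have hlim : Filter.Tendsto (fun n : ℕ => (1 : ℝ) / (n + 1)) Filter.atTop (nhds 0) :=
    tendsto_one_div_add_atTop_nhds_zero_nat
  have hcn : ∀ n, HasWG U (f n ∘ c) (fun x => f' n (c x) • k x) := fun n =>
    hc.comp hU hUf (h1 n) (h2 n) (h4 n) (h3 n)
  -- The candidate equals k off the zero set and 0 on it. The truncations of c converge to c and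
  -- their gradients to k₀, so k₀ is also a weak gradient of c, and uniqueness gives k = k₀.
  set k₀ : E d → E d := fun x => (if c x = 0 then (0 : ℝ) else 1) • k x with hk₀
  obtain ⟨c', hc'm, hcc'⟩ := hc.memLp.1
  have hk₀m : AEStronglyMeasurable k₀ (volume.restrict U) := by
    have : AEStronglyMeasurable (fun x => (if c' x = 0 then (0 : ℝ) else 1) • k x)
        (volume.restrict U) := by
      have hm : AEStronglyMeasurable (fun x => if c' x = 0 then (0 : ℝ) else 1)
          (volume.restrict U) :=
        (Measurable.ite (hc'm.measurable (measurableSet_singleton 0)) measurable_const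
          measurable_const).aestronglyMeasurable
      exact hm.smul hc.memLp_grad.1
    refine this.congr ?_
    filter_upwards [hcc'] with x hx
    simp only [hk₀, hx]
  have hk₀L : MemLp k₀ 2 (volume.restrict U) := hc.memLp_grad.of_le hk₀m (ae_of_all _ fun x => by
    simp only [hk₀]; split_ifs <;> simp)
  have t1 : Filter.Tendsto (fun n => eLpNorm (c - f n ∘ c) 2 (volume.restrict U))
      Filter.atTop (nhds 0) := by
    refine tendsto_eLpNorm_of_dominated (g := fun _ => (1 : ℝ)) (C := C)
      (fun n => (hc.sub (hcn n)).memLp.1) (memLp_const 1) (fun n => ae_of_all _ fun x => ?_)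
      (ae_of_all _ fun x => ?_)
    · have := h6 n (c x)
      rw [abs_sub_comm] at this
      have h9 : (1 : ℝ) / (n + 1) ≤ 1 := by
        rw [div_le_one (by positivity)]; linarith [n.cast_nonneg (α := ℝ)]
      simpa using this.trans (mul_le_of_le_one_right hC0 h9)
    · refine squeeze_zero_norm (a := fun n : ℕ => C * (1 / (n + 1))) (fun n => ?_)
        (by simpa using hlim.const_mul C)
      have := h6 n (c x)
      rwa [abs_sub_comm] at this
  have t2 : Filter.Tendsto (fun n => eLpNorm (k₀ - fun x => f' n (c x) • k x) 2
      (volume.restrict U)) Filter.atTop (nhds 0) := by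
    refine tendsto_eLpNorm_of_dominated (g := k) (C := 1 + C)
      (fun n => (hk₀L.sub (hcn n).memLp_grad).1) hc.memLp_grad (fun n => ae_of_all _ fun x => ?_)
      (ae_of_all _ fun x => ?_)
    · simp only [hk₀, Pi.sub_apply, ← sub_smul]
      rw [norm_smul]
      gcongr
      refine (norm_sub_le _ _).trans (add_le_add ?_ (h4 n _))
      split_ifs <;> simp
    · by_cases hx : c x = 0
      · simp [hk₀, hx, h8]
      · refine tendsto_const_nhds.congr' ?_
        have : ∀ᶠ n : ℕ in Filter.atTop, 2 * ((1 : ℝ) / (n + 1)) < |c x| := by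
          have := hlim.const_mul 2
          rw [mul_zero] at this
          exact this.eventually_lt_const (abs_pos.2 hx)
        filter_upwards [this] with n hn
        simp [hk₀, hx, h7 n _ hn]
  have h0 : HasWG U c k₀ := by
    refine HasWG.of_tendsto hc.memLp hk₀L fun ε hε => ?_
    rw [ENNReal.tendsto_nhds_zero] at t1 t2
    obtain ⟨n, hn1, hn2⟩ := ((t1 ε (pos_iff_ne_zero.2 hε)).and
      (t2 ε (pos_iff_ne_zero.2 hε))).exists
    exact ⟨_, _, hcn n, hn1, hn2⟩
  filter_upwards [hc.unique hU h0] with x hx hx0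
  rw [hx]; simp [hk₀, hx0]

/-- Multiplication by a cut-off function that tends to zero at the part of the boundary where no
boundary condition is imposed. -/
theorem HasVan.mul_hasH10 (hU : IsOpen U) (hUb : Bornology.IsBounded U) (hR : IsOpen R)
    (hRU : R ⊆ U) {C : ℝ} (hc : HasBddWG U c k C)
    (hlim : ∀ p ∈ closure U, p ∉ R → p ∉ Γ →
      Filter.Tendsto c (nhdsWithin p U) (nhds 0)) (hv : HasVan U Γ v G) :
    HasH10 R (c * v) (fun x => c x • G x + v x • k x) := by
  have hUf : volume U ≠ ⊤ := hUb.measure_lt_top.ne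
  have hcv := hc.mul hU hv.toHasWG
  refine ⟨hcv.mono hRU, fun ε hε => ?_⟩
  -- Two approximations are combined: c by a truncation that vanishes where |c| is small, hence near
  -- the part of the boundary without condition, and v by a w vanishing near Γ. The truncated
  -- product then vanishes off a compact subset of R, and mollification gives test functions.
  obtain ⟨C', hC'0, hC'⟩ := exists_truncation
  have hpos : ∀ n : ℕ, (0 : ℝ) < 1 / (n + 1) := fun n => by positivity
  choose f f' L h1 h2 h3 h4 h5 h6 h7 h8 using fun n : ℕ => hC' _ (hpos n)
  have h9 : ∀ n : ℕ, (1 : ℝ) / (n + 1) ≤ 1 := fun n => by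
    rw [div_le_one (by positivity)]; linarith [n.cast_nonneg (α := ℝ)]
  have hlim0 : Filter.Tendsto (fun n : ℕ => (1 : ℝ) / (n + 1)) Filter.atTop (nhds 0) :=
    tendsto_one_div_add_atTop_nhds_zero_nat
  set B := max (C + C') (C' * C) with hB
  have hB0 : 0 ≤ max B 0 := le_max_right _ _
  have h6' : ∀ n x, |f n (c x) - c x| ≤ C' := fun n x =>
    (h6 n (c x)).trans (mul_le_of_le_one_right hC'0 (h9 n))
  have hcn : ∀ n, HasBddWG U (f n ∘ c) (fun x => f' n (c x) • k x) (max B 0) := fun n => by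
    refine ⟨hc.toHasWG.comp hU hUf (h1 n) (h2 n) (h4 n) (h3 n), ?_, ?_⟩
    · filter_upwards [hc.bound] with x hx
      refine le_trans ?_ ((le_max_left (C + C') (C' * C)).trans (le_max_left B 0))
      have := abs_add_le (c x) (f n (c x) - c x)
      rw [add_sub_cancel] at this
      exact this.trans (add_le_add hx (h6' n x))
    · filter_upwards [hc.bound_grad] with x hx
      refine le_trans ?_ ((le_max_right (C + C') (C' * C)).trans (le_max_left B 0))
      rw [norm_smul]
      exact mul_le_mul (h4 n _) hx (norm_nonneg _) hC'0
  have hcnv : ∀ n {w : E d → ℝ} {H : E d → E d}, HasWG U w H → HasWG U ((f n ∘ c) * w)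
      (fun x => f n (c x) • H x + w x • f' n (c x) • k x) := fun n w H hw => (hcn n).mul hU hw
  -- convergence of the truncations
  have t1 : Filter.Tendsto (fun n => eLpNorm (c * v - (f n ∘ c) * v) 2 (volume.restrict U))
      Filter.atTop (nhds 0) := by
    refine tendsto_eLpNorm_of_dominated (g := v) (C := C')
      (fun n => (hcv.sub (hcnv n hv.toHasWG)).memLp.1) hv.memLp (fun n => ae_of_all _ fun x => ?_)
      (ae_of_all _ fun x => ?_)
    · rw [← sub_mul, Pi.mul_apply, norm_mul]
      gcongr
      rw [Pi.sub_apply, norm_sub_rev]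
      exact h6' n x
    · refine squeeze_zero_norm (a := fun n : ℕ => C' * (1 / (n + 1)) * |v x|) (fun n => ?_)
        (by simpa using (hlim0.const_mul C').mul_const |v x|)
      rw [← sub_mul, Pi.mul_apply, norm_mul]
      gcongr
      · rw [Pi.sub_apply, norm_sub_rev]; exact h6 n (c x)
      · rfl
  -- Where c ≠ 0, f_n'(c) is eventually 1. Where c = 0 it is 0 for all n, and convergence of the
  -- gradients holds only because k vanishes there.
  have hk0 := hc.toHasWG.grad_eq_zero_of_eq_zero hU hUf
  have t2 : Filter.Tendsto (fun n => eLpNorm ((fun x => c x • G x + v x • k x)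
      - fun x => f n (c x) • G x + v x • f' n (c x) • k x) 2 (volume.restrict U))
      Filter.atTop (nhds 0) := by
    refine tendsto_eLpNorm_of_dominated (g := fun x => (‖G x‖ + ‖v x‖ : ℝ))
      (C := C' + (1 + C') * max C 0)
      (fun n => (hcv.sub (hcnv n hv.toHasWG)).memLp_grad.1)
      (hv.memLp_grad.norm.add hv.memLp.norm) (fun n => ?_) ?_
    · filter_upwards [hc.bound_grad] with x hx
      have e : ((fun x => c x • G x + v x • k x)
          - fun x => f n (c x) • G x + v x • f' n (c x) • k x) x
          = (c x - f n (c x)) • G x + v x • (1 - f' n (c x)) • k x := by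
        simp only [Pi.sub_apply]; module
      rw [e, Real.norm_eq_abs (‖G x‖ + ‖v x‖), abs_of_nonneg (by positivity)]
      refine (norm_add_le _ _).trans ?_
      rw [norm_smul, norm_smul, norm_smul]
      have a1 : ‖c x - f n (c x)‖ ≤ C' := by rw [norm_sub_rev]; exact h6' n x
      have a2 : ‖1 - f' n (c x)‖ ≤ 1 + C' := (norm_sub_le _ _).trans
        (add_le_add (by simp) (h4 n _))
      have a3 : ‖k x‖ ≤ max C 0 := hx.trans (le_max_left _ _)
      have a4 : ‖1 - f' n (c x)‖ * ‖k x‖ ≤ (1 + C') * max C 0 :=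
        mul_le_mul a2 a3 (norm_nonneg _) (by positivity)
      have a5 : 0 ≤ (1 + C') * max C 0 := by positivity
      nlinarith [norm_nonneg (G x), norm_nonneg (v x), mul_le_mul_of_nonneg_right a1 (norm_nonneg (G x)),
        mul_le_mul_of_nonneg_left a4 (norm_nonneg (v x)), mul_nonneg hC'0 (norm_nonneg (v x)),
        mul_nonneg a5 (norm_nonneg (G x))]
    · filter_upwards [hk0] with x hx
      have e : ∀ n, ((fun x => c x • G x + v x • k x)
          - fun x => f n (c x) • G x + v x • f' n (c x) • k x) x
          = (c x - f n (c x)) • G x + v x • (1 - f' n (c x)) • k x := fun n => by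
        simp only [Pi.sub_apply]; module
      simp only [e]
      have l1 : Filter.Tendsto (fun n => c x - f n (c x)) Filter.atTop (nhds 0) := by
        refine squeeze_zero_norm (a := fun n : ℕ => C' * (1 / (n + 1))) (fun n => ?_)
          (by simpa using hlim0.const_mul C')
        rw [norm_sub_rev]; exact h6 n (c x)
      have l2 : Filter.Tendsto (fun n => v x • (1 - f' n (c x)) • k x) Filter.atTop (nhds 0) := by
        by_cases hx0 : c x = 0
        · simp [hx hx0]
        · refine tendsto_const_nhds.congr' ?_
          have : ∀ᶠ n : ℕ in Filter.atTop, 2 * ((1 : ℝ) / (n + 1)) < |c x| := by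
            have := hlim0.const_mul 2
            rw [mul_zero] at this
            exact this.eventually_lt_const (abs_pos.2 hx0)
          filter_upwards [this] with n hn
          simp [h7 n _ hn]
      simpa using (l1.smul_const (G x)).add l2
  have hε3 : ε / 3 ≠ 0 := (ENNReal.div_pos hε (by simp)).ne'
  rw [ENNReal.tendsto_nhds_zero] at t1 t2
  obtain ⟨n, hn1, hn2⟩ := ((t1 (ε / 3) (pos_iff_ne_zero.2 hε3)).and
    (t2 (ε / 3) (pos_iff_ne_zero.2 hε3))).exists
  -- approximation of the function
  obtain ⟨δ, hδ0, hδ⟩ := exists_pos_ofReal_mul_le (C := ENNReal.ofReal (max B 0) * 2)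
    (by finiteness) hε3
  obtain ⟨w, H, hw, ⟨O, hO, hΓO, hwO⟩, hvw, hGH⟩ := hv.approx (ENNReal.ofReal δ)
    (by simpa using hδ0)
  have hmw := hcnv n hw
  have hmd := (hcnv n hv.toHasWG).sub hmw
  have b1 : eLpNorm ((f n ∘ c) * v - (f n ∘ c) * w) 2 (volume.restrict U) ≤ ε / 3 := by
    refine (eLpNorm_le_mul_eLpNorm_of_ae_le_mul (g := v - w) (c := max B 0) ?_ 2).trans ?_
    · filter_upwards [(hcn n).bound] with x hx
      rw [← mul_sub, Pi.mul_apply, norm_mul]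
      gcongr
      exact hx
    · refine (mul_le_mul_right hvw _).trans (le_trans ?_ hδ)
      calc ENNReal.ofReal (max B 0) * ENNReal.ofReal δ
          = ENNReal.ofReal δ * (ENNReal.ofReal (max B 0) * 1) := by ring
        _ ≤ _ := by gcongr; norm_num
  have b2 : eLpNorm ((fun x => f n (c x) • G x + v x • f' n (c x) • k x)
      - fun x => f n (c x) • H x + w x • f' n (c x) • k x) 2 (volume.restrict U) ≤ ε / 3 := by
    have e : ((fun x => f n (c x) • G x + v x • f' n (c x) • k x)
      - fun x => f n (c x) • H x + w x • f' n (c x) • k x)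
      = (fun x => f n (c x) • (G - H) x) + fun x => (v - w) x • f' n (c x) • k x := by
      ext1 x; simp only [Pi.sub_apply, Pi.add_apply]; module
    have m1 : MemLp (fun x => f n (c x) • (G - H) x) 2 (volume.restrict U) :=
      MemLp.smul_of_bound (hcn n).memLp.1 (hcn n).bound (hv.memLp_grad.sub hw.memLp_grad)
    have m2 : MemLp (fun x => (v - w) x • f' n (c x) • k x) 2 (volume.restrict U) :=
      MemLp.smul_of_bound_right (hv.memLp.sub hw.memLp) (hcn n).bound_grad (hcn n).memLp_grad.1
    rw [e]
    refine (eLpNorm_add_le m1.1 m2.1 (by norm_num)).trans ?_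
    have c1 : eLpNorm (fun x => f n (c x) • (G - H) x) 2 (volume.restrict U)
        ≤ ENNReal.ofReal (max B 0) * ENNReal.ofReal δ := by
      refine (eLpNorm_le_mul_eLpNorm_of_ae_le_mul (g := G - H) (c := max B 0) ?_ 2).trans
        (by gcongr)
      filter_upwards [(hcn n).bound] with x hx
      rw [norm_smul]
      gcongr
      exact hx
    have c2 : eLpNorm (fun x => (v - w) x • f' n (c x) • k x) 2 (volume.restrict U)
        ≤ ENNReal.ofReal (max B 0) * ENNReal.ofReal δ := by
      refine (eLpNorm_le_mul_eLpNorm_of_ae_le_mul (g := v - w) (c := max B 0) ?_ 2).trans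
        (by gcongr)
      filter_upwards [(hcn n).bound_grad] with x hx
      rw [norm_smul, mul_comm]
      gcongr
    refine (add_le_add c1 c2).trans (le_trans (le_of_eq ?_) hδ)
    ring
  -- the truncated product has compact support
  set K := closure {x | x ∈ U ∧ x ∉ O ∧ 1 / ((n : ℝ) + 1) ≤ |c x|} with hK
  have hKU : K ⊆ closure U := closure_mono fun x hx => hx.1
  have hKc : IsCompact K := hUb.isCompact_closure.of_isClosed_subset isClosed_closure hKU
  have hKR : K ⊆ R := by
    intro p hp
    by_contra hpR
    have hpO : p ∉ O := by
      intro hpO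
      obtain ⟨y, hyO, hy⟩ := mem_closure_iff.1 hp O hO hpO
      exact hy.2.1 hyO
    -- A point of K outside R also lies outside O ⊇ Γ, so c tends to 0 there, against |c| ≥ 1/(n+1)
    -- at arbitrarily close points.
    have ht := hlim p (hKU hp) hpR fun h => hpO (hΓO h)
    have hev : ∀ᶠ x in nhdsWithin p U, |c x| < 1 / ((n : ℝ) + 1) := by
      have := ht.abs
      rw [abs_zero] at this
      exact this.eventually_lt_const (hpos n)
    obtain ⟨V, hV, hpV, hVU⟩ := mem_nhdsWithin.1 hev
    obtain ⟨y, hyV, hy⟩ := mem_closure_iff.1 hp V hV hpV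
    exact absurd (hVU ⟨hyV, hy.1⟩) (not_lt.2 hy.2.2)
  obtain ⟨φ, hφ, a1, a2⟩ := hmw.exists_testFunction_of_compact hU hKc hR hKR hRU
    (fun x hx hxK => by
      rw [Pi.mul_apply]
      by_cases hxO : x ∈ O
      · rw [hwO x ⟨hxO, hx⟩, mul_zero]
      · have : |c x| ≤ 1 / ((n : ℝ) + 1) := by
          by_contra hcx
          exact hxK (subset_closure ⟨hx, hxO, (not_le.1 hcx).le⟩)
        rw [Function.comp, h5 n _ this, zero_mul]) hε3
  have hthird : ε / 3 + ε / 3 + ε / 3 = ε := ENNReal.add_thirds ε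
  have hmono : volume.restrict R ≤ volume.restrict U := Measure.restrict_mono hRU le_rfl
  refine ⟨φ, hφ, (eLpNorm_mono_measure _ hmono).trans ?_, (eLpNorm_mono_measure _ hmono).trans ?_⟩
  · have e : c * v - φ = c * v - (f n ∘ c) * v + ((f n ∘ c) * v - (f n ∘ c) * w)
        + ((f n ∘ c) * w - φ) := by abel
    have m1 := (hcv.sub (hcnv n hv.toHasWG)).memLp.1
    rw [e, ← hthird]
    refine (eLpNorm_add_le (m1.add hmd.memLp.1) (hmw.memLp.sub (hφ.memLp 2)).1 (by norm_num)).trans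
      (add_le_add ?_ a1)
    exact (eLpNorm_add_le m1 hmd.memLp.1 (by norm_num)).trans (add_le_add hn1 b1)
  · have m1 := (hcv.sub (hcnv n hv.toHasWG)).memLp_grad.1
    rw [← sub_add_sub_cancel _ (fun x => f n (c x) • H x + w x • f' n (c x) • k x) (gradient φ),
      ← sub_add_sub_cancel _ (fun x => f n (c x) • G x + v x • f' n (c x) • k x)
      (fun x => f n (c x) • H x + w x • f' n (c x) • k x), ← hthird]
    refine (eLpNorm_add_le (m1.add hmd.memLp_grad.1) (hmw.memLp_grad.sub (hφ.memLp_gradient 2)).1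
      (by norm_num)).trans (add_le_add ?_ a2)
    exact (eLpNorm_add_le m1 hmd.memLp_grad.1 (by norm_num)).trans (add_le_add hn2 b2)

end

section

variable {d : ℕ}

/-! ### The energy form -/

variable {S T Ω : Set (E d)} {v w : E d → ℝ} {G G' H H' : E d → E d}
  {A : E d → Matrix (Fin d) (Fin d) ℝ} {αmin αmax : ℝ}

/-- The integrand of the energy form. -/
def density (A : E d → Matrix (Fin d) (Fin d) ℝ) (G H : E d → E d) (x : E d) : ℝ :=
  (A x *ᵥ (G x).ofLp) ⬝ᵥ (H x).ofLp

/-- The energy form in terms of gradients. -/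
def aint (A : E d → Matrix (Fin d) (Fin d) ℝ) (S : Set (E d)) (G H : E d → E d) : ℝ :=
  ∫ x in S, density A G H x

theorem ofLp_dotProduct_self (ξ : E d) : ξ.ofLp ⬝ᵥ ξ.ofLp = ‖ξ‖ ^ 2 := by
  rw [EuclideanSpace.real_norm_sq_eq, dotProduct]
  exact Finset.sum_congr rfl fun i _ => by ring

theorem density_add_left (x : E d) :
    density A (G + G') H x = density A G H x + density A G' H x := by
  simp [density, Matrix.mulVec_add, add_dotProduct]

theorem density_add_right (x : E d) :
    density A G (H + H') x = density A G H x + density A G H' x := by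
  simp [density, dotProduct_add]

theorem density_smul_left (c : ℝ) (x : E d) : density A (c • G) H x = c * density A G H x := by
  simp [density, Matrix.mulVec_smul, smul_dotProduct]

theorem density_smul_right (c : ℝ) (x : E d) : density A G (c • H) x = c * density A G H x := by
  simp [density, dotProduct_smul]

theorem aint_congr (hG : G =ᵐ[volume.restrict S] G') (hH : H =ᵐ[volume.restrict S] H') :
    aint A S G H = aint A S G' H' := by
  refine integral_congr_ae ?_
  filter_upwards [hG, hH] with x h1 h2
  simp [density, h1, h2]

theorem form_eq_aint (hS : IsOpen S) (hv : HasWG S v G) (hw : HasWG S w H) :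
    form A S v w = aint A S G H :=
  aint_congr (hv.ae_eq_weakGrad hS) (hw.ae_eq_weakGrad hS)

namespace IsElliptic

theorem mono (hA : IsElliptic Ω A αmin αmax) (hS : S ⊆ Ω) : IsElliptic S A αmin αmax where
  measurable i j := (hA.measurable i j).mono_measure (Measure.restrict_mono hS le_rfl)
  pos := hA.pos
  le := hA.le
  symm := ae_mono (Measure.restrict_mono hS le_rfl) hA.symm
  bounds := ae_mono (Measure.restrict_mono hS le_rfl) hA.bounds

variable (hA : IsElliptic S A αmin αmax)
include hA

theorem density_comm (G H : E d → E d) :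
    ∀ᵐ x ∂volume.restrict S, density A G H x = density A H G x := by
  filter_upwards [hA.symm] with x hx
  rw [density, density, dotProduct_comm, Matrix.dotProduct_mulVec, ← Matrix.mulVec_transpose,
    hx.eq]

theorem le_density (G : E d → E d) :
    ∀ᵐ x ∂volume.restrict S, αmin * ‖G x‖ ^ 2 ≤ density A G G x := by
  filter_upwards [hA.bounds] with x hx
  rw [← ofLp_dotProduct_self]
  exact (hx _).1

theorem density_le (G : E d → E d) :
    ∀ᵐ x ∂volume.restrict S, density A G G x ≤ αmax * ‖G x‖ ^ 2 := by
  filter_upwards [hA.bounds] with x hx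
  rw [← ofLp_dotProduct_self]
  exact (hx _).2

theorem density_nonneg (G : E d → E d) : ∀ᵐ x ∂volume.restrict S, 0 ≤ density A G G x := by
  filter_upwards [hA.le_density G] with x hx
  exact (mul_nonneg hA.pos.le (sq_nonneg _)).trans hx

/-- Polarisation: four times the density is the difference of the quadratic forms at G + H and G -
H, each between 0 and its upper ellipticity bound; the parallelogram law sums these bounds. -/
theorem abs_density_le (G H : E d → E d) :
    ∀ᵐ x ∂volume.restrict S, |density A G H x| ≤ αmax * (‖G x‖ ^ 2 + ‖H x‖ ^ 2) := by
  filter_upwards [hA.density_comm G H, hA.density_le (G + H), hA.density_le (G - H),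
    hA.density_nonneg (G + H), hA.density_nonneg (G - H)] with x h1 h2 h3 h4 h5
  have e1 : density A (G + H) (G + H) x = density A G G x + 2 * density A G H x +
      density A H H x := by
    rw [density_add_left, density_add_right, density_add_right, h1]; ring
  have e2 : density A (G - H) (G - H) x = density A G G x - 2 * density A G H x +
      density A H H x := by
    rw [show G - H = G + (-1 : ℝ) • H by simp [sub_eq_add_neg], density_add_left,
      density_add_right, density_add_right, density_smul_left, density_smul_left,
      density_smul_right, density_smul_right, h1]
    ring
  have p : ‖G x + H x‖ ^ 2 + ‖G x - H x‖ ^ 2 = 2 * (‖G x‖ ^ 2 + ‖H x‖ ^ 2) := by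
    have := parallelogram_law_with_norm ℝ (G x) (H x)
    nlinarith
  have hα : 0 ≤ αmax := hA.pos.le.trans hA.le
  have a1 : (0 : ℝ) ≤ αmax * ‖G x + H x‖ ^ 2 := by positivity
  have a2 : (0 : ℝ) ≤ αmax * ‖G x - H x‖ ^ 2 := by positivity
  have a3 : (0 : ℝ) ≤ αmax * (‖G x‖ ^ 2 + ‖H x‖ ^ 2) := by positivity
  have p' : αmax * ‖G x + H x‖ ^ 2 + αmax * ‖G x - H x‖ ^ 2 =
      2 * (αmax * (‖G x‖ ^ 2 + ‖H x‖ ^ 2)) := by rw [← mul_add, p]; ring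
  simp only [Pi.add_apply, Pi.sub_apply] at h2 h3
  rw [abs_le]
  constructor <;> linarith

theorem integrable_density (hG : MemLp G 2 (volume.restrict S))
    (hH : MemLp H 2 (volume.restrict S)) : Integrable (density A G H) (volume.restrict S) := by
  have hGs : Integrable (fun x => ‖G x‖ ^ 2) (volume.restrict S) := hG.integrable_norm_pow two_ne_zero
  have hHs : Integrable (fun x => ‖H x‖ ^ 2) (volume.restrict S) := hH.integrable_norm_pow two_ne_zero
  refine ((hGs.add hHs).const_mul αmax).mono' ?_ (hA.abs_density_le G H)
  have c : ∀ (F : E d → E d) (_ : MemLp F 2 (volume.restrict S)) (i : Fin d),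
      AEStronglyMeasurable (fun x => (F x).ofLp i) (volume.restrict S) := fun F hF i =>
    (EuclideanSpace.proj (𝕜 := ℝ) i).continuous.comp_aestronglyMeasurable hF.1
  have : density A G H = fun x => ∑ i, (∑ j, A x i j * (G x).ofLp j) * (H x).ofLp i := by
    ext x; simp [density, dotProduct, Matrix.mulVec]
  rw [this]
  refine Finset.aestronglyMeasurable_fun_sum _ fun i _ => ?_
  refine AEStronglyMeasurable.mul ?_ (c H hH i)
  exact Finset.aestronglyMeasurable_fun_sum _ fun j _ => (hA.measurable i j).mul (c G hG j)

theorem aint_add_left (hG : MemLp G 2 (volume.restrict S)) (hG' : MemLp G' 2 (volume.restrict S))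
    (hH : MemLp H 2 (volume.restrict S)) : aint A S (G + G') H = aint A S G H + aint A S G' H := by
  rw [aint, aint, aint, ← integral_add (hA.integrable_density hG hH) (hA.integrable_density hG' hH)]
  exact integral_congr_ae (ae_of_all _ fun x => density_add_left x)

theorem aint_comm (G H : E d → E d) : aint A S G H = aint A S H G :=
  integral_congr_ae (hA.density_comm G H)

omit hA in
theorem _root_.RingGFEM.aint_smul_left (c : ℝ) : aint A S (c • G) H = c * aint A S G H := by
  rw [aint, aint, ← integral_const_mul]
  exact integral_congr_ae (ae_of_all _ fun x => density_smul_left c x)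

omit hA in
theorem _root_.RingGFEM.aint_smul_right (c : ℝ) : aint A S G (c • H) = c * aint A S G H := by
  rw [aint, aint, ← integral_const_mul]
  exact integral_congr_ae (ae_of_all _ fun x => density_smul_right c x)

omit hA in
theorem _root_.RingGFEM.aint_zero_left : aint A S 0 H = 0 := by
  simpa using aint_smul_left (A := A) (S := S) (G := (0 : E d → E d)) (H := H) 0

omit hA in
theorem _root_.RingGFEM.aint_zero_right : aint A S G 0 = 0 := by
  simpa using aint_smul_right (A := A) (S := S) (G := G) (H := (0 : E d → E d)) 0

theorem aint_add_right (hG : MemLp G 2 (volume.restrict S)) (hH : MemLp H 2 (volume.restrict S))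
    (hH' : MemLp H' 2 (volume.restrict S)) :
    aint A S G (H + H') = aint A S G H + aint A S G H' := by
  rw [hA.aint_comm, hA.aint_add_left hH hH' hG, hA.aint_comm H, hA.aint_comm H']

theorem aint_sub_left (hG : MemLp G 2 (volume.restrict S)) (hG' : MemLp G' 2 (volume.restrict S))
    (hH : MemLp H 2 (volume.restrict S)) : aint A S (G - G') H = aint A S G H - aint A S G' H := by
  have : G - G' = G + (-1 : ℝ) • G' := by simp [sub_eq_add_neg]
  rw [this, hA.aint_add_left hG (hG'.const_smul _) hH, aint_smul_left]
  ring

theorem aint_sub_right (hG : MemLp G 2 (volume.restrict S)) (hH : MemLp H 2 (volume.restrict S))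
    (hH' : MemLp H' 2 (volume.restrict S)) :
    aint A S G (H - H') = aint A S G H - aint A S G H' := by
  rw [hA.aint_comm, hA.aint_sub_left hH hH' hG, hA.aint_comm H, hA.aint_comm H']

theorem aint_self_nonneg (G : E d → E d) : 0 ≤ aint A S G G :=
  integral_nonneg_of_ae (hA.density_nonneg G)

theorem le_aint (hG : MemLp G 2 (volume.restrict S)) :
    αmin * (eLpNorm G 2 (volume.restrict S)).toReal ^ 2 ≤ aint A S G G := by
  rw [← integral_norm_sq_eq hG.1, ← integral_const_mul]
  exact integral_mono_ae ((hG.integrable_norm_pow two_ne_zero).const_mul _)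
    (hA.integrable_density hG hG) (hA.le_density G)

theorem aint_le (hG : MemLp G 2 (volume.restrict S)) :
    aint A S G G ≤ αmax * (eLpNorm G 2 (volume.restrict S)).toReal ^ 2 := by
  rw [← integral_norm_sq_eq hG.1, ← integral_const_mul]
  exact integral_mono_ae (hA.integrable_density hG hG)
    ((hG.integrable_norm_pow two_ne_zero).const_mul _) (hA.density_le G)

theorem eq_zero_of_aint_eq_zero (hG : MemLp G 2 (volume.restrict S)) (h : aint A S G G = 0) :
    G =ᵐ[volume.restrict S] 0 := by
  have h1 := hA.le_aint hG
  have h2 : (eLpNorm G 2 (volume.restrict S)).toReal ^ 2 = 0 := by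
    have h3 := sq_nonneg (eLpNorm G 2 (volume.restrict S)).toReal
    nlinarith [hA.pos]
  have h4 : (eLpNorm G 2 (volume.restrict S)).toReal = 0 := by simpa using h2
  rw [ENNReal.toReal_eq_zero_iff, or_iff_left hG.2.ne] at h4
  exact (eLpNorm_eq_zero_iff hG.1 two_ne_zero).1 h4

theorem aint_mono (hTS : T ⊆ S) (hG : MemLp G 2 (volume.restrict S)) :
    aint A T G G ≤ aint A S G G :=
  setIntegral_mono_set (hA.integrable_density hG hG) (hA.density_nonneg G) hTS.eventuallyLE

theorem aint_sq_le (hG : MemLp G 2 (volume.restrict S)) (hH : MemLp H 2 (volume.restrict S)) :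
    aint A S G H ^ 2 ≤ aint A S G G * aint A S H H := by
  have key : ∀ t : ℝ, 0 ≤ aint A S H H * (t * t) + (2 * aint A S G H) * t + aint A S G G := by
    intro t
    have := hA.aint_self_nonneg (G + t • H)
    have htH := hH.const_smul t
    rw [hA.aint_add_left hG htH (hG.add htH), hA.aint_add_right hG hG htH,
      hA.aint_add_right htH hG htH, aint_smul_left, aint_smul_left, aint_smul_right,
      aint_smul_right, hA.aint_comm H G] at this
    nlinarith
  have := discrim_le_zero key
  rw [discrim] at this
  nlinarith

theorem aint_sub_self (hG : MemLp G 2 (volume.restrict S)) (hH : MemLp H 2 (volume.restrict S)) :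
    aint A S (G - H) (G - H) = aint A S G G - 2 * aint A S G H + aint A S H H := by
  rw [hA.aint_sub_left hG hH (hG.sub hH), hA.aint_sub_right hG hG hH, hA.aint_sub_right hH hG hH,
    hA.aint_comm H G]
  ring

theorem aint_add_self (hG : MemLp G 2 (volume.restrict S)) (hH : MemLp H 2 (volume.restrict S)) :
    aint A S (G + H) (G + H) = aint A S G G + 2 * aint A S G H + aint A S H H := by
  rw [hA.aint_add_left hG hH (hG.add hH), hA.aint_add_right hG hG hH, hA.aint_add_right hH hG hH,
    hA.aint_comm H G]
  ring

end IsElliptic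

/-- The integral over `S` of fields supported in `T ⊆ S`. -/
theorem aint_eq_of_subset (hS : IsOpen S) (hTS : T ⊆ S)
    (h : ∀ᵐ x ∂volume.restrict S, x ∉ T → density A G H x = 0) : aint A S G H = aint A T G H := by
  refine setIntegral_eq_of_subset_of_ae_sdiff_eq_zero hS.measurableSet.nullMeasurableSet hTS ?_
  filter_upwards [(ae_restrict_iff' hS.measurableSet).1 h] with x hx hxT
  exact hx hxT.1 hxT.2

end

section

variable {d : ℕ}

/-! ### A variational eigenvalue problem for a pair of forms -/

/-- A symmetric positive semidefinite bilinear form. -/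
structure IsPSD {V : Type*} [AddCommGroup V] [Module ℝ V] (a : LinearMap.BilinForm ℝ V) : Prop where
  symm : ∀ x y, a x y = a y x
  nonneg : ∀ x, 0 ≤ a x x

/-- Sequences bounded for `a + N` have `N`-Cauchy subsequences, and `a + N` is complete. -/
structure IsCompactPair {V : Type*} [AddCommGroup V] [Module ℝ V]
    (a N : LinearMap.BilinForm ℝ V) : Prop where
  left : IsPSD a
  right : IsPSD N
  compact : ∀ (x : ℕ → V) (M : ℝ), (∀ m, a (x m) (x m) + N (x m) (x m) ≤ M) →
    ∃ ψ : ℕ → ℕ, StrictMono ψ ∧ ∀ ε : ℝ, 0 < ε → ∃ K, ∀ m ≥ K, ∀ l ≥ K,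
      N (x (ψ m) - x (ψ l)) (x (ψ m) - x (ψ l)) ≤ ε
  complete : ∀ x : ℕ → V, (∀ ε : ℝ, 0 < ε → ∃ K, ∀ m ≥ K, ∀ l ≥ K,
      a (x m - x l) (x m - x l) + N (x m - x l) (x m - x l) ≤ ε) →
    ∃ z, ∀ ε : ℝ, 0 < ε → ∃ K, ∀ m ≥ K, a (x m - z) (x m - z) + N (x m - z) (x m - z) ≤ ε

section Abstract

variable {V : Type*} [AddCommGroup V] [Module ℝ V] {a N B Q : LinearMap.BilinForm ℝ V}
  {X : Submodule ℝ V}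

/-- Nonnegativity is required on X only, so that this and its companions apply to σa - B, which is
semidefinite merely on a complement of eigenvectors. -/
theorem form_sub_self_le (hs : ∀ x y, Q x y = Q y x) (hQ : ∀ x ∈ X, 0 ≤ Q x x) {x y : V}
    (hx : x ∈ X) (hy : y ∈ X) : Q (x - y) (x - y) ≤ 2 * Q x x + 2 * Q y y := by
  have h := hQ _ (X.add_mem hx hy)
  simp only [map_add, map_sub, LinearMap.add_apply, LinearMap.sub_apply, hs y x] at h ⊢
  linarith

theorem form_le_two_mul (hs : ∀ x y, Q x y = Q y x) (hQ : ∀ x ∈ X, 0 ≤ Q x x) {x y : V}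
    (hx : x ∈ X) (hy : y ∈ X) : Q x x ≤ 2 * Q (x - y) (x - y) + 2 * Q y y := by
  have h := hQ _ (X.sub_mem (X.sub_mem hx hy) hy)
  simp only [map_sub, LinearMap.sub_apply, hs y x] at h ⊢
  linarith

theorem form_sq_le (hs : ∀ x y, Q x y = Q y x) (hQ : ∀ x ∈ X, 0 ≤ Q x x) {x y : V}
    (hx : x ∈ X) (hy : y ∈ X) : Q x y ^ 2 ≤ Q x x * Q y y := by
  have key : ∀ t : ℝ, 0 ≤ Q y y * (t * t) + (2 * Q x y) * t + Q x x := by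
    intro t
    have h := hQ _ (X.add_mem hx (X.smul_mem t hy))
    simp only [map_add, map_smul, LinearMap.add_apply, LinearMap.smul_apply, smul_eq_mul,
      hs y x] at h
    nlinarith
  have := discrim_le_zero key
  rw [discrim] at this
  nlinarith

theorem IsPSD.le_two_mul (h : IsPSD a) (x y : V) : a x x ≤ 2 * a (x - y) (x - y) + 2 * a y y :=
  form_le_two_mul (X := ⊤) h.symm (fun x _ => h.nonneg x) trivial trivial

theorem IsPSD.sq_le (h : IsPSD a) (x y : V) : a x y ^ 2 ≤ a x x * a y y :=
  form_sq_le (X := ⊤) h.symm (fun x _ => h.nonneg x) trivial trivial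

theorem IsPSD.eq_zero_of_self (h : IsPSD a) {x : V} (hx : a x x = 0) (y : V) : a x y = 0 := by
  have := h.sq_le x y
  rw [hx, zero_mul] at this
  exact pow_eq_zero_iff two_ne_zero |>.1 (le_antisymm this (sq_nonneg _))

theorem IsPSD.sub_comm (a : LinearMap.BilinForm ℝ V) (x y : V) :
    a (x - y) (x - y) = a (y - x) (y - x) := by
  rw [← neg_sub y x, map_neg, map_neg, LinearMap.neg_apply, neg_neg]

/-- Minimising sequences of a semidefinite form that controls `a` up to `N`. -/
theorem IsCompactPair.exists_limit (h : IsCompactPair a N)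
    (hX : ∀ z, (∀ ε : ℝ, 0 < ε → ∃ x ∈ X, N (x - z) (x - z) ≤ ε) → z ∈ X)
    (hs : ∀ x y, Q x y = Q y x) (hQ : ∀ x ∈ X, 0 ≤ Q x x) {c c' : ℝ} (hc : 0 < c) (hc' : 0 < c')
    (haQ : ∀ x ∈ X, a x x ≤ c * (Q x x + N x x)) (hQa : ∀ x ∈ X, Q x x ≤ c' * a x x)
    {x : ℕ → V} (hx : ∀ m, x m ∈ X) {M : ℝ} (hM : ∀ m, N (x m) (x m) ≤ M)
    (hlim : ∀ ε : ℝ, 0 < ε → ∃ K, ∀ m ≥ K, Q (x m) (x m) ≤ ε) (hQM : ∀ m, Q (x m) (x m) ≤ M) :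
    ∃ z ∈ X, Q z z = 0 ∧ ∀ ε : ℝ, 0 < ε → ∃ m, N (x m - z) (x m - z) ≤ ε := by
  obtain ⟨ψ, hψ, hN⟩ := h.compact x (c * (M + M) + M) fun m => by
    have h1 := haQ _ (hx m)
    have h2 := mul_le_mul_of_nonneg_left (add_le_add (hQM m) (hM m)) hc.le
    linarith [hM m]
  -- The subsequence is N-Cauchy. The differences also have small Q by the parallelogram inequality,
  -- and a ≤ c(Q + N) upgrades this to Cauchy for a + N. With every quantity at most δ the total is
  -- (5c + 1)δ, which 6c + 2 dominates.
  obtain ⟨z, hz⟩ := h.complete (fun m => x (ψ m)) fun ε hε => by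
    have hδ : 0 < ε / (6 * c + 2) := by positivity
    obtain ⟨K₁, hK₁⟩ := hN _ hδ
    obtain ⟨K₂, hK₂⟩ := hlim _ hδ
    refine ⟨max K₁ K₂, fun m hm l hl => ?_⟩
    have n1 := hK₁ m (le_trans (le_max_left _ _) hm) l (le_trans (le_max_left _ _) hl)
    have q1 := hK₂ (ψ m) ((le_trans (le_max_right _ _) hm).trans (hψ.id_le m))
    have q2 := hK₂ (ψ l) ((le_trans (le_max_right _ _) hl).trans (hψ.id_le l))
    have q3 := form_sub_self_le hs hQ (hx (ψ m)) (hx (ψ l))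
    have a1 := haQ _ (X.sub_mem (hx (ψ m)) (hx (ψ l)))
    have a2 : c * (Q (x (ψ m) - x (ψ l)) (x (ψ m) - x (ψ l)) +
        N (x (ψ m) - x (ψ l)) (x (ψ m) - x (ψ l))) ≤ c * (5 * (ε / (6 * c + 2))) :=
      mul_le_mul_of_nonneg_left (by linarith) hc.le
    have e : (6 * c + 2) * (ε / (6 * c + 2)) = ε := by field_simp
    have : 0 < c * (ε / (6 * c + 2)) := by positivity
    nlinarith
  have hzX : z ∈ X := hX z fun ε hε => by
    obtain ⟨K, hK⟩ := hz ε hε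
    exact ⟨_, hx (ψ K), by linarith [hK K le_rfl, h.left.nonneg (x (ψ K) - z)]⟩
  refine ⟨z, hzX, le_antisymm (le_of_forall_pos_le_add fun ε hε => ?_) (hQ z hzX), fun ε hε => ?_⟩
  · have hδ : 0 < ε / (2 * c' + 2) := by positivity
    obtain ⟨K₁, hK₁⟩ := hz _ hδ
    obtain ⟨K₂, hK₂⟩ := hlim _ hδ
    have n1 := hK₁ (max K₁ K₂) (le_max_left _ _)
    have n2 := h.right.nonneg (x (ψ (max K₁ K₂)) - z)
    have q1 := hK₂ (ψ (max K₁ K₂)) ((le_max_right _ _).trans (hψ.id_le _))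
    have q2 := form_le_two_mul hs hQ hzX (hx (ψ (max K₁ K₂)))
    rw [IsPSD.sub_comm Q] at q2
    have q3 := hQa _ (X.sub_mem (hx (ψ (max K₁ K₂))) hzX)
    have q4 := mul_le_mul_of_nonneg_left (show a (x (ψ (max K₁ K₂)) - z)
      (x (ψ (max K₁ K₂)) - z) ≤ ε / (2 * c' + 2) by linarith) hc'.le
    have e : (2 * c' + 2) * (ε / (2 * c' + 2)) = ε := by field_simp
    nlinarith
  · obtain ⟨K, hK⟩ := hz ε hε
    exact ⟨ψ K, by linarith [hK K le_rfl, h.left.nonneg (x (ψ K) - z)]⟩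

/-- A Poincaré inequality on subspaces on which `a` has trivial kernel. -/
theorem IsCompactPair.exists_poincare (h : IsCompactPair a N)
    (hX : ∀ z, (∀ ε : ℝ, 0 < ε → ∃ x ∈ X, N (x - z) (x - z) ≤ ε) → z ∈ X)
    (hker : ∀ x ∈ X, a x x = 0 → N x x = 0) :
    ∃ C : ℝ, 0 < C ∧ ∀ x ∈ X, N x x ≤ C * a x x := by
  by_contra! hcon
  -- Normalised counterexamples have N = 1 and vanishing energy; their limit has zero energy, so N =
  -- 0 there by hypothesis, while N stays close to 1.
  have hex : ∀ m : ℕ, ∃ x ∈ X, N x x = 1 ∧ a x x ≤ 1 / ((m : ℝ) + 1) := by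
    intro m
    obtain ⟨x, hx, hlt⟩ := hcon ((m : ℝ) + 1) (by positivity)
    have ha := h.left.nonneg x
    have hpos : 0 < N x x := lt_of_le_of_lt (by positivity) hlt
    have hsq : Real.sqrt (N x x) ^ 2 = N x x := Real.sq_sqrt hpos.le
    have hne : Real.sqrt (N x x) ≠ 0 := (Real.sqrt_pos.2 hpos).ne'
    refine ⟨(Real.sqrt (N x x))⁻¹ • x, X.smul_mem _ hx, ?_, ?_⟩
    · simp only [map_smul, LinearMap.smul_apply, smul_eq_mul]
      field_simp
      exact hsq.symm
    · simp only [map_smul, LinearMap.smul_apply, smul_eq_mul]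
      rw [← mul_assoc, ← mul_inv, ← sq, hsq, inv_mul_le_iff₀ hpos, mul_one_div,
        le_div_iff₀ (by positivity)]
      linarith
  choose x hx hN ha using hex
  have ha1 : ∀ m, a (x m) (x m) ≤ 1 := fun m => (ha m).trans (by
    rw [div_le_one (by positivity)]; linarith [m.cast_nonneg (α := ℝ)])
  obtain ⟨z, hzX, hz, hNz⟩ := h.exists_limit (Q := a) hX h.left.symm
    (fun x _ => h.left.nonneg x) (c := 1) (c' := 1) one_pos one_pos
    (fun x _ => by linarith [h.right.nonneg x]) (fun x _ => by simp) hx (M := 1)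
    (fun m => (hN m).le) (fun ε hε => by
      obtain ⟨K, hK⟩ := exists_nat_one_div_lt hε
      refine ⟨K, fun m hm => (ha m).trans (le_trans ?_ hK.le)⟩
      have : (K : ℝ) ≤ m := by exact_mod_cast hm
      exact one_div_le_one_div_of_le (by positivity) (by linarith)) ha1
  obtain ⟨m, hm⟩ := hNz (1 / 4) (by norm_num)
  have := h.right.le_two_mul (x m) z
  rw [hN m, hker z hzX hz] at this
  linarith

/-- The maximiser of the Rayleigh quotient of `B` and `a`. -/
theorem IsCompactPair.exists_maximizer (h : IsCompactPair a N) (hB : IsPSD B) {C : ℝ} (hC : 0 < C)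
    (hBN : ∀ x, B x x ≤ C * N x x)
    (hX : ∀ z, (∀ ε : ℝ, 0 < ε → ∃ x ∈ X, N (x - z) (x - z) ≤ ε) → z ∈ X)
    (hker : ∀ x ∈ X, a x x = 0 → N x x = 0) {D : ℝ} (hD : 0 ≤ D) {y : V} (hy : y ∈ X)
    (hyD : D * a y y < B y y) :
    ∃ w ∈ X, ∃ σ : ℝ, D < σ ∧ 0 < B w w ∧ ∀ φ ∈ X, B w φ = σ * a w φ := by
  obtain ⟨P, hP, hPoinc⟩ := h.exists_poincare hX hker
  set s : Set ℝ := {t | ∃ x ∈ X, a x x ≤ 1 ∧ t = B x x} with hsdef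
  have hbdd : BddAbove s := ⟨C * P, by
    rintro _ ⟨x, hx, hx1, rfl⟩
    have := hPoinc x hx
    calc B x x ≤ C * N x x := hBN x
      _ ≤ C * (P * 1) := by gcongr; exact this.trans (by gcongr)
      _ = C * P := by ring⟩
  set σ := sSup s with hσ
  have hle : ∀ x ∈ X, B x x ≤ σ * a x x := by
    intro x hx
    rcases (h.left.nonneg x).eq_or_lt with h0 | hpos
    · have h1 := hBN x
      rw [hker x hx h0.symm, mul_zero] at h1
      rw [← h0, mul_zero]; exact h1
    · have hsq : Real.sqrt (a x x) ^ 2 = a x x := Real.sq_sqrt hpos.le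
      have hne : Real.sqrt (a x x) ≠ 0 := (Real.sqrt_pos.2 hpos).ne'
      have hmem : (a x x)⁻¹ * B x x ∈ s := by
        refine ⟨(Real.sqrt (a x x))⁻¹ • x, X.smul_mem _ hx, ?_, ?_⟩
        · simp only [map_smul, LinearMap.smul_apply, smul_eq_mul]
          rw [← mul_assoc, ← mul_inv, ← sq, hsq, inv_mul_cancel₀ hpos.ne']
        · simp only [map_smul, LinearMap.smul_apply, smul_eq_mul]
          rw [← mul_assoc, ← mul_inv, ← sq, hsq]
      have := le_csSup hbdd hmem
      rwa [inv_mul_le_iff₀ hpos, mul_comm] at this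
  have hDσ : D < σ := by
    have h1 := hle y hy
    by_contra! hcon
    have := mul_le_mul_of_nonneg_right hcon (h.left.nonneg y)
    linarith
  have hσ0 : 0 < σ := hD.trans_lt hDσ
  have hex : ∀ m : ℕ, ∃ x ∈ X, a x x ≤ 1 ∧ σ - σ / (2 * ((m : ℝ) + 1)) < B x x := by
    intro m
    have hne : s.Nonempty := ⟨0, 0, X.zero_mem, by simp, by simp⟩
    obtain ⟨_, ⟨x, hx, hx1, rfl⟩, hlt⟩ := exists_lt_of_lt_csSup hne
      (show σ - σ / (2 * ((m : ℝ) + 1)) < sSup s by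
        rw [← hσ]; linarith [show 0 < σ / (2 * ((m : ℝ) + 1)) by positivity])
    exact ⟨x, hx, hx1, hlt⟩
  choose x hx hxa hxB using hex
  -- The form σa - B is nonnegative on X and tends to 0 along the maximising sequence. It controls a
  -- up to N, because σa = Q + B ≤ Q + CN.
  have hQs : ∀ x y, (σ • a - B) x y = (σ • a - B) y x := fun x y => by
    simp [h.left.symm x y, hB.symm x y]
  have hQ : ∀ x ∈ X, 0 ≤ (σ • a - B) x x := fun x hx => by
    simpa using hle x hx
  have hQx : ∀ m, (σ • a - B) (x m) (x m) ≤ σ / (2 * ((m : ℝ) + 1)) := fun m => by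
    have := mul_le_mul_of_nonneg_left (hxa m) hσ0.le
    simp only [LinearMap.sub_apply, LinearMap.smul_apply, smul_eq_mul]
    linarith [hxB m]
  obtain ⟨w, hwX, hw, hNw⟩ := h.exists_limit (Q := σ • a - B) hX hQs hQ (c := (1 + C) / σ)
    (c' := σ) (by positivity) hσ0 (fun x hx => by
      have h1 := hBN x
      have h2 := hQ x hx
      have h3 := h.right.nonneg x
      simp only [LinearMap.sub_apply, LinearMap.smul_apply, smul_eq_mul] at h2 ⊢
      rw [div_mul_eq_mul_div, le_div_iff₀ hσ0]
      nlinarith) (fun x _ => by simpa using hB.nonneg x) hx (M := P + σ)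
    (fun m => by
      have := hPoinc _ (hx m)
      nlinarith [hxa m]) (fun ε hε => by
      obtain ⟨K, hK⟩ := exists_nat_one_div_lt (show 0 < ε / σ by positivity)
      refine ⟨K, fun m hm => (hQx m).trans ?_⟩
      have : (K : ℝ) ≤ m := by exact_mod_cast hm
      rw [lt_div_iff₀ hσ0] at hK
      refine le_trans ?_ hK.le
      rw [div_mul_eq_mul_div, one_mul]
      have hm0 := m.cast_nonneg (α := ℝ)
      exact div_le_div_of_nonneg_left hσ0.le (by positivity) (by linarith))
    (fun m => (hQx m).trans (by
      have : σ / (2 * ((m : ℝ) + 1)) ≤ σ := div_le_self hσ0.le (by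
        linarith [m.cast_nonneg (α := ℝ)])
      linarith))
  refine ⟨w, hwX, σ, hDσ, ?_, fun φ hφ => ?_⟩
  -- Every x_m has B > σ/2. Taking N(x_m - w) ≤ σ/(8C) leaves B(w,w) > σ/8.
  · obtain ⟨m, hm⟩ := hNw (σ / (8 * C)) (by positivity)
    have h1 := hB.le_two_mul (x m) w
    have h2 := hBN (x m - w)
    have h3 := mul_le_mul_of_nonneg_left hm hC.le
    have h4 : C * (σ / (8 * C)) = σ / 8 := by field_simp
    have h5 : σ / (2 * ((m : ℝ) + 1)) ≤ σ / 2 :=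
      div_le_div_of_nonneg_left hσ0.le (by positivity) (by linarith [m.cast_nonneg (α := ℝ)])
    linarith [hxB m]
  -- Since Q is nonnegative on X and Q(w,w) = 0, Cauchy–Schwarz gives Q(w,φ) = 0: the Euler equation
  -- without differentiating.
  · have := form_sq_le hQs hQ hwX hφ
    rw [hw, zero_mul] at this
    have h0 := pow_eq_zero_iff two_ne_zero |>.1 (le_antisymm this (sq_nonneg _))
    simp only [LinearMap.sub_apply, LinearMap.smul_apply, smul_eq_mul] at h0
    linarith

/-- Projection onto a finite family, orthogonal for a semidefinite form. -/
theorem IsPSD.exists_projection {ι : Type*} (hB : IsPSD B) (s : Finset ι) (v : ι → V) (φ : V) :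
    ∃ p ∈ Submodule.span ℝ (v '' s), ∀ k ∈ s, B (v k) (φ - p) = 0 := by
  classical
  induction s using Finset.induction_on generalizing φ with
  | empty => exact ⟨0, Submodule.zero_mem _, by simp⟩
  | insert i s hi ih =>
    obtain ⟨p, hp, hpv⟩ := ih φ
    obtain ⟨q, hq, hqv⟩ := ih (v i)
    have hsub : Submodule.span ℝ (v '' s) ≤ Submodule.span ℝ (v '' (insert i s : Finset ι)) :=
      Submodule.span_mono (image_mono (by simp))
    have hperp : ∀ x ∈ Submodule.span ℝ (v '' s), ∀ z, (∀ k ∈ s, B (v k) z = 0) → B x z = 0 := by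
      intro x hx z hz
      induction hx using Submodule.span_induction with
      | mem x hx => obtain ⟨k, hk, rfl⟩ := hx; exact hz k hk
      | zero => simp
      | add x y _ _ h1 h2 => simp [h1, h2]
      | smul c x _ h1 => simp [h1]
    set e := v i - q with he
    have hvi : v i = q + e := by simp [he]
    -- Gram–Schmidt for a semidefinite form: a null direction e is B-orthogonal to everything, and
    -- the coefficient 0 serves.
    obtain ⟨t, ht⟩ : ∃ t : ℝ, B e (φ - p) - t * B e e = 0 := by
      by_cases h0 : B e e = 0
      · exact ⟨0, by simp [hB.eq_zero_of_self h0]⟩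
      · exact ⟨B e (φ - p) / B e e, by field_simp; simp⟩
    have hs : ∀ k ∈ s, B (v k) (φ - (p + t • e)) = 0 := fun k hk => by
      have h1 := hpv k hk
      have h2 := hqv k hk
      rw [← sub_sub, map_sub, h1, map_smul, h2]; simp
    refine ⟨p + t • e, ?_, fun k hk => ?_⟩
    · refine Submodule.add_mem _ (hsub hp) (Submodule.smul_mem _ _ (Submodule.sub_mem _ ?_ (hsub hq)))
      exact Submodule.subset_span ⟨i, by simp, rfl⟩
    · rcases Finset.mem_insert.1 hk with rfl | hk
      · rw [hvi, map_add, LinearMap.add_apply, hperp q hq _ hs, zero_add, ← sub_sub, map_sub,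
          map_smul, smul_eq_mul, ht]
      · exact hs k hk

/-- Orthogonal complements are closed. -/
theorem IsPSD.eq_zero_of_forall_exists (hN : IsPSD N) (hB : IsPSD B) {C : ℝ} (hC : 0 < C)
    (hBN : ∀ x, B x x ≤ C * N x x) {v z : V}
    (hz : ∀ ε : ℝ, 0 < ε → ∃ x, B v x = 0 ∧ N (x - z) (x - z) ≤ ε) : B v z = 0 := by
  by_contra hne
  have hpos : 0 < B v z ^ 2 := by positivity
  have hvk := hB.nonneg v
  -- The tolerance makes the Cauchy–Schwarz bound B(v,v)·C·N(x - z) at most half of B(v,z)² = B(v,x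
  -- - z)².
  obtain ⟨x, hx, hxε⟩ := hz (B v z ^ 2 / (2 * C * (B v v + 1))) (by positivity)
  have h1 := hB.sq_le v (x - z)
  rw [map_sub, hx, zero_sub, neg_sq] at h1
  rw [le_div_iff₀ (by positivity)] at hxε
  have h2 := mul_le_mul_of_nonneg_left (hBN (x - z)) hvk
  have h3 := mul_nonneg hC.le (hN.nonneg (x - z))
  nlinarith

/-- The complement of the first eigenvectors: width bounds transfer to it. -/
theorem IsCompactPair.le_of_width (h : IsCompactPair a N) (hB : IsPSD B) {C : ℝ} (hC : 0 < C)
    (hBN : ∀ x, B x x ≤ C * N x x) {n : ℕ} {v : Fin n → V} {μ : Fin n → ℝ}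
    (heig : ∀ k φ, a (v k) φ = μ k * B (v k) φ)
    (hlin : ∀ c : Fin n → ℝ, N (∑ k, c k • v k) (∑ k, c k • v k) = 0 → c = 0)
    (hfirst : ∀ w ν, N w w ≠ 0 → (∀ φ, a w φ = ν * B w φ) →
      (∀ c : Fin n → ℝ, N (w - ∑ k, c k • v k) (w - ∑ k, c k • v k) ≠ 0) → ∀ k, μ k ≤ ν)
    (hker : ∀ x, (∀ k, B (v k) x = 0) → a x x = 0 → N x x = 0)
    {ι : Type*} [Fintype ι] (hι : Fintype.card ι ≤ n) (ℓ : ι → V →ₗ[ℝ] ℝ) {D : ℝ} (hD : 0 ≤ D)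
    (hwidth : ∀ z, (∀ j, ℓ j z = 0) → B z z ≤ D * a z z)
    (hnull : ∀ z, (∀ j, ℓ j z = 0) → a z z = 0 → N z z = 0)
    {y : V} (hy : ∀ k, B (v k) y = 0) : B y y ≤ D * a y y := by
  by_contra! hcon
  set X : Submodule ℝ V := ⨅ k, LinearMap.ker (B (v k)) with hXdef
  have hmemX : ∀ x, x ∈ X ↔ ∀ k, B (v k) x = 0 := fun x => by
    simp [hXdef, Submodule.mem_iInf]
  have hX : ∀ z, (∀ ε : ℝ, 0 < ε → ∃ x ∈ X, N (x - z) (x - z) ≤ ε) → z ∈ X := fun z hz =>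
    (hmemX z).2 fun k => h.right.eq_zero_of_forall_exists hB hC hBN fun ε hε => by
      obtain ⟨x, hx, hxε⟩ := hz ε hε
      exact ⟨x, (hmemX x).1 hx k, hxε⟩
  -- If the bound failed at y, the supremum of B/a on X would exceed D and be attained.
  obtain ⟨w, hwX, σ, hσ, hBw, hw⟩ := h.exists_maximizer hB hC hBN hX
    (fun x hx => hker x ((hmemX x).1 hx)) hD ((hmemX y).2 hy) hcon
  have hσ0 : 0 < σ := hD.trans_lt hσ
  have hwv : ∀ k, B (v k) w = 0 := (hmemX w).1 hwX
  have hav : ∀ k, a (v k) w = 0 := fun k => by rw [heig, hwv, mul_zero]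
  have hspan : ∀ p ∈ Submodule.span ℝ (v '' (Finset.univ : Finset (Fin n))),
      B w p = 0 ∧ a w p = 0 := by
    intro p hp
    induction hp using Submodule.span_induction with
    | mem x hx =>
      obtain ⟨k, _, rfl⟩ := hx
      exact ⟨by rw [hB.symm, hwv], by rw [h.left.symm, hav]⟩
    | zero => simp
    | add x y _ _ h1 h2 => simp [h1, h2]
    | smul c x _ h1 => simp [h1]
  -- The equation is known on X. Every φ is a member of X plus a combination of the v_k, and both
  -- B(w,·) and a(w,·) vanish on the latter.
  have hwall : ∀ φ, B w φ = σ * a w φ := by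
    intro φ
    obtain ⟨p, hp, hpv⟩ := hB.exists_projection Finset.univ v φ
    have h1 := hw (φ - p) ((hmemX _).2 fun k => hpv k (Finset.mem_univ k))
    rw [map_sub, map_sub, (hspan p hp).1, (hspan p hp).2] at h1
    simpa using h1
  -- If w were a combination up to null vectors, then B(w,w) would vanish, since w is B-orthogonal
  -- to every v_k.
  have hnotspan : ∀ c : Fin n → ℝ, N (w - ∑ k, c k • v k) (w - ∑ k, c k • v k) ≠ 0 := by
    intro c h0
    have h1 := hBN (w - ∑ k, c k • v k)
    rw [h0, mul_zero] at h1
    have h2 := hB.eq_zero_of_self (le_antisymm h1 (hB.nonneg _)) w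
    have hwv' : ∀ k, B w (v k) = 0 := fun k => by rw [hB.symm, hwv]
    rw [hB.symm, map_sub, map_sum] at h2
    simp only [map_smul, hwv', smul_zero, Finset.sum_const_zero, sub_zero] at h2
    exact hBw.ne' h2
  have hNw : N w w ≠ 0 := by simpa using hnotspan 0
  have hμ : ∀ k, μ k ≤ 1 / σ := hfirst w (1 / σ) hNw
    (fun φ => by rw [hwall φ]; field_simp) hnotspan
  -- a nontrivial combination annihilated by all functionals
  obtain ⟨⟨c, t⟩, hct, hne⟩ : ∃ p : (Fin n → ℝ) × ℝ,
      (∀ j, ℓ j (∑ k, p.1 k • v k + p.2 • w) = 0) ∧ p ≠ 0 := by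
    let F : ((Fin n → ℝ) × ℝ) →ₗ[ℝ] (ι → ℝ) :=
      { toFun := fun p j => ℓ j (∑ k, p.1 k • v k + p.2 • w)
        map_add' := fun p q => by
          ext j
          simp only [Prod.fst_add, Prod.snd_add, Pi.add_apply, add_smul, Finset.sum_add_distrib,
            map_add]
          ring
        map_smul' := fun r p => by
          ext j
          simp only [Prod.smul_fst, Prod.smul_snd, Pi.smul_apply, smul_eq_mul, mul_smul,
            ← Finset.smul_sum, map_add, map_smul, RingHom.id_apply]
          ring }
    -- There are n + 1 coefficients against at most n functionals.
    have hF : LinearMap.ker F ≠ ⊥ := LinearMap.ker_ne_bot_of_finrank_lt (by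
      simpa using Nat.lt_succ_of_le hι)
    obtain ⟨p, hp, hp0⟩ := (Submodule.ne_bot_iff _).1 hF
    exact ⟨p, fun j => congrFun (LinearMap.mem_ker.1 hp) j, hp0⟩
  set z := ∑ k, c k • v k + t • w with hz
  -- Eigenvectors of different eigenvalues are B-orthogonal. Within one eigenspace orthogonality is
  -- neither known nor needed.
  have hBμ : ∀ k l, (μ k - μ l) * B (v k) (v l) = 0 := fun k l => by
    have h1 := heig k (v l)
    rw [h.left.symm, heig l (v k), hB.symm] at h1
    linarith
  -- The w-component drops out of B - σa. Since 1 - σμ_k ≥ 0, the rest is the value of B on the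
  -- vector with coefficients c_k √(1 - σμ_k), because only pairs with equal eigenvalues contribute.
  have hge : σ * a z z ≤ B z z := by
    have hs : ∀ k, 0 ≤ 1 - σ * μ k := fun k => by
      have := mul_le_mul_of_nonneg_left (hμ k) hσ0.le
      rw [mul_one_div_cancel hσ0.ne'] at this
      linarith
    have hpsd := hB.nonneg (∑ k, (c k * Real.sqrt (1 - σ * μ k)) • v k)
    have e1 : B z z - σ * a z z = ∑ k, ∑ l, c k * (c l * ((1 - σ * μ k) * B (v k) (v l))) := by
      have hwz : B w z = σ * a w z := hwall z
      have hvz : ∀ k, B (v k) z = ∑ l, c l * B (v k) (v l) := fun k => by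
        rw [hz, map_add, map_sum, map_smul, hwv]
        simp
      have hexp : ∀ (b : LinearMap.BilinForm ℝ V) x, b z x = ∑ k, c k * b (v k) x + t * b w x :=
        fun b x => by rw [hz]; simp
      have hz1 : B z z = ∑ k, c k * B (v k) z + t * B w z := by
        rw [← hexp B z]
      have hz2 : a z z = ∑ k, c k * a (v k) z + t * a w z := by
        rw [← hexp a z]
      rw [hz1, hz2, hwz, mul_add, Finset.mul_sum]
      have : ∀ k, c k * B (v k) z - σ * (c k * a (v k) z) =
          ∑ l, c k * (c l * ((1 - σ * μ k) * B (v k) (v l))) := fun k => by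
        rw [heig, hvz, ← Finset.mul_sum]
        have : ∑ l, c l * ((1 - σ * μ k) * B (v k) (v l)) =
            (1 - σ * μ k) * ∑ l, c l * B (v k) (v l) := by
          rw [Finset.mul_sum]; exact Finset.sum_congr rfl fun l _ => by ring
        rw [this]; ring
      rw [← Finset.sum_congr rfl fun k _ => this k, Finset.sum_sub_distrib]
      ring
    have e2 : B (∑ k, (c k * Real.sqrt (1 - σ * μ k)) • v k)
        (∑ k, (c k * Real.sqrt (1 - σ * μ k)) • v k) =
        ∑ k, ∑ l, c k * (c l * ((1 - σ * μ k) * B (v k) (v l))) := by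
      simp only [map_sum, LinearMap.sum_apply, map_smul, LinearMap.smul_apply, smul_eq_mul,
        Finset.mul_sum]
      rw [Finset.sum_comm]
      refine Finset.sum_congr rfl fun k _ => Finset.sum_congr rfl fun l _ => ?_
      rcases mul_eq_zero.1 (hBμ k l) with h1 | h1
      · have h2 : μ l = μ k := by linarith
        rw [h2]
        have h3 : Real.sqrt (1 - σ * μ k) * Real.sqrt (1 - σ * μ k) = 1 - σ * μ k :=
          Real.mul_self_sqrt (hs k)
        linear_combination (c k * c l * B (v k) (v l)) * h3
      · rw [h1]; ring
    linarith [e2 ▸ hpsd]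
  -- Here σ a(z,z) ≤ B(z,z) ≤ D a(z,z) with σ > D.
  have haz : a z z = 0 := by
    have h1 := hwidth z hct
    have h2 := h.left.nonneg z
    by_contra hne0
    have h3 : 0 < a z z := lt_of_le_of_ne h2 (Ne.symm hne0)
    nlinarith
  have hNz := hnull z hct haz
  -- The null vector z is either a nontrivial relation among the v_k, or expresses w through them.
  by_cases ht : t = 0
  · refine hne ?_
    rw [hz, ht, zero_smul, add_zero] at hNz
    rw [hlin c hNz, ht]; rfl
  · refine hnotspan (fun k => -(t⁻¹ * c k)) ?_
    have : w - ∑ k, (-(t⁻¹ * c k)) • v k = t⁻¹ • z := by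
      rw [hz, smul_add, smul_smul, inv_mul_cancel₀ ht, one_smul, Finset.smul_sum]
      simp only [neg_smul, Finset.sum_neg_distrib, sub_neg_eq_add, mul_smul]
      rw [add_comm]
    rw [this]
    simp [hNz]

/-- Boundedness of `B` by `a` on an orthogonal complement. -/
theorem IsCompactPair.exists_le_mul (h : IsCompactPair a N) (hB : IsPSD B) {C : ℝ} (hC : 0 < C)
    (hBN : ∀ x, B x x ≤ C * N x x) (t : V)
    (hker : ∀ x, B t x = 0 → a x x = 0 → N x x = 0) :
    ∃ D : ℝ, 0 < D ∧ ∀ x, B t x = 0 → B x x ≤ D * a x x := by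
  obtain ⟨P, hP, hx⟩ := h.exists_poincare (X := LinearMap.ker (B t))
    (fun z hz => h.right.eq_zero_of_forall_exists hB hC hBN hz) hker
  refine ⟨C * P, by positivity, fun x hxt => (hBN x).trans ?_⟩
  rw [mul_assoc]
  exact mul_le_mul_of_nonneg_left (hx x hxt) hC.le

/-- If the kernel of `a` is spanned by one vector, then this vector is, up to null vectors, a
combination of the first eigenvectors. -/
theorem IsCompactPair.exists_kernel_combination (h : IsCompactPair a N) (hB : IsPSD B) {n : ℕ}
    (hn : 1 ≤ n) {v : Fin n → V} {μ : Fin n → ℝ} (heig : ∀ k φ, a (v k) φ = μ k * B (v k) φ)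
    (hv : ∀ k, N (v k) (v k) ≠ 0)
    (hfirst : ∀ w ν, N w w ≠ 0 → (∀ φ, a w φ = ν * B w φ) →
      (∀ c : Fin n → ℝ, N (w - ∑ k, c k • v k) (w - ∑ k, c k • v k) ≠ 0) → ∀ k, μ k ≤ ν)
    {e : V} (he : N e e ≠ 0) (hae : a e e = 0)
    (hker : ∀ x, a x x = 0 → ∃ t : ℝ, N (x - t • e) (x - t • e) = 0) :
    ∃ c : Fin n → ℝ, N (e - ∑ k, c k • v k) (e - ∑ k, c k • v k) = 0 := by
  by_contra! hcon
  set k₀ : Fin n := ⟨0, hn⟩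
  -- A kernel vector outside the span would be a further eigenvector with eigenvalue 0, so all
  -- listed eigenvalues would be at most 0. Then the first listed eigenvector has zero energy, hence
  -- is a nonzero multiple of e up to null vectors, a contradiction. This uses n ≥ 1.
  have hμ := hfirst e 0 he (fun φ => by rw [h.left.eq_zero_of_self hae, zero_mul]) hcon k₀
  have ha : a (v k₀) (v k₀) = 0 := by
    refine le_antisymm ?_ (h.left.nonneg _)
    rw [heig]
    exact mul_nonpos_of_nonpos_of_nonneg hμ (hB.nonneg _)
  obtain ⟨t, ht⟩ := hker _ ha
  have ht0 : t ≠ 0 := by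
    rintro rfl
    exact hv k₀ (by simpa using ht)
  refine hcon (Pi.single k₀ t⁻¹) ?_
  have : ∑ k, (Pi.single k₀ t⁻¹ : Fin n → ℝ) k • v k = t⁻¹ • v k₀ := by
    rw [Finset.sum_eq_single k₀ (fun k _ hk => by simp [hk]) (by simp)]; simp
  have e2 : e - t⁻¹ • v k₀ = (-t⁻¹) • (v k₀ - t • e) := by
    rw [smul_sub, smul_smul, neg_mul, inv_mul_cancel₀ ht0]
    simp [sub_eq_add_neg, add_comm]
  rw [this, e2]
  rw [map_smul, map_smul, LinearMap.smul_apply, ht, smul_zero, smul_zero]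

/-- Null vectors do not contribute. -/
theorem IsPSD.eq_of_null (hB : IsPSD B) {C : ℝ} (hBN : ∀ x, B x x ≤ C * N x x) {x y : V}
    (hxy : N (x - y) (x - y) = 0) (z : V) : B x z = B y z := by
  have h1 := hBN (x - y)
  rw [hxy, mul_zero] at h1
  have h2 := hB.eq_zero_of_self (le_antisymm h1 (hB.nonneg _)) z
  rw [map_sub, LinearMap.sub_apply] at h2
  linarith

end Abstract

end

section

variable {d : ℕ}

/-! ### The space of harmonic functions on a ring -/

variable {R Rs Γ : Set (E d)} {A : E d → Matrix (Fin d) (Fin d) ℝ} {αmin αmax C : ℝ}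
  {c v w : E d → ℝ} {k G H : E d → E d}

theorem exists_eLpNorm_limit {α F : Type*} [MeasurableSpace α] {μ : Measure α}
    [NormedAddCommGroup F] [CompleteSpace F] {f : ℕ → α → F} (hf : ∀ n, MemLp (f n) 2 μ)
    (hc : ∀ ε : ℝ, 0 < ε → ∃ K, ∀ m ≥ K, ∀ l ≥ K, (eLpNorm (f m - f l) 2 μ).toReal < ε) :
    ∃ g, MemLp g 2 μ ∧
      ∀ ε : ℝ, 0 < ε → ∃ K, ∀ m ≥ K, (eLpNorm (f m - g) 2 μ).toReal < ε := by
  have hd : ∀ (g : Lp F 2 μ) n, dist ((hf n).toLp) g = (eLpNorm (f n - (g : α → F)) 2 μ).toReal := by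
    intro g n
    rw [Lp.dist_def]
    congr 1
    refine eLpNorm_congr_ae ?_
    filter_upwards [(hf n).coeFn_toLp] with x hx
    simp [hx]
  have hcs : CauchySeq fun n => (hf n).toLp := by
    refine Metric.cauchySeq_iff.2 fun ε hε => ?_
    obtain ⟨K, hK⟩ := hc ε hε
    refine ⟨K, fun m hm l hl => ?_⟩
    rw [hd, eLpNorm_congr_ae (g := f m - f l)]
    · exact hK m hm l hl
    · filter_upwards [(hf l).coeFn_toLp] with x hx
      simp [hx]
  obtain ⟨g, hg⟩ := cauchySeq_tendsto_of_complete hcs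
  refine ⟨g, Lp.memLp g, fun ε hε => ?_⟩
  obtain ⟨K, hK⟩ := Metric.tendsto_atTop.1 hg ε hε
  exact ⟨K, fun m hm => by rw [← hd]; exact hK m hm⟩

theorem eLpNorm_le_ofReal_of_toReal_lt {α F : Type*} [MeasurableSpace α] {μ : Measure α}
    [NormedAddCommGroup F] {f : α → F} (hf : MemLp f 2 μ) {ε : ℝ}
    (h : (eLpNorm f 2 μ).toReal < ε) : eLpNorm f 2 μ ≤ ENNReal.ofReal ε :=
  (ENNReal.le_ofReal_iff_toReal_le hf.eLpNorm_ne_top (ENNReal.toReal_nonneg.trans h.le)).2 h.le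

/-- A ring `R ⊆ R^*` with a cut-off function that vanishes outside of `R`, and the part `Γ` of the
boundary of `R^*` that carries a Dirichlet condition. -/
structure IsRing (A : E d → Matrix (Fin d) (Fin d) ℝ) (αmin αmax : ℝ) (Rs R Γ : Set (E d))
    (c : E d → ℝ) (k : E d → E d) (C : ℝ) : Prop where
  elliptic : IsElliptic Rs A αmin αmax
  lipschitz : IsLipschitzOpen Rs
  isOpen : IsOpen R
  subset : R ⊆ Rs
  cutoff : HasBddWG Rs c k C
  eq_zero : ∀ x ∈ Rs, x ∉ R → c x = 0
  tendsto : ∀ p ∈ closure Rs, p ∉ R → p ∉ Γ → Filter.Tendsto c (nhdsWithin p Rs) (nhds 0)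

/-- The gradient of `c v`. -/
def cutGrad (c : E d → ℝ) (k : E d → E d) (p : (E d → ℝ) × (E d → E d)) : E d → E d :=
  fun x => c x • p.2 x + p.1 x • k x

theorem cutGrad_add (p q : (E d → ℝ) × (E d → E d)) :
    cutGrad c k (p + q) = cutGrad c k p + cutGrad c k q := by
  ext1 x
  simp only [cutGrad, Prod.fst_add, Prod.snd_add, Pi.add_apply, smul_add, add_smul]
  abel

theorem cutGrad_smul (r : ℝ) (p : (E d → ℝ) × (E d → E d)) :
    cutGrad c k (r • p) = r • cutGrad c k p := by
  ext1 x
  simp only [cutGrad, Prod.smul_fst, Prod.smul_snd, Pi.smul_apply, smul_add, smul_smul,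
    smul_eq_mul, mul_comm r]

namespace IsRing

variable (h : IsRing A αmin αmax Rs R Γ c k C)

/-- Pairs of an operator-harmonic function with zero trace on `Γ` and its gradient. -/
def space : Submodule ℝ ((E d → ℝ) × (E d → E d)) where
  carrier := {p | HasVan Rs Γ p.1 p.2 ∧ ∀ φ H, HasH10 Rs φ H → aint A Rs p.2 H = 0}
  add_mem' := fun {p q} hp hq => ⟨hp.1.add hq.1, fun φ H hφ => by
    rw [Prod.snd_add, h.elliptic.aint_add_left hp.1.memLp_grad hq.1.memLp_grad hφ.memLp_grad,
      hp.2 φ H hφ, hq.2 φ H hφ, add_zero]⟩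
  zero_mem' := ⟨HasVan.zero, fun φ H _ => aint_zero_left⟩
  smul_mem' := fun r p hp => ⟨hp.1.smul r, fun φ H hφ => by
    rw [Prod.smul_snd, aint_smul_left, hp.2 φ H hφ, mul_zero]⟩

theorem hasVan (p : h.space) : HasVan Rs Γ p.1.1 p.1.2 := p.2.1

theorem memLp (p : h.space) : MemLp p.1.1 2 (volume.restrict Rs) := (h.hasVan p).memLp

theorem memLp_grad (p : h.space) : MemLp p.1.2 2 (volume.restrict Rs) := (h.hasVan p).memLp_grad

theorem hasWG_cut (p : h.space) : HasWG Rs (c * p.1.1) (cutGrad c k p.1) :=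
  h.cutoff.mul h.lipschitz.isOpen (h.hasVan p).toHasWG

theorem hasH10_cut (p : h.space) : HasH10 R (c * p.1.1) (cutGrad c k p.1) :=
  (h.hasVan p).mul_hasH10 h.lipschitz.isOpen h.lipschitz.isBounded h.isOpen h.subset h.cutoff
    h.tendsto

/-- The energy form on `R^*`. -/
def aForm : LinearMap.BilinForm ℝ h.space :=
  LinearMap.mk₂ ℝ (fun p q => aint A Rs p.1.2 q.1.2)
    (fun p q r => h.elliptic.aint_add_left (h.memLp_grad p) (h.memLp_grad q) (h.memLp_grad r))
    (fun _ _ _ => aint_smul_left _)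
    (fun p q r => h.elliptic.aint_add_right (h.memLp_grad p) (h.memLp_grad q) (h.memLp_grad r))
    (fun _ _ _ => aint_smul_right _)

/-- The `L²` form on `R^*`. -/
def nForm : LinearMap.BilinForm ℝ h.space :=
  LinearMap.mk₂ ℝ (fun p q => ∫ x in Rs, p.1.1 x * q.1.1 x)
    (fun p q r => by
      refine Eq.trans ?_ (integral_add ((h.memLp p).integrable_mul (h.memLp r))
        ((h.memLp q).integrable_mul (h.memLp r)))
      exact integral_congr_ae (ae_of_all _ fun x => add_mul (p.1.1 x) (q.1.1 x) (r.1.1 x)))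
    (fun s p q => by
      rw [smul_eq_mul, ← integral_const_mul]
      exact integral_congr_ae (ae_of_all _ fun x => mul_assoc s (p.1.1 x) (q.1.1 x)))
    (fun p q r => by
      refine Eq.trans ?_ (integral_add ((h.memLp p).integrable_mul (h.memLp q))
        ((h.memLp p).integrable_mul (h.memLp r)))
      exact integral_congr_ae (ae_of_all _ fun x => mul_add (p.1.1 x) (q.1.1 x) (r.1.1 x)))
    (fun s p q => by
      rw [smul_eq_mul, ← integral_const_mul]
      exact integral_congr_ae (ae_of_all _ fun x => mul_left_comm (p.1.1 x) s (q.1.1 x)))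

/-- The energy form on `R` of the products with the cut-off function. -/
def bForm : LinearMap.BilinForm ℝ h.space :=
  have hA := h.elliptic.mono h.subset
  LinearMap.mk₂ ℝ (fun p q => aint A R (cutGrad c k p.1) (cutGrad c k q.1))
    (fun p q r => by
      rw [Submodule.coe_add, cutGrad_add]
      exact hA.aint_add_left (h.hasH10_cut p).memLp_grad (h.hasH10_cut q).memLp_grad
        (h.hasH10_cut r).memLp_grad)
    (fun s p q => by rw [Submodule.coe_smul, cutGrad_smul]; exact aint_smul_left s)
    (fun p q r => by
      rw [Submodule.coe_add, cutGrad_add]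
      exact hA.aint_add_right (h.hasH10_cut p).memLp_grad (h.hasH10_cut q).memLp_grad
        (h.hasH10_cut r).memLp_grad)
    (fun s p q => by rw [Submodule.coe_smul, cutGrad_smul]; exact aint_smul_right s)

theorem aForm_apply (p q : h.space) : h.aForm p q = aint A Rs p.1.2 q.1.2 := rfl

theorem bForm_apply (p q : h.space) :
    h.bForm p q = aint A R (cutGrad c k p.1) (cutGrad c k q.1) := rfl

theorem nForm_self (p : h.space) :
    h.nForm p p = (eLpNorm p.1.1 2 (volume.restrict Rs)).toReal ^ 2 := by
  rw [← integral_norm_sq_eq (h.memLp p).1]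
  refine integral_congr_ae (ae_of_all _ fun x => ?_)
  simp [sq]

theorem isPSD_aForm : IsPSD h.aForm :=
  ⟨fun _ _ => h.elliptic.aint_comm _ _, fun _ => h.elliptic.aint_self_nonneg _⟩

theorem isPSD_bForm : IsPSD h.bForm :=
  ⟨fun _ _ => (h.elliptic.mono h.subset).aint_comm _ _,
    fun _ => (h.elliptic.mono h.subset).aint_self_nonneg _⟩

theorem isPSD_nForm : IsPSD h.nForm :=
  ⟨fun p q => integral_congr_ae (ae_of_all _ fun x => mul_comm (p.1.1 x) (q.1.1 x)),
    fun p => by rw [h.nForm_self]; positivity⟩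

theorem nForm_eq_zero_iff (p : h.space) :
    h.nForm p p = 0 ↔ p.1.1 =ᵐ[volume.restrict Rs] 0 := by
  rw [h.nForm_self, pow_eq_zero_iff two_ne_zero, ENNReal.toReal_eq_zero_iff,
    or_iff_left (h.memLp p).eLpNorm_ne_top, eLpNorm_eq_zero_iff (h.memLp p).1 two_ne_zero]

theorem aForm_eq_zero_iff (p : h.space) :
    h.aForm p p = 0 ↔ p.1.2 =ᵐ[volume.restrict Rs] 0 := by
  refine ⟨fun h0 => h.elliptic.eq_zero_of_aint_eq_zero (h.memLp_grad p) h0, fun h0 => ?_⟩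
  rw [h.aForm_apply, aint_congr h0 h0, aint_zero_left]

/-- Ellipticity turns energy bounds into gradient bounds, so Rellich gives compactness. Completeness
holds because zero trace on Γ and operator-harmonicity survive L² limits of functions and gradients.
-/
theorem isCompactPair : IsCompactPair h.aForm h.nForm where
  left := h.isPSD_aForm
  right := h.isPSD_nForm
  compact := by
    intro x M hM
    have hα := h.elliptic.pos
    have hN : ∀ m, (eLpNorm (x m).1.1 2 (volume.restrict Rs)).toReal ^ 2 ≤ M := fun m => by
      have := hM m
      rw [← h.nForm_self]
      linarith [h.isPSD_aForm.nonneg (x m)]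
    have hG : ∀ m, (eLpNorm (x m).1.2 2 (volume.restrict Rs)).toReal ^ 2 ≤ M / αmin := fun m => by
      have h1 := hM m
      have h2 := h.elliptic.le_aint (h.memLp_grad (x m))
      rw [← h.aForm_apply] at h2
      rw [le_div_iff₀ hα]
      linarith [h.isPSD_nForm.nonneg (x m)]
    obtain ⟨ψ, hψ, hc⟩ := h.lipschitz.exists_subseq (fun m => (h.hasVan (x m)).toHasWG)
      (M := ENNReal.ofReal (max (Real.sqrt M) (Real.sqrt (M / αmin)))) ENNReal.ofReal_ne_top
      (fun m => (ENNReal.le_ofReal_iff_toReal_le (h.memLp _).eLpNorm_ne_top (by positivity)).2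
        ((Real.le_sqrt_of_sq_le (hN m)).trans (le_max_left _ _)))
      (fun m => (ENNReal.le_ofReal_iff_toReal_le (h.memLp_grad _).eLpNorm_ne_top
        (by positivity)).2 ((Real.le_sqrt_of_sq_le (hG m)).trans (le_max_right _ _)))
    refine ⟨ψ, hψ, fun ε hε => ?_⟩
    obtain ⟨K, hK⟩ := hc (ENNReal.ofReal (Real.sqrt ε)) (by simpa using hε)
    refine ⟨K, fun m hm l hl => ?_⟩
    have h1 := ENNReal.toReal_le_of_le_ofReal (Real.sqrt_nonneg _) (hK m hm l hl)
    rw [h.nForm_self]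
    have := pow_le_pow_left₀ ENNReal.toReal_nonneg h1 2
    rwa [Real.sq_sqrt hε.le] at this
  complete := by
    intro x hx
    have hα := h.elliptic.pos
    have hsq : ∀ {t ε : ℝ}, 0 < ε → t ^ 2 ≤ ε ^ 2 / 4 → t < ε := fun {t ε} hε h2 => by
      exact (abs_lt.1 (abs_lt_of_sq_lt_sq (by nlinarith [sq_pos_of_pos hε]) hε.le)).2
    obtain ⟨v, hv, hvl⟩ := exists_eLpNorm_limit (f := fun m => (x m).1.1) (fun m => h.memLp _)
      fun ε hε => by
        obtain ⟨K, hK⟩ := hx (ε ^ 2 / 4) (by positivity)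
        refine ⟨K, fun m hm l hl => hsq hε ?_⟩
        have h1 := hK m hm l hl
        have h2 := h.nForm_self (x m - x l)
        simp only [Submodule.coe_sub, Prod.fst_sub] at h2
        rw [← h2]
        linarith [h.isPSD_aForm.nonneg (x m - x l)]
    obtain ⟨G, hG, hGl⟩ := exists_eLpNorm_limit (f := fun m => (x m).1.2)
      (fun m => h.memLp_grad _) fun ε hε => by
        obtain ⟨K, hK⟩ := hx (αmin * (ε ^ 2 / 4)) (by positivity)
        refine ⟨K, fun m hm l hl => hsq hε ?_⟩
        have h1 := hK m hm l hl
        have h2 := h.elliptic.le_aint (h.memLp_grad (x m - x l))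
        rw [← h.aForm_apply] at h2
        simp only [Submodule.coe_sub, Prod.snd_sub] at h2
        have h3 := h.isPSD_nForm.nonneg (x m - x l)
        exact le_of_mul_le_mul_left (h2.trans (by linarith)) hα
    have hz : ((v, G) : (E d → ℝ) × (E d → E d)) ∈ h.space := by
      refine ⟨HasVan.of_tendsto hv hG fun ε hε => ?_, fun φ H hφ => ?_⟩
      · obtain ⟨δ, hδ, hδε⟩ := exists_pos_ofReal_le hε
        obtain ⟨K₁, hK₁⟩ := hvl δ hδ
        obtain ⟨K₂, hK₂⟩ := hGl δ hδ
        refine ⟨_, _, h.hasVan (x (max K₁ K₂)), ?_, ?_⟩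
        · rw [eLpNorm_sub_comm]
          exact (eLpNorm_le_ofReal_of_toReal_lt ((h.memLp _).sub hv)
            (hK₁ _ (le_max_left _ _))).trans hδε
        · rw [eLpNorm_sub_comm]
          exact (eLpNorm_le_ofReal_of_toReal_lt ((h.memLp_grad _).sub hG)
            (hK₂ _ (le_max_right _ _))).trans hδε
      · refine pow_eq_zero_iff two_ne_zero |>.1
          (le_antisymm (le_of_forall_pos_le_add fun ε hε => ?_) (sq_nonneg _))
        rw [zero_add]
        have hH := h.elliptic.aint_self_nonneg H
        have hαM : 0 < αmax := hα.trans_le h.elliptic.le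
        -- Chosen so that Cauchy–Schwarz bounds the square of the limiting form value by ε; the +1
        -- avoids division by zero.
        set s := ε / (αmax * (aint A Rs H H + 1)) with hs
        have hs0 : 0 < s := by positivity
        obtain ⟨K, hK⟩ := hGl (Real.sqrt s) (Real.sqrt_pos.2 hs0)
        have h1 := hK K le_rfl
        have hd := ((h.memLp_grad (x K)).sub hG)
        have h2 := h.elliptic.aint_le hd
        have h3 := h.elliptic.aint_sq_le hd hφ.memLp_grad
        rw [h.elliptic.aint_sub_left (h.memLp_grad (x K)) hG hφ.memLp_grad,
          (x K).2.2 φ H hφ, zero_sub, neg_sq] at h3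
        have h4 := pow_le_pow_left₀ ENNReal.toReal_nonneg h1.le 2
        rw [Real.sq_sqrt hs0.le] at h4
        calc _ ≤ _ := h3
          _ ≤ (αmax * s) * (aint A Rs H H + 1) := by
            refine mul_le_mul (h2.trans ?_) (by linarith) hH (by positivity)
            exact mul_le_mul_of_nonneg_left h4 hαM.le
          _ = ε := by rw [hs]; field_simp
    refine ⟨⟨_, hz⟩, fun ε hε => ?_⟩
    have hαM : 0 < αmax := hα.trans_le h.elliptic.le
    obtain ⟨K₁, hK₁⟩ := hvl (Real.sqrt (ε / 2)) (Real.sqrt_pos.2 (by positivity))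
    obtain ⟨K₂, hK₂⟩ := hGl (Real.sqrt (ε / (2 * αmax))) (Real.sqrt_pos.2 (by positivity))
    refine ⟨max K₁ K₂, fun m hm => ?_⟩
    have a1 := pow_le_pow_left₀ ENNReal.toReal_nonneg (hK₁ m ((le_max_left _ _).trans hm)).le 2
    have a2 := pow_le_pow_left₀ ENNReal.toReal_nonneg (hK₂ m ((le_max_right _ _).trans hm)).le 2
    rw [Real.sq_sqrt (by positivity)] at a1 a2
    have b1 := h.nForm_self (x m - ⟨_, hz⟩)
    have b2 := h.elliptic.aint_le (h.memLp_grad (x m - ⟨_, hz⟩))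
    rw [← h.aForm_apply] at b2
    simp only [Submodule.coe_sub, Prod.fst_sub, Prod.snd_sub] at b1 b2
    rw [b1]
    have b3 := mul_le_mul_of_nonneg_left a2 hαM.le
    have e : αmax * (ε / (2 * αmax)) = ε / 2 := by field_simp
    linarith

theorem integrable_sq_density (p : h.space) :
    Integrable (fun x => p.1.1 x ^ 2 * density A k k x) (volume.restrict Rs) := by
  have h1 := MemLp.smul_of_bound_right (h.memLp p) h.cutoff.bound_grad h.cutoff.memLp_grad.1
  refine (h.elliptic.integrable_density h1 h1).congr (ae_of_all _ fun x => ?_)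
  simp only [density, WithLp.ofLp_smul, Matrix.mulVec_smul, smul_dotProduct, dotProduct_smul,
    smul_eq_mul]
  ring

/-- Caccioppoli's inequality. -/
theorem bForm_self_le_integral (p : h.space) :
    h.bForm p p ≤ ∫ x in Rs, p.1.1 x ^ 2 * density A k k x := by
  set v := p.1.1 with hv
  set G := p.1.2 with hG
  have hA := h.elliptic
  -- The test function is c²v, which lies in H¹₀(R*): c² tends to 0 at boundary points outside Γ,
  -- and v has zero trace on Γ.
  have ht : ∀ q ∈ closure Rs, q ∉ Rs → q ∉ Γ →
      Filter.Tendsto (c * c) (nhdsWithin q Rs) (nhds 0) := fun q hq hqR hqΓ => by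
    have := h.tendsto q hq (fun hR => hqR (h.subset hR)) hqΓ
    simpa [Pi.mul_def] using this.mul this
  have h1 := (h.hasVan p).mul_hasH10 h.lipschitz.isOpen h.lipschitz.isBounded h.lipschitz.isOpen
    subset_rfl (h.cutoff.mul_self h.lipschitz.isOpen) ht
  have h2 := p.2.2 _ _ h1
  have hcut := (h.hasWG_cut p).memLp_grad
  refine (hA.aint_mono h.subset hcut).trans ?_
  -- By symmetry of A, A∇(cv)·∇(cv) = A∇v·∇(c²v) + v² A∇c·∇c, and the first term integrates to zero.
  have h3 : ∀ᵐ x ∂volume.restrict Rs, density A (cutGrad c k p.1) (cutGrad c k p.1) x =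
      density A G (fun x => (c * c) x • G x + v x • (c x • k x + c x • k x)) x +
        v x ^ 2 * density A k k x := by
    filter_upwards [hA.density_comm k G] with x hx
    simp only [density, cutGrad, ← hv, ← hG] at hx ⊢
    simp only [WithLp.ofLp_add, WithLp.ofLp_smul, Matrix.mulVec_add, Matrix.mulVec_smul, add_dotProduct,
      dotProduct_add, smul_dotProduct, dotProduct_smul, smul_eq_mul, Pi.mul_apply, hx]
    ring
  rw [aint, integral_congr_ae h3]
  rw [integral_add (hA.integrable_density (h.memLp_grad p) h1.memLp_grad)
    (h.integrable_sq_density p)]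
  have : ∫ x in Rs, density A G (fun x => (c * c) x • G x + v x • (c x • k x + c x • k x)) x = 0 :=
    h2
  rw [this, zero_add]

/-- The integrand of Caccioppoli's bound is at most αmax C² v². The added 1 only makes the constant
positive. -/
theorem bForm_self_le (p : h.space) : h.bForm p p ≤ (αmax * C ^ 2 + 1) * h.nForm p p := by
  have hA := h.elliptic
  refine (h.bForm_self_le_integral p).trans ?_
  rw [h.nForm_self, ← integral_norm_sq_eq (h.memLp p).1, ← integral_const_mul]
  refine integral_mono_ae (h.integrable_sq_density p)
    (((h.memLp p).integrable_norm_pow two_ne_zero).const_mul _) ?_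
  filter_upwards [hA.density_le k, h.cutoff.bound_grad] with x hx hx'
  have h1 : ‖k x‖ ^ 2 ≤ C ^ 2 := pow_le_pow_left₀ (norm_nonneg _) hx' 2
  have h2 := mul_le_mul_of_nonneg_left h1 (hA.pos.le.trans hA.le)
  rw [Real.norm_eq_abs, sq_abs, mul_comm]
  exact mul_le_mul_of_nonneg_right (by linarith) (sq_nonneg _)

end IsRing

end

section

variable {d : ℕ}

/-! ### Geometry of a patch -/

variable {Ω : Set (E d)} {A : E d → Matrix (Fin d) (Fin d) ℝ} {αmin αmax C : ℝ}
  {P : Patch d} {c v w : E d → ℝ} {k G H : E d → E d}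

/-- The part of the boundary of `R^*` with a Dirichlet condition. -/
def Patch.Γ (Ω : Set (E d)) (P : Patch d) : Set (E d) := frontier P.Rs ∩ frontier Ω

namespace Patch.Admissible

variable (hP : P.Admissible Ω)
include hP

theorem isOpen_Wt : IsOpen P.Wt := hP.Wt_lipschitz.isOpen

theorem isOpen_Rs : IsOpen P.Rs := hP.Rs_lipschitz.isOpen

theorem Wt_subset_W : P.Wt ⊆ P.W := hP.Wt_union_R ▸ subset_union_left

theorem R_subset_W : P.R ⊆ P.W := hP.Wt_union_R ▸ subset_union_right

theorem Wt_subset_Ws : P.Wt ⊆ P.Ws := hP.Wt_subset_W.trans hP.W_subset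

theorem Rs_subset_Ω : P.Rs ⊆ Ω := hP.Rs_subset.trans hP.Ws_subset

theorem χR_eq_zero {x : E d} (hx : x ∈ P.Ws) (hxR : x ∉ P.R) : P.χR x = 0 := by
  by_cases hW : x ∈ P.W
  · have h1 : x ∈ P.Wt := by
      rw [← hP.Wt_union_R] at hW
      exact hW.resolve_right hxR
    simp [Patch.χR, hP.χ_inner x h1, hP.η_one x hW hxR]
  · simp [Patch.χR, hP.χ_support x (hP.Ws_subset hx) hW,
      hP.η_zero x hx fun h => hW (hP.Wt_subset_W h)]

theorem continuousAt_χ (hΩ : IsOpen Ω) {x : E d} (hx : x ∈ Ω) : ContinuousAt P.χ x :=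
  hP.χ_mem.1.continuousAt (hΩ.mem_nhds hx)

theorem continuousAt_η {x : E d} (hx : x ∈ P.Ws) : ContinuousAt P.η x :=
  hP.η_mem.1.continuousAt (hP.isOpen_Ws.mem_nhds hx)

/-- Inside ω continuity and the vanishing of χ^R off R suffice. At a point of Ω outside ω, χ tends
to 0 by continuity; such a point outside R is not on ∂ω̃ ∩ Ω ⊆ R, so η vanishes nearby. Continuity
of η up to ∂ω* is never required. -/
theorem tendsto_χR (hΩ : IsOpen Ω) {p : E d} (hp : p ∈ Ω) (hpR : p ∉ P.R) :
    Filter.Tendsto P.χR (nhdsWithin p P.Ws) (nhds 0) := by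
  by_cases hW : p ∈ P.W
  · have h1 : ContinuousAt P.χR p :=
      (hP.continuousAt_χ hΩ hp).sub (hP.continuousAt_η (hP.W_subset hW))
    rw [← hP.χR_eq_zero (hP.W_subset hW) hpR]
    exact h1.tendsto.mono_left nhdsWithin_le_nhds
  · have h1 : Filter.Tendsto P.χ (nhdsWithin p P.Ws) (nhds 0) := by
      rw [← hP.χ_support p hp hW]
      exact (hP.continuousAt_χ hΩ hp).tendsto.mono_left nhdsWithin_le_nhds
    have h2 : p ∉ closure P.Wt := fun h => by
      have h3 : p ∈ frontier P.Wt :=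
        ⟨h, by rw [hP.isOpen_Wt.interior_eq]; exact fun h => hW (hP.Wt_subset_W h)⟩
      exact hpR (hP.frontier_Wt ⟨h3, hp⟩)
    have h3 : Filter.Tendsto P.η (nhdsWithin p P.Ws) (nhds 0) := by
      refine tendsto_const_nhds.congr' ?_
      have : ∀ᶠ x in nhdsWithin p P.Ws, x ∈ (closure P.Wt)ᶜ :=
        nhdsWithin_le_nhds (isClosed_closure.isOpen_compl.mem_nhds h2)
      filter_upwards [this, self_mem_nhdsWithin] with x hx hxs
      exact (hP.η_zero x hxs fun h => hx (subset_closure h)).symm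
    simpa [Patch.χR, Pi.sub_def] using h1.sub h3

theorem mem_of_mem_closure_Rs {p : E d} (hp : p ∈ closure P.Rs)
    (hpΓ : p ∉ P.Γ Ω) : p ∈ Ω := by
  by_contra hn
  refine hpΓ ⟨⟨hp, fun h => hn (hP.Rs_subset_Ω (interior_subset h))⟩,
    closure_mono hP.Rs_subset_Ω hp, fun h => hn (interior_subset h)⟩

/-- A point of ∂R* ∩ ∂Ω lies in the closure of ω* but outside Ω, hence in ∂ω* ∩ ∂Ω. -/
theorem Γ_eq_empty (hΩ : IsOpen Ω) (hb : ¬ P.IsBoundary Ω) : P.Γ Ω = ∅ := by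
  refine eq_empty_of_forall_notMem fun p hp => hb ⟨p, ⟨closure_mono hP.Rs_subset hp.1.1, ?_⟩, hp.2⟩
  rw [hP.isOpen_Ws.interior_eq]
  intro h
  exact hp.2.2 (by rw [hΩ.interior_eq]; exact hP.Ws_subset h)

/-- The gradients of the cut-off functions. -/
theorem exists_cutoffs (hΩf : volume Ω ≠ ⊤) :
    ∃ kχ kη Cχ Cη, HasBddWG Ω P.χ kχ Cχ ∧ HasBddWG P.Ws P.η kη Cη ∧
      HasBddWG P.Ws P.χR (kχ - kη) (Cχ + Cη) := by
  obtain ⟨kχ, Cχ, h1⟩ := hP.χ_mem.exists_hasBddWG hΩf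
  obtain ⟨kη, Cη, h2⟩ := hP.η_mem.exists_hasBddWG
    (ne_top_of_le_ne_top hΩf (measure_mono hP.Ws_subset))
  exact ⟨kχ, kη, Cχ, Cη, h1, h2, (h1.mono hP.Ws_subset).sub h2⟩

theorem isRing (hΩ : IsOpen Ω) (hA : IsElliptic Ω A αmin αmax) (hk : HasBddWG P.Ws P.χR k C) :
    IsRing A αmin αmax P.Rs P.R (P.Γ Ω) P.χR k C where
  elliptic := hA.mono hP.Rs_subset_Ω
  lipschitz := hP.Rs_lipschitz
  isOpen := hP.isOpen_R
  subset := hP.R_subset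
  cutoff := hk.mono hP.Rs_subset
  eq_zero _ hx hxR := hP.χR_eq_zero (hP.Rs_subset hx) hxR
  tendsto _ hp hpR hpΓ := (hP.tendsto_χR hΩ (hP.mem_of_mem_closure_Rs hp hpΓ) hpR).mono_left
    (nhdsWithin_mono _ hP.Rs_subset)

/-- For interior patches Γ is empty and the trace condition is void, so one space serves both cases
and the ring theory needs no distinction. -/
theorem eigenSpace_eq (hΩ : IsOpen Ω) : P.eigenSpace Ω A = P.Hab Ω A := by
  unfold Patch.eigenSpace
  split_ifs with hb
  · rfl
  · ext v
    refine ⟨fun h => ⟨h, ?_⟩, fun h => h.1⟩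
    change VanishesOn P.Rs (P.Γ Ω) v
    rw [hP.Γ_eq_empty hΩ hb]
    exact h.1.hasWG.hasVan_empty.vanishesOn hP.isOpen_Rs

end Patch.Admissible

namespace IsRing

variable (h : IsRing A αmin αmax P.Rs P.R (P.Γ Ω) P.χR k C)
include h

theorem mem_Hab (p : h.space) : p.1.1 ∈ P.Hab Ω A :=
  ⟨⟨(h.hasVan p).memH1, fun φ hφ => by
    rw [form_eq_aint h.lipschitz.isOpen (h.hasVan p).toHasWG hφ.1.hasWG]
    exact p.2.2 _ _ (hφ.hasH10 h.lipschitz.isOpen hφ.1.hasWG)⟩,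
    (h.hasVan p).vanishesOn h.lipschitz.isOpen⟩

theorem mem_space (hv : v ∈ P.Hab Ω A) (hG : HasWG P.Rs v G) : (v, G) ∈ h.space :=
  ⟨hv.2.hasVan h.lipschitz.isOpen hG, fun φ H hφ => by
    rw [← form_eq_aint h.lipschitz.isOpen hG hφ.toHasWG]
    exact hv.1.2 φ (hφ.memH10 h.lipschitz.isOpen)⟩

theorem exists_eq (hv : v ∈ P.Hab Ω A) : ∃ p : h.space, p.1.1 = v :=
  ⟨⟨(v, weakGrad P.Rs v), h.mem_space hv hv.1.1.hasWG⟩, rfl⟩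

theorem form_Rs (p q : h.space) : form A P.Rs p.1.1 q.1.1 = h.aForm p q :=
  form_eq_aint h.lipschitz.isOpen (h.hasVan p).toHasWG (h.hasVan q).toHasWG

theorem form_R (p q : h.space) : form A P.R (P.χR * p.1.1) (P.χR * q.1.1) = h.bForm p q :=
  form_eq_aint h.isOpen (h.hasH10_cut p).toHasWG (h.hasH10_cut q).toHasWG

theorem energyNorm_Rs (p : h.space) : energyNorm A P.Rs p.1.1 = Real.sqrt (h.aForm p p) := by
  rw [energyNorm, h.form_Rs]

theorem isEigenpair_iff (hP : P.Admissible Ω) (hΩ : IsOpen Ω) (p : h.space) (μ : ℝ) :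
    P.IsEigenpair Ω A p.1.1 μ ↔
      h.nForm p p ≠ 0 ∧ ∀ q, h.aForm p q = μ * h.bForm p q := by
  rw [Patch.IsEigenpair, hP.eigenSpace_eq hΩ, Ne, h.nForm_eq_zero_iff]
  constructor
  · rintro ⟨-, h1, h2⟩
    refine ⟨h1, fun q => ?_⟩
    rw [← h.form_Rs, ← h.form_R]
    exact h2 _ (h.mem_Hab q)
  · rintro ⟨h1, h2⟩
    refine ⟨h.mem_Hab p, h1, fun φ hφ => ?_⟩
    obtain ⟨q, rfl⟩ := h.exists_eq hφ
    rw [h.form_Rs, h.form_R]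
    exact h2 q

omit h in
theorem coe_sum_smul (h : IsRing A αmin αmax P.Rs P.R (P.Γ Ω) P.χR k C) {n : ℕ}
    (q : Fin n → h.space) (c : Fin n → ℝ) :
    (∑ j, c j • q j : h.space).1.1 = ∑ j, c j • (q j).1.1 := by
  simp [Prod.fst_sum]

/-- The abstract form of `IsFirstEigenpairs`. -/
theorem first_eigenpairs (hP : P.Admissible Ω) (hΩ : IsOpen Ω) {n : ℕ} {q : Fin n → h.space}
    {μ : Fin n → ℝ} (hf : P.IsFirstEigenpairs Ω A n (fun j => (q j).1.1) μ) :
    (∀ j p, h.aForm (q j) p = μ j * h.bForm (q j) p) ∧ (∀ j, h.nForm (q j) (q j) ≠ 0) ∧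
    (∀ c : Fin n → ℝ, h.nForm (∑ j, c j • q j) (∑ j, c j • q j) = 0 → c = 0) ∧
    (∀ w ν, h.nForm w w ≠ 0 → (∀ p, h.aForm w p = ν * h.bForm w p) →
      (∀ c : Fin n → ℝ, h.nForm (w - ∑ j, c j • q j) (w - ∑ j, c j • q j) ≠ 0) →
      ∀ j, μ j ≤ ν) := by
  refine ⟨fun j => ((h.isEigenpair_iff hP hΩ _ _).1 (hf.eigenpair j)).2,
    fun j => ((h.isEigenpair_iff hP hΩ _ _).1 (hf.eigenpair j)).1, fun c hc => ?_,
    fun w ν hw hν hc => ?_⟩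
  · rw [h.nForm_eq_zero_iff, h.coe_sum_smul] at hc
    exact hf.linearIndependent c hc
  · refine hf.first w.1.1 ν ((h.isEigenpair_iff hP hΩ _ _).2 ⟨hw, hν⟩) ?_
    rintro ⟨c, hwc⟩
    refine hc c ((h.nForm_eq_zero_iff _).2 ?_)
    have e : (w - ∑ j, c j • q j : h.space).1.1 = w.1.1 - ∑ j, c j • (q j).1.1 := by
      rw [Submodule.coe_sub, Prod.fst_sub, h.coe_sum_smul]
    rw [e]
    filter_upwards [hwc] with x hx
    simp [hx]

/-- Reading off a bound from the width. -/
theorem exists_of_nWidthOn_lt {S : Set (E d → ℝ)} {m : ℕ} {D : ℝ}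
    (hD : P.nWidthOn A S m < ENNReal.ofReal D) : ∃ q : Fin m → E d → ℝ, (∀ j, MemH10 P.R (q j)) ∧
      ∀ p : h.space, p.1.1 ∈ S →
        (∀ j, aint A P.R (cutGrad P.χR k p.1) (weakGrad P.R (q j)) = 0) →
        h.bForm p p ≤ D ^ 2 * h.aForm p p := by
  rw [Patch.nWidthOn] at hD
  simp only [iInf_lt_iff] at hD
  obtain ⟨q, hq, hlt⟩ := hD
  have hD0 : 0 < D := by
    rw [← ENNReal.ofReal_pos]; exact hlt.trans_le' bot_le
  refine ⟨q, hq, fun p hp hort => ?_⟩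
  have h1 := (le_iSup₂ (f := fun u (_ : u ∈ S) => ⨅ v ∈ Submodule.span ℝ (Set.range q),
    ENNReal.ofReal (energyNorm A P.R (P.χR * u - v)) / ENNReal.ofReal (energyNorm A P.Rs u))
    p.1.1 hp).trans_lt hlt
  have hA := h.elliptic.mono h.subset
  have hcut := (h.hasH10_cut p)
  have hspan : ∀ v ∈ Submodule.span ℝ (Set.range q), ∃ G, HasH10 P.R v G ∧
      aint A P.R (cutGrad P.χR k p.1) G = 0 := by
    intro v hv
    induction hv using Submodule.span_induction with
    | mem x hx =>
      obtain ⟨j, rfl⟩ := hx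
      exact ⟨_, (hq j).hasH10 h.isOpen (hq j).1.hasWG, hort j⟩
    | zero => exact ⟨0, HasH10.zero, aint_zero_right⟩
    | add x y _ _ hx hy =>
      obtain ⟨G, hG, hG0⟩ := hx
      obtain ⟨H, hH, hH0⟩ := hy
      refine ⟨_, hG.add hH, ?_⟩
      rw [hA.aint_add_right hcut.memLp_grad hG.memLp_grad hH.memLp_grad, hG0, hH0, add_zero]
    | smul r x _ hx =>
      obtain ⟨G, hG, hG0⟩ := hx
      exact ⟨_, hG.smul r, by rw [aint_smul_right, hG0, mul_zero]⟩
  have h2 : ENNReal.ofReal (Real.sqrt (h.bForm p p)) / ENNReal.ofReal (Real.sqrt (h.aForm p p)) <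
      ENNReal.ofReal D := by
    -- When χ^R p is orthogonal to the width space, subtracting any of its members can only increase
    -- the energy, so the infimum over the space is attained at 0.
    refine lt_of_le_of_lt (le_iInf₂ fun v hv => ?_) h1
    obtain ⟨G, hG, hG0⟩ := hspan v hv
    rw [h.energyNorm_Rs, energyNorm, form_eq_aint h.isOpen (hcut.toHasWG.sub hG.toHasWG)
      (hcut.toHasWG.sub hG.toHasWG), hA.aint_sub_self hcut.memLp_grad hG.memLp_grad, hG0,
      ← h.bForm_apply]
    gcongr
    linarith [hA.aint_self_nonneg G]
  -- A zero denominator is harmless: in the extended reals x/0 is infinite unless x = 0, so the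
  -- bound by D forces the numerator to vanish as well.
  have h3 := (ENNReal.div_le_iff_le_mul (Or.inr ENNReal.ofReal_ne_top)
    (Or.inl ENNReal.ofReal_ne_top)).1 h2.le
  rw [← ENNReal.ofReal_mul hD0.le, ENNReal.ofReal_le_ofReal_iff (by positivity)] at h3
  have h4 := pow_le_pow_left₀ (Real.sqrt_nonneg _) h3 2
  rwa [mul_pow, Real.sq_sqrt (h.isPSD_bForm.nonneg _), Real.sq_sqrt (h.isPSD_aForm.nonneg _)] at h4

/-- The zero approximation space already gives the bound √D, whatever dimension is allowed. -/
theorem nWidthOn_ne_top {S : Set (E d → ℝ)} {m : ℕ} {D : ℝ} (hS : S ⊆ P.Hab Ω A)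
    (hD : ∀ p : h.space, p.1.1 ∈ S → h.bForm p p ≤ D * h.aForm p p) :
    P.nWidthOn A S m ≠ ⊤ := by
  refine ne_top_of_le_ne_top (b := ENNReal.ofReal (Real.sqrt D)) ENNReal.ofReal_ne_top ?_
  refine (iInf₂_le (fun _ => 0) fun _ => HasH10.zero.memH10 h.isOpen).trans ?_
  refine iSup₂_le fun u hu => (iInf₂_le 0 (Submodule.zero_mem _)).trans ?_
  obtain ⟨p, rfl⟩ := h.exists_eq (hS hu)
  rw [sub_zero, h.energyNorm_Rs, energyNorm, h.form_R]
  refine ENNReal.div_le_of_le_mul ?_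
  rw [← ENNReal.ofReal_mul (Real.sqrt_nonneg _)]
  refine ENNReal.ofReal_le_ofReal ?_
  rw [← Real.sqrt_mul' _ (h.isPSD_aForm.nonneg _)]
  exact Real.sqrt_le_sqrt (hD p hu)

end IsRing

end

section

variable {d : ℕ}

/-! ### Local approximation -/

variable {Ω : Set (E d)} {A : E d → Matrix (Fin d) (Fin d) ℝ} {αmin αmax C : ℝ}
  {P : Patch d} {k : E d → E d}

namespace IsRing

variable (h : IsRing A αmin αmax P.Rs P.R (P.Γ Ω) P.χR k C)
include h

theorem caccioppoli_pos : 0 < αmax * C ^ 2 + 1 := by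
  have := h.elliptic.pos.le.trans h.elliptic.le
  positivity

theorem ker_boundary (hP : P.Admissible Ω) (hb : P.IsBoundary Ω) (p : h.space)
    (hp : h.aForm p p = 0) : h.nForm p p = 0 := by
  rw [h.nForm_eq_zero_iff]
  refine hP.Rs_dirichlet hb _ ((h.hasVan p).vanishesOn h.lipschitz.isOpen) ?_
  exact ((h.hasVan p).ae_eq_weakGrad h.lipschitz.isOpen).trans ((h.aForm_eq_zero_iff p).1 hp)

/-- The functional `B(⋅, G)` on the space of harmonic functions. -/
def functional (h : IsRing A αmin αmax P.Rs P.R (P.Γ Ω) P.χR k C) {G : E d → E d}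
    (hG : MemLp G 2 (volume.restrict P.R)) : h.space →ₗ[ℝ] ℝ where
  toFun p := aint A P.R (cutGrad P.χR k p.1) G
  map_add' p q := by
    rw [Submodule.coe_add, cutGrad_add]
    exact (h.elliptic.mono h.subset).aint_add_left (h.hasH10_cut p).memLp_grad
      (h.hasH10_cut q).memLp_grad hG
  map_smul' r p := by rw [Submodule.coe_smul, cutGrad_smul]; exact aint_smul_left r

/-- The constant function. -/
theorem exists_one (hP : P.Admissible Ω) (hΩ : IsOpen Ω) (hb : ¬ P.IsBoundary Ω) :
    ∃ e : h.space, e.1 = (fun _ => 1, 0) := by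
  refine ⟨⟨(fun _ => 1, 0), ?_, fun φ H _ => aint_zero_left⟩, rfl⟩
  rw [hP.Γ_eq_empty hΩ hb]
  exact (hasWG_const h.lipschitz.isBounded.measure_lt_top.ne 1).hasVan_empty

/-! ### The constant function on an interior ring. -/

section Interior

variable {e : h.space} (he : e.1 = (fun _ => 1, 0))
include he

theorem nForm_one_ne_zero (hne : P.Rs.Nonempty) : h.nForm e e ≠ 0 := by
  rw [Ne, h.nForm_eq_zero_iff, he]
  intro h0
  have h1 : ∀ᵐ x ∂volume.restrict P.Rs, False := by
    filter_upwards [h0] with x hx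
    simp at hx
  have h2 : volume P.Rs = 0 := by simpa [ae_iff] using h1
  exact (h.lipschitz.isOpen.measure_pos volume hne).ne' h2

theorem aForm_one : h.aForm e e = 0 := by
  rw [h.aForm_apply, he]; exact aint_zero_left

theorem cutGrad_one : cutGrad P.χR k e.1 = k := by
  rw [he]; ext1 x; simp [cutGrad]

theorem exists_const (hc : IsPreconnected P.Rs) (p : h.space) (hp : h.aForm p p = 0) :
    ∃ t : ℝ, h.nForm (p - t • e) (p - t • e) = 0 := by
  have h1 : HasWG P.Rs p.1.1 0 := (h.hasVan p).toHasWG.congr Filter.EventuallyEq.rfl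
    ((h.aForm_eq_zero_iff p).1 hp)
  obtain ⟨t, ht⟩ := h1.exists_ae_eq_const h.lipschitz.isOpen hc
  refine ⟨t, (h.nForm_eq_zero_iff _).2 ?_⟩
  filter_upwards [ht] with x hx
  simp [he, hx]

/-- Zero energy makes p a constant t up to null vectors, and 0 = B(1,p) = t B(1,1) forces t = 0. -/
theorem ker_interior (hc : IsPreconnected P.Rs) (h0 : h.bForm e e ≠ 0) (p : h.space)
    (hp : h.bForm e p = 0) (hap : h.aForm p p = 0) : h.nForm p p = 0 := by
  obtain ⟨t, ht⟩ := h.exists_const he hc p hap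
  have h1 := h.isPSD_bForm.eq_of_null h.bForm_self_le ht e
  rw [h.isPSD_bForm.symm, hp, map_smul, LinearMap.smul_apply, smul_eq_mul] at h1
  have ht0 : t = 0 := (mul_eq_zero.1 h1.symm).resolve_right h0
  simpa [ht0] using ht

/-- If `B(1, 1) = 0`, then `B = 0`. -/
theorem bForm_eq_zero_of_one (h0 : h.bForm e e = 0) (p : h.space) : h.bForm p p = 0 := by
  refine le_antisymm ((h.bForm_self_le_integral p).trans ?_) (h.isPSD_bForm.nonneg p)
  rw [h.bForm_apply, cutGrad_one h he] at h0
  have hA := h.elliptic.mono h.subset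
  have h1 := hA.eq_zero_of_aint_eq_zero
    (h.cutoff.memLp_grad.mono_measure (Measure.restrict_mono h.subset le_rfl)) h0
  -- On R the gradient k of χ^R vanishes because B(1,1) = 0; off R it vanishes because χ^R does.
  -- Caccioppoli's bound is then zero.
  have h2 := h.cutoff.toHasWG.grad_eq_zero_of_eq_zero h.lipschitz.isOpen
    h.lipschitz.isBounded.measure_lt_top.ne
  rw [Filter.EventuallyEq, ae_restrict_iff' h.isOpen.measurableSet] at h1
  refine (integral_eq_zero_of_ae ?_).le
  filter_upwards [h2, ae_restrict_of_ae h1, ae_restrict_mem h.lipschitz.isOpen.measurableSet]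
    with x hx hx' hxs
  have : k x = 0 := by
    by_cases hxR : x ∈ P.R
    · exact hx' hxR
    · exact hx (h.eq_zero x hxs hxR)
  simp [density, this]

/-- The functional M^R is B(1,·)/B(1,1), since ∇χ^R is the gradient of χ^R·1. With B(1,1) ≠ 0 the
normalisation is immaterial. -/
theorem mem_Ha0_iff (h0 : h.bForm e e ≠ 0) (p : h.space) :
    p.1.1 ∈ P.Ha0 A ↔ h.bForm e p = 0 := by
  have hk : HasWG P.R P.χR k := h.cutoff.toHasWG.mono h.subset
  have h1 : form A P.R P.χR P.χR = h.bForm e e := by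
    rw [form_eq_aint h.isOpen hk hk, h.bForm_apply, cutGrad_one h he]
  have h2 : form A P.R (P.χR * p.1.1) P.χR = h.bForm e p := by
    rw [form_eq_aint h.isOpen (h.hasH10_cut p).toHasWG hk, h.isPSD_bForm.symm, h.bForm_apply,
      cutGrad_one h he]
  simp only [Patch.Ha0, Patch.MR, mem_ofPred_eq, h1, h2, mul_eq_zero, inv_eq_zero, h0, false_or]
  exact and_iff_right (h.mem_Hab p).1

end Interior

/-- The ring widths are finite. -/
theorem nWidth_ne_top (hP : P.Admissible Ω) (hΩ : IsOpen Ω) (m : ℕ) : P.nWidth Ω A m ≠ ⊤ := by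
  unfold Patch.nWidth
  split_ifs with hb
  -- The vector 0 makes the orthogonality condition void: on boundary patches the energy has only
  -- null vectors in its kernel.
  · obtain ⟨D, hD, hx⟩ := h.isCompactPair.exists_le_mul h.isPSD_bForm h.caccioppoli_pos
      h.bForm_self_le 0 fun p _ hp => h.ker_boundary hP hb p hp
    exact h.nWidthOn_ne_top subset_rfl fun p _ => hx p (by simp)
  · have hsub : P.Ha0 A ⊆ P.Hab Ω A := by
      rw [← hP.eigenSpace_eq hΩ]
      intro v hv
      unfold Patch.eigenSpace
      rw [if_neg hb]
      exact hv.1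
    obtain ⟨e, he⟩ := h.exists_one hP hΩ hb
    by_cases h0 : h.bForm e e = 0
    · exact h.nWidthOn_ne_top (D := 0) hsub fun p _ => by
        rw [h.bForm_eq_zero_of_one he h0 p, zero_mul]
    · obtain ⟨D, hD, hx⟩ := h.isCompactPair.exists_le_mul h.isPSD_bForm h.caccioppoli_pos
        h.bForm_self_le e (h.ker_interior he (hP.Rs_connected hb).isPreconnected h0)
      exact h.nWidthOn_ne_top hsub fun p hp => hx p ((h.mem_Ha0_iff he h0 p).1 hp)

/-- The complement of the first eigenfunctions is approximated by zero with the accuracy given by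
the width. -/
theorem sqrt_bForm_le (hP : P.Admissible Ω) (hΩ : IsOpen Ω) {n : ℕ} (hn : 1 ≤ n)
    {q : Fin n → h.space} {μ : Fin n → ℝ}
    (hf : P.IsFirstEigenpairs Ω A n (fun j => (q j).1.1) μ) {y : h.space}
    (hy : ∀ j, h.bForm (q j) y = 0) :
    open Classical in
    Real.sqrt (h.bForm y y) ≤ (P.nWidth Ω A (if P.IsBoundary Ω then n else n - 1)).toReal *
      Real.sqrt (h.aForm y y) := by
  classical
  obtain ⟨heig, hq, hlin, hfirst⟩ := h.first_eigenpairs hP hΩ hf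
  set m := if P.IsBoundary Ω then n else n - 1 with hm
  have hfin := h.nWidth_ne_top hP hΩ m
  -- The width is an infimum that need not be attained and may be 0, so the bound is proved for
  -- every larger D and passed to the limit.
  suffices H : ∀ D : ℝ, (P.nWidth Ω A m).toReal < D → h.bForm y y ≤ D ^ 2 * h.aForm y y by
    refine le_of_forall_pos_le_add fun ε hε => ?_
    set s := Real.sqrt (h.aForm y y) with hs
    have hs0 : 0 ≤ s := Real.sqrt_nonneg _
    have h1 := H ((P.nWidth Ω A m).toReal + ε / (s + 1)) (by
      have : 0 < ε / (s + 1) := by positivity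
      linarith)
    have h2 : ε / (s + 1) * s ≤ ε := by
      rw [div_mul_eq_mul_div, div_le_iff₀ (by positivity)]
      nlinarith
    have h3 : (0 : ℝ) ≤ (P.nWidth Ω A m).toReal + ε / (s + 1) := by positivity
    calc Real.sqrt (h.bForm y y)
        ≤ Real.sqrt (((P.nWidth Ω A m).toReal + ε / (s + 1)) ^ 2 * h.aForm y y) :=
          Real.sqrt_le_sqrt h1
      _ = ((P.nWidth Ω A m).toReal + ε / (s + 1)) * s := by
          rw [Real.sqrt_mul (by positivity), Real.sqrt_sq h3]
      _ ≤ _ := by rw [add_mul]; linarith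
  intro D hD
  have hD' : P.nWidth Ω A m < ENNReal.ofReal D :=
    (ENNReal.lt_ofReal_iff_toReal_lt hfin).2 hD
  unfold Patch.nWidth at hD'
  by_cases hb : P.IsBoundary Ω
  · simp only [hb, if_true] at hm hD'
    obtain ⟨r, hr, hrD⟩ := h.exists_of_nWidthOn_lt hD'
    refine h.isCompactPair.le_of_width h.isPSD_bForm h.caccioppoli_pos h.bForm_self_le heig hlin
      hfirst (fun x _ hx => h.ker_boundary hP hb x hx) (ι := Fin m) (by simp [hm])
      (fun j => h.functional (hr j).1.hasWG.memLp_grad) (sq_nonneg D)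
      (fun z hz => hrD z (h.mem_Hab z) hz) (fun z _ hz => h.ker_boundary hP hb z hz) hy
  · simp only [hb, if_false] at hm hD'
    obtain ⟨e, he⟩ := h.exists_one hP hΩ hb
    -- In the degenerate case the inverse in M^R is 0 and the constraint is empty, but B vanishes on
    -- the diagonal and the bound is trivial.
    by_cases h0 : h.bForm e e = 0
    · rw [h.bForm_eq_zero_of_one he h0 y]
      have := h.isPSD_aForm.nonneg y
      positivity
    obtain ⟨r, hr, hrD⟩ := h.exists_of_nWidthOn_lt hD'
    have hconn := hP.Rs_connected hb
    have hker := h.ker_interior he hconn.isPreconnected h0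
    obtain ⟨c, hc⟩ := h.isCompactPair.exists_kernel_combination h.isPSD_bForm hn heig hq hfirst
      (h.nForm_one_ne_zero he hconn.nonempty) (h.aForm_one he)
      (h.exists_const he hconn.isPreconnected)
    -- The functionals are B(1,·) and the n - 1 from the width space, n in all because n ≥ 1.
    -- Orthogonality to the eigenfunctions implies B(1,·) = 0, as 1 is a combination of them, so the
    -- kernel of a is trivial on the complement too.
    refine h.isCompactPair.le_of_width h.isPSD_bForm h.caccioppoli_pos h.bForm_self_le heig hlin
      hfirst (fun x hx hax => hker x ?_ hax) (ι := Option (Fin m)) (by simp [hm]; omega)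
      (fun o => o.elim (h.bForm e) fun j => h.functional (hr j).1.hasWG.memLp_grad) (sq_nonneg D)
      (fun z hz => hrD z ((h.mem_Ha0_iff he h0 z).2 (hz none)) fun j => hz (some j))
      (fun z hz haz => hker z (hz none) haz) hy
    rw [h.isPSD_bForm.eq_of_null h.bForm_self_le hc]
    simp [hx]

end IsRing

end

section

variable {d : ℕ}

/-! ### Extension to the whole domain -/

variable {Ω S : Set (E d)} {A : E d → Matrix (Fin d) (Fin d) ℝ} {αmin αmax C : ℝ}
  {P : Patch d} {k : E d → E d} {v w : E d → ℝ} {G H : E d → E d}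

/-- An operator-harmonic function `q` on `ω̃` with the trace of `p` on `∂ω̃`. -/
structure IsFilled (h : IsRing A αmin αmax P.Rs P.R (P.Γ Ω) P.χR k C) (p : h.space)
    (q : (E d → ℝ) × (E d → E d)) : Prop where
  hasVan : HasVan P.Wt (frontier P.Wt ∩ frontier Ω) q.1 q.2
  harmonic : ∀ φ H, HasH10 P.Wt φ H → aint A P.Wt q.2 H = 0
  trace : HasVan (P.Wt ∩ P.Rs) (frontier P.Wt) (q.1 - p.1.1) (q.2 - p.1.2)

namespace IsFilled

variable {h : IsRing A αmin αmax P.Rs P.R (P.Γ Ω) P.χR k C} {p p' : h.space}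
  {q q' : (E d → ℝ) × (E d → E d)}

theorem add (hA : IsElliptic P.Wt A αmin αmax) (hq : IsFilled h p q) (hq' : IsFilled h p' q') :
    IsFilled h (p + p') (q + q') where
  hasVan := hq.hasVan.add hq'.hasVan
  harmonic φ H hφ := by
    rw [Prod.snd_add, hA.aint_add_left hq.hasVan.memLp_grad hq'.hasVan.memLp_grad hφ.memLp_grad,
      hq.harmonic φ H hφ, hq'.harmonic φ H hφ, add_zero]
  trace := by
    have := hq.trace.add hq'.trace
    rwa [sub_add_sub_comm, sub_add_sub_comm] at this

theorem smul (hq : IsFilled h p q) (r : ℝ) : IsFilled h (r • p) (r • q) where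
  hasVan := hq.hasVan.smul r
  harmonic φ H hφ := by rw [Prod.smul_snd, aint_smul_left, hq.harmonic φ H hφ, mul_zero]
  trace := by
    have := hq.trace.smul r
    rwa [smul_sub, smul_sub] at this

theorem zero : IsFilled h 0 0 where
  hasVan := HasVan.zero
  harmonic _ _ _ := aint_zero_left
  trace := by
    have := HasVan.zero (S := P.Wt ∩ P.Rs) (Γ := frontier P.Wt)
    simpa using this

theorem sub (hA : IsElliptic P.Wt A αmin αmax) (hq : IsFilled h p q) (hq' : IsFilled h p' q') :
    IsFilled h (p - p') (q - q') := by
  have := hq.add hA (hq'.smul (-1))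
  rwa [neg_one_smul ℝ p', neg_one_smul ℝ q', ← sub_eq_add_neg, ← sub_eq_add_neg] at this

theorem sum (hA : IsElliptic P.Wt A αmin αmax) {ι : Type*} (s : Finset ι) {p : ι → h.space}
    {q : ι → (E d → ℝ) × (E d → E d)} (hq : ∀ i, IsFilled h (p i) (q i)) :
    IsFilled h (∑ i ∈ s, p i) (∑ i ∈ s, q i) := by
  classical
  induction s using Finset.induction_on with
  | empty => simpa using zero
  | insert a s ha ih =>
    rw [Finset.sum_insert ha, Finset.sum_insert ha]
    exact (hq a).add hA ih

end IsFilled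

theorem Patch.IsHarmonicFilling.isFilled (h : IsRing A αmin αmax P.Rs P.R (P.Γ Ω) P.χR k C)
    (hP : P.Admissible Ω) {p : h.space} {vt : E d → ℝ} (hf : P.IsHarmonicFilling Ω A p.1.1 vt) :
    IsFilled h p (vt, weakGrad P.Wt vt) where
  hasVan := hf.dirichlet.hasVan hP.isOpen_Wt hf.harmonic.1.hasWG
  harmonic φ H hφ := by
    rw [← form_eq_aint hP.isOpen_Wt hf.harmonic.1.hasWG hφ.toHasWG]
    exact hf.harmonic.2 φ (hφ.memH10 hP.isOpen_Wt)
  trace := hf.trace.hasVan (hP.isOpen_Wt.inter hP.isOpen_Rs)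
    ((hf.harmonic.1.hasWG.mono inter_subset_left).sub
      ((h.hasVan p).toHasWG.mono inter_subset_right))

/-- Testing with an extension by zero. -/
theorem aint_indicator_right {T : Set (E d)} (hT : IsOpen T) (hS : IsOpen S) (hST : S ⊆ T) :
    aint A T G (S.indicator H) = aint A S G H := by
  rw [aint_eq_of_subset hT hST (ae_of_all _ fun x hx => by simp [density, hx])]
  refine setIntegral_congr_fun hS.measurableSet fun x hx => ?_
  simp [density, hx]

/-- The extension of a filled function, multiplied with the partition of unity, has at most the
energy of the cut-off function on the ring. -/
theorem IsFilled.exists_extension {kη : E d → E d} {Cη : ℝ} (hP : P.Admissible Ω)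
    (hΩ : IsOpen Ω) (hΩf : volume Ω ≠ ⊤) (hA : IsElliptic Ω A αmin αmax)
    (hη : HasBddWG P.Ws P.η kη Cη) (hχR : HasBddWG P.Ws P.χR k C)
    {h : IsRing A αmin αmax P.Rs P.R (P.Γ Ω) P.χR k C} {p : h.space}
    {q : (E d → ℝ) × (E d → E d)} (hq : IsFilled h p q) :
    ∃ Z, HasH10 Ω (P.χ * P.ext p.1.1 q.1) Z ∧ aint A Ω Z Z ≤ h.bForm p p ∧
      ∀ᵐ x ∂volume.restrict Ω, x ∉ P.W → Z x = 0 := by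
  classical
  have hWtΩ : P.Wt ⊆ Ω := hP.Wt_subset_Ws.trans hP.Ws_subset
  have hRΩ : P.R ⊆ Ω := hP.R_subset.trans hP.Rs_subset_Ω
  have hI : IsOpen (P.Wt ∩ P.Rs) := hP.isOpen_Wt.inter hP.isOpen_Rs
  have h1 := h.hasH10_cut p
  -- On the part of ∂ω̃ inside Ω, η tends to 0; on the rest q has zero trace.
  have h2 : HasH10 P.Wt (P.η * q.1) (fun x => P.η x • q.2 x + q.1 x • kη x) := by
    refine hq.hasVan.mul_hasH10 hP.isOpen_Wt hP.Wt_lipschitz.isBounded hP.isOpen_Wt subset_rfl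
      (hη.mono hP.Wt_subset_Ws) fun x hx hxW hxΓ => ?_
    have hxf : x ∈ frontier P.Wt := ⟨hx, by rwa [hP.isOpen_Wt.interior_eq]⟩
    have hxΩ : x ∈ Ω := by
      by_contra hn
      exact hxΓ ⟨hxf, closure_mono hWtΩ hx, fun h => hn (interior_subset h)⟩
    have hxs : x ∈ P.Ws := hP.W_subset (hP.R_subset_W (hP.frontier_Wt ⟨hxf, hxΩ⟩))
    rw [← hP.η_zero x hxs hxW]
    exact (hP.continuousAt_η hxs).tendsto.mono_left nhdsWithin_le_nhds
  -- The trace of q - p vanishes on ∂ω̃; at other boundary points of the intersection χ^R tends to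
  -- 0.
  have h3 : HasH10 (P.Wt ∩ P.Rs) (P.χR * (q.1 - p.1.1))
      (fun x => P.χR x • (q.2 - p.1.2) x + (q.1 - p.1.1) x • k x) := by
    refine hq.trace.mul_hasH10 hI (hP.Wt_lipschitz.isBounded.subset inter_subset_left) hI subset_rfl
      (hχR.mono (inter_subset_left.trans hP.Wt_subset_Ws)) fun x hx hxW hxΓ => ?_
    have hxWt : x ∈ P.Wt := by
      by_contra hn
      exact hxΓ ⟨closure_mono inter_subset_left hx, by rwa [hP.isOpen_Wt.interior_eq]⟩
    have hxR : x ∉ P.R := fun hR => hxW ⟨hxWt, hP.R_subset hR⟩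
    exact (hP.tendsto_χR hΩ (hWtΩ hxWt) hxR).mono_left
      (nhdsWithin_mono _ (inter_subset_left.trans hP.Wt_subset_Ws))
  have h4 := h2.add (h3.indicator hI (inter_subset_left (s := P.Wt)))
  have h5 := h1.indicator h.isOpen hRΩ
  have h6 := h4.indicator hP.isOpen_Wt hWtΩ
  set X := (fun x => P.η x • q.2 x + q.1 x • kη x) +
    (P.Wt ∩ P.Rs).indicator (fun x => P.χR x • (q.2 - p.1.2) x + (q.1 - p.1.1) x • k x) with hX
  have h7 := h5.add h6
  -- On ω̃ ∩ R, (1 - η)p + ηq + (1 - η)(q - p) = q. On ω̃ \ R, η = 1 and χ^R = 0. On R \ ω̃, η = 0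
  -- and χ^R = χ.
  have heq : ∀ x ∈ Ω, (P.R.indicator (P.χR * p.1.1) + P.Wt.indicator (P.η * q.1 +
      (P.Wt ∩ P.Rs).indicator (P.χR * (q.1 - p.1.1)))) x = (P.χ * P.ext p.1.1 q.1) x := by
    intro x hx
    by_cases hxt : x ∈ P.Wt
    · have e0 : P.χR x = 1 - P.η x := by simp [Patch.χR, hP.χ_inner x hxt]
      by_cases hxR : x ∈ P.R
      · have hxs := hP.R_subset hxR
        simp [Patch.ext, hxt, hxR, hxs, hP.χ_inner x hxt, e0]
        ring
      · have e1 : P.χR x = 0 := hP.χR_eq_zero (hP.Wt_subset_Ws hxt) hxR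
        have e2 : P.η x = 1 := by linarith
        by_cases hxs : x ∈ P.Rs <;> simp [Patch.ext, hxt, hxR, hxs, hP.χ_inner x hxt, e1, e2]
    · by_cases hxR : x ∈ P.R
      · have hxs := hP.W_subset (hP.R_subset_W hxR)
        simp [Patch.ext, hxt, hxR, Patch.χR, hP.η_zero x hxs hxt]
      · have : x ∉ P.W := by rw [← hP.Wt_union_R]; simp [hxt, hxR]
        simp [Patch.ext, hxt, hxR, hP.χ_support x hx this]
  have hZ := h7.congr (w := P.χ * P.ext p.1.1 q.1)
    (by filter_upwards [ae_restrict_mem hΩ.measurableSet] with x hx using heq x hx)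
    Filter.EventuallyEq.rfl
  have hA' := hA.mono hWtΩ
  have hF := h5.memLp_grad
  have hF2 := h6.memLp_grad
  -- On ω̃ the product χ v^ext is q, which is operator-harmonic, and the correction lies in H¹₀(ω̃).
  have hort : aint A Ω (P.R.indicator (cutGrad P.χR k p.1) + P.Wt.indicator X)
      (P.Wt.indicator X) = 0 := by
    rw [aint_indicator_right hΩ hP.isOpen_Wt hWtΩ, ← hq.harmonic _ _ h4]
    have e1 : HasWG P.Wt q.1 (P.R.indicator (cutGrad P.χR k p.1) + P.Wt.indicator X) := by
      refine (hZ.toHasWG.mono hWtΩ).congr ?_ Filter.EventuallyEq.rfl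
      filter_upwards [ae_restrict_mem hP.isOpen_Wt.measurableSet] with x hx
      simp [Patch.ext, hx, hP.χ_inner x hx]
    exact aint_congr (e1.unique hP.isOpen_Wt hq.hasVan.toHasWG) Filter.EventuallyEq.rfl
  refine ⟨_, hZ, ?_, ?_⟩
  -- Pythagoras: the energy of the zero extension of χ^R p is that of χ v^ext plus that of the
  -- correction.
  · have e1 := hA.aint_sub_self hZ.memLp_grad hF2
    rw [hort, add_sub_cancel_right, aint_indicator_right hΩ h.isOpen hRΩ,
      (hA.mono hRΩ).aint_comm, aint_indicator_right h.isOpen h.isOpen subset_rfl,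
      ← h.bForm_apply] at e1
    linarith [hA.aint_self_nonneg (P.Wt.indicator X)]
  · filter_upwards [hZ.toHasWG.grad_eq_zero_of_eq_zero hΩ hΩf,
      ae_restrict_mem hΩ.measurableSet] with x hx hxΩ hxW
    exact hx (by simp [hP.χ_support x hxΩ hxW])

end

section

variable {d : ℕ}

/-! ### The local error -/

variable {Ω S T : Set (E d)} {A : E d → Matrix (Fin d) (Fin d) ℝ} {αmin αmax C : ℝ}
  {P : Patch d} {k : E d → E d} {f g u v w : E d → ℝ} {Gu G H : E d → E d} {n : ℕ}
  {L : LocalData d n}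

theorem load_indicator (hS : IsOpen S) (hΩ : IsOpen Ω) (hSΩ : S ⊆ Ω) :
    load f Ω (S.indicator v) = load f S v := by
  rw [load, load, setIntegral_eq_of_subset_of_forall_sdiff_eq_zero hΩ.measurableSet hSΩ
    fun x hx => by simp [hx.2]]
  exact setIntegral_congr_fun hS.measurableSet fun x hx => by simp [hx]

theorem frontier_inter_subset (hT : IsOpen T) (hTΩ : T ⊆ Ω) (hST : S ⊆ T) :
    frontier S ∩ frontier Ω ⊆ frontier T ∩ frontier Ω := fun x hx =>
  ⟨⟨closure_mono hST hx.1.1, fun h => hx.2.2 (interior_mono hTΩ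
    (by rw [hT.interior_eq] at h ⊢; exact h))⟩, hx.2⟩

theorem disjoint_frontier_self (hS : IsOpen S) : Disjoint (frontier S) S := by
  rw [disjoint_iff_inter_eq_empty, inter_comm, hS.inter_frontier_eq]

/-- Test functions on a subset, extended by zero, are admissible in the global equation. -/
theorem HasH10.aint_eq_load (hΩ : IsOpen Ω) (hu : IsWeakSolution Ω A f g u) (hGu : HasWG Ω u Gu)
    (hS : IsOpen S) (hSΩ : S ⊆ Ω) (hφ : HasH10 S v H) : aint A S Gu H = load f S v := by
  have h1 := hφ.indicator hS hSΩ
  have h2 := hu.eq _ (h1.memH10 hΩ)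
  rwa [form_eq_aint hΩ hGu h1.toHasWG, aint_indicator_right hΩ hS hSΩ,
    load_indicator hS hΩ hSΩ] at h2

/-- The difference of the solution and the local particular function. -/
theorem LocalData.Solves.exists_remainder (hP : P.Admissible Ω) (hΩ : IsOpen Ω)
    (hA : IsElliptic Ω A αmin αmax) (hu : IsWeakSolution Ω A f g u) (hGu : HasWG Ω u Gu)
    (hg : MemH1 Ω g) (hL : L.Solves Ω A f g P) :
    ∃ G, HasVan P.Ws (frontier P.Ws ∩ frontier Ω) (u - L.particular Ω P) G ∧
      (∀ φ H, HasH10 P.Ws φ H → aint A P.Ws G H = 0) ∧ aint A P.Ws G G ≤ aint A P.Ws Gu Gu := by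
  have hWs := hP.isOpen_Ws
  have hA' := hA.mono hP.Ws_subset
  have hGu' := hGu.mono hP.Ws_subset
  have hψ : HasH10 P.Ws L.ψ (weakGrad P.Ws L.ψ) := hL.ψ_mem.hasH10 hWs hL.ψ_mem.1.hasWG
  have hψeq : ∀ φ H, HasH10 P.Ws φ H → aint A P.Ws (weakGrad P.Ws L.ψ) H = load f P.Ws φ :=
    fun φ H hφ => by
      rw [← form_eq_aint hWs hψ.toHasWG hφ.toHasWG]
      exact hL.ψ_eq φ (hφ.memH10 hWs)
  -- Pythagoras: if the remainder is orthogonal to the particular function, its energy is at most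
  -- that of u.
  have key : ∀ {G r}, HasWG P.Ws r G → aint A P.Ws (Gu - G) G = 0 →
      aint A P.Ws (Gu - G) (Gu - G) ≤ aint A P.Ws Gu Gu := fun {G r} hr h0 => by
    have := hA'.aint_add_self (hGu'.sub hr).memLp_grad hr.memLp_grad
    rw [sub_add_cancel, h0] at this
    linarith [hA'.aint_self_nonneg G]
  have hdisj : Disjoint (frontier P.Ws ∩ frontier Ω) P.Ws :=
    (disjoint_frontier_self hWs).mono_left inter_subset_left
  by_cases hb : P.IsBoundary Ω
  · obtain ⟨hψb, hψbg⟩ := hL.ψb_dirichlet hb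
    set Gb := weakGrad P.Ws L.ψb
    have hb' : HasWG P.Ws L.ψb Gb := hψb.hasWG
    have hbeq : ∀ w H, HasVan P.Ws (frontier P.Ws ∩ frontier Ω) w H → aint A P.Ws Gb H = 0 :=
      fun w H hw => by
        rw [← form_eq_aint hWs hb' hw.toHasWG]
        exact hL.ψb_eq hb w (hw.vanishesOn hWs)
    have hr := hψ.toHasWG.add hb'
    have hpart : L.particular Ω P = L.ψ + L.ψb := by simp [LocalData.particular, hb]
    have hgW := hg.hasWG
    have hvan : HasVan P.Ws (frontier P.Ws ∩ frontier Ω) (u - (L.ψ + L.ψb))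
        (Gu - (weakGrad P.Ws L.ψ + Gb)) := by
      -- The trace condition comes from u - g ∈ H¹₀(Ω), since ∂Ω is disjoint from the open set Ω.
      have h1 : HasVan P.Ws (frontier P.Ws ∩ frontier Ω) (u - g) (Gu - weakGrad Ω g) :=
        ((hu.dirichlet.hasH10 hΩ (hGu.sub hgW)).hasVan
          (disjoint_frontier_self hΩ)).mono hP.Ws_subset inter_subset_right
      have h2 := hψbg.hasVan hWs (hb'.sub (hgW.mono hP.Ws_subset))
      have h3 := (h1.sub h2).sub (hψ.hasVan hdisj)
      convert h3 using 1 <;> abel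
    have hharm : ∀ φ H, HasH10 P.Ws φ H →
        aint A P.Ws (Gu - (weakGrad P.Ws L.ψ + Gb)) H = 0 := fun φ H hφ => by
      rw [hA'.aint_sub_left hGu'.memLp_grad hr.memLp_grad hφ.memLp_grad,
        hA'.aint_add_left hψ.memLp_grad hb'.memLp_grad hφ.memLp_grad, hψeq φ H hφ,
        hφ.aint_eq_load hΩ hu hGu hWs hP.Ws_subset, hbeq φ H (hφ.hasVan hdisj)]
      ring
    rw [hpart]
    refine ⟨_, hvan, hharm, key hr ?_⟩
    -- The remainder is orthogonal to ψ because ψ ∈ H¹₀(ω*), and to ψ^b because it is itself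
    -- admissible in the equation for ψ^b.
    rw [hA'.aint_add_right hvan.memLp_grad hψ.memLp_grad hb'.memLp_grad, hharm _ _ hψ,
      hA'.aint_comm, hbeq _ _ hvan, add_zero]
  · have hpart : L.particular Ω P = L.ψ := by simp [LocalData.particular, hb]
    have hharm : ∀ φ H, HasH10 P.Ws φ H → aint A P.Ws (Gu - weakGrad P.Ws L.ψ) H = 0 :=
      fun φ H hφ => by
        rw [hA'.aint_sub_left hGu'.memLp_grad hψ.memLp_grad hφ.memLp_grad, hψeq φ H hφ,
          hφ.aint_eq_load hΩ hu hGu hWs hP.Ws_subset, sub_self]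
    rw [hpart, not_nonempty_iff_eq_empty.1 hb]
    exact ⟨_, (hGu'.sub hψ.toHasWG).hasVan_empty, hharm, key hψ.toHasWG (hharm _ _ hψ)⟩

/-- Extension distributes over linear combinations. -/
theorem Patch.ext_sub_sum (c : Fin n → ℝ) (z : E d → ℝ) (v vt : Fin n → E d → ℝ) :
    P.ext (z - ∑ j, c j • v j) (z - ∑ j, c j • vt j) =
      z - ∑ j, c j • P.ext (v j) (vt j) := by
  classical
  ext x
  by_cases hx : x ∈ P.Wt <;> simp [Patch.ext, hx]

theorem Patch.ext_sum (c : Fin n → ℝ) (v vt : Fin n → E d → ℝ) :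
    P.ext (∑ j, c j • v j) (∑ j, c j • vt j) = ∑ j, c j • P.ext (v j) (vt j) := by
  classical
  ext x
  by_cases hx : x ∈ P.Wt <;> simp [Patch.ext, hx]

/-- The eigenfunctions as elements of the space of harmonic functions, with their fillings. -/
theorem LocalData.Solves.exists_eigenfunctions (hP : P.Admissible Ω) (hΩ : IsOpen Ω)
    (h : IsRing A αmin αmax P.Rs P.R (P.Γ Ω) P.χR k C) (hL : L.Solves Ω A f g P) :
    ∃ q : Fin n → h.space, (∀ j, (q j).1.1 = L.v j) ∧
      ∀ j, IsFilled h (q j) (L.vt j, weakGrad P.Wt (L.vt j)) := by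
  have hv : ∀ j, ∃ p : h.space, p.1.1 = L.v j := fun j => h.exists_eq (by
    rw [← hP.eigenSpace_eq hΩ]; exact (hL.eigenpairs.eigenpair j).1)
  choose q hq using hv
  exact ⟨q, hq, fun j => Patch.IsHarmonicFilling.isFilled h hP (by
    rw [hq]; exact hL.filling j)⟩

theorem coe_sum_smul_prod (c : Fin n → ℝ) (q : Fin n → (E d → ℝ) × (E d → E d)) :
    (∑ j, c j • q j).1 = ∑ j, c j • (q j).1 := by
  simp [Prod.fst_sum]

/-- Products of the partition of unity and local functions have zero trace. -/
theorem LocalData.Solves.hasH10 (hP : P.Admissible Ω) (hΩ : IsOpen Ω) (hΩf : volume Ω ≠ ⊤)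
    (hA : IsElliptic Ω A αmin αmax) (hL : L.Solves Ω A f g P) {φ : E d → ℝ}
    (hφ : φ ∈ L.space P) : ∃ Z, HasH10 Ω (P.χ * φ) Z := by
  obtain ⟨kχ, kη, Cχ, Cη, -, hη, hχR⟩ := hP.exists_cutoffs hΩf
  have h := hP.isRing hΩ hA hχR
  obtain ⟨q, hq, hqf⟩ := hL.exists_eigenfunctions hP hΩ h
  obtain ⟨c, rfl⟩ := (Submodule.mem_span_range_iff_exists_fun ℝ).1 hφ
  have hAt := hA.mono (hP.Wt_subset_Ws.trans hP.Ws_subset)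
  obtain ⟨Z, hZ, -⟩ := (IsFilled.sum hAt Finset.univ fun j => (hqf j).smul (c j)).exists_extension
    hP hΩ hΩf hA hη hχR
  rw [h.coe_sum_smul, coe_sum_smul_prod] at hZ
  simp only [hq] at hZ
  rw [Patch.ext_sum] at hZ
  exact ⟨Z, hZ⟩

open Classical in
/-- The local approximation error. -/
theorem LocalData.Solves.exists_approx (hP : P.Admissible Ω) (hΩ : IsOpen Ω) (hΩf : volume Ω ≠ ⊤)
    (hA : IsElliptic Ω A αmin αmax) (hu : IsWeakSolution Ω A f g u) (hGu : HasWG Ω u Gu)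
    (hg : MemH1 Ω g) (hn : 1 ≤ n) (hL : L.Solves Ω A f g P) :
    ∃ φ ∈ L.space P, ∃ Z, HasH10 Ω (P.χ * (u - L.particular Ω P - φ)) Z ∧
      aint A Ω Z Z ≤ (P.nWidth Ω A (if P.IsBoundary Ω then n else n - 1)).toReal ^ 2 *
        aint A P.Ws Gu Gu ∧
      ∀ᵐ x ∂volume.restrict Ω, x ∉ P.W → Z x = 0 := by
  obtain ⟨kχ, kη, Cχ, Cη, -, hη, hχR⟩ := hP.exists_cutoffs hΩf
  have h := hP.isRing hΩ hA hχR
  obtain ⟨q, hq, hqf⟩ := hL.exists_eigenfunctions hP hΩ h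
  have hWtΩ := hP.Wt_subset_Ws.trans hP.Ws_subset
  have hAt := hA.mono hWtΩ
  obtain ⟨G, hzvan, hzharm, hzle⟩ := hL.exists_remainder hP hΩ hA hu hGu hg
  set z := u - L.particular Ω P with hz
  have hharm : ∀ {S} (_ : IsOpen S) (_ : S ⊆ P.Ws) φ H, HasH10 S φ H → aint A S G H = 0 :=
    fun hS hSW φ H hφ => by
      rw [← aint_indicator_right hP.isOpen_Ws hS hSW]
      exact hzharm _ _ (hφ.indicator hS hSW)
  let pz : h.space := ⟨(z, G), hzvan.mono hP.Rs_subset (frontier_inter_subset hP.isOpen_Ws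
    hP.Ws_subset hP.Rs_subset), hharm hP.isOpen_Rs hP.Rs_subset⟩
  -- The remainder is operator-harmonic on all of ω*, so it is its own filling.
  have hzf : IsFilled h pz (z, G) :=
    ⟨hzvan.mono hP.Wt_subset_Ws (frontier_inter_subset hP.isOpen_Ws hP.Ws_subset
      hP.Wt_subset_Ws), hharm hP.isOpen_Wt hP.Wt_subset_Ws, by
        simpa [pz] using HasVan.zero (S := P.Wt ∩ P.Rs) (Γ := frontier P.Wt)⟩
  have hf : P.IsFirstEigenpairs Ω A n (fun j => (q j).1.1) L.μ := by
    simp only [hq]; exact hL.eigenpairs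
  obtain ⟨s, hs, hys⟩ := h.isPSD_bForm.exists_projection Finset.univ q pz
  rw [Finset.coe_univ, image_univ] at hs
  obtain ⟨c, rfl⟩ := (Submodule.mem_span_range_iff_exists_fun ℝ).1 hs
  set y := pz - ∑ j, c j • q j with hy
  have heig := (h.first_eigenpairs hP hΩ hf).1
  have hyq : ∀ j, h.bForm (q j) y = 0 := fun j => hys j (Finset.mem_univ j)
  -- A B-orthogonal projection onto eigenvectors is also a-orthogonal, since a(v_k,·) = μ_k
  -- B(v_k,·); hence it does not increase the energy.
  have hya : h.aForm y y ≤ h.aForm pz pz := by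
    have e : pz = y + ∑ j, c j • q j := by rw [hy, sub_add_cancel]
    have e0 : h.aForm (∑ j, c j • q j) y = 0 := by
      rw [map_sum, LinearMap.sum_apply]
      refine Finset.sum_eq_zero fun j _ => ?_
      rw [map_smul, LinearMap.smul_apply, heig, hyq, mul_zero, smul_zero]
    have e1 := h.isPSD_aForm.nonneg (∑ j, c j • q j)
    rw [e]
    simp only [map_add, LinearMap.add_apply, h.isPSD_aForm.symm y, e0]
    linarith
  obtain ⟨Z, hZ, hZle, hZ0⟩ := (hzf.sub hAt (IsFilled.sum hAt Finset.univ
    fun j => (hqf j).smul (c j))).exists_extension hP hΩ hΩf hA hη hχR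
  refine ⟨∑ j, c j • P.ext (L.v j) (L.vt j), Submodule.sum_mem _ fun j _ =>
    Submodule.smul_mem _ _ (Submodule.subset_span ⟨j, rfl⟩), Z, ?_, ?_, hZ0⟩
  · rw [Submodule.coe_sub, Prod.fst_sub, Prod.fst_sub, h.coe_sum_smul, coe_sum_smul_prod] at hZ
    simp only [hq] at hZ
    rw [Patch.ext_sub_sum] at hZ
    exact hZ
  · have h1 := h.sqrt_bForm_le hP hΩ hn hf hyq
    have h2 := pow_le_pow_left₀ (Real.sqrt_nonneg _) h1 2
    rw [mul_pow, Real.sq_sqrt (h.isPSD_bForm.nonneg _),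
      Real.sq_sqrt (h.isPSD_aForm.nonneg _)] at h2
    refine (hZle.trans h2).trans (mul_le_mul_of_nonneg_left ?_ (sq_nonneg _))
    refine hya.trans (le_trans ?_ hzle)
    exact (hA.mono hP.Ws_subset).aint_mono hP.Rs_subset hzvan.memLp_grad

end

section

variable {d : ℕ}

/-! ### The global error -/

variable {Ω S T : Set (E d)} {A : E d → Matrix (Fin d) (Fin d) ℝ} {αmin αmax C : ℝ}
  {f g u v w : E d → ℝ} {Gu G H : E d → E d} {M : ℕ} {P : Fin M → Patch d} {n : Fin M → ℕ}
  {L : ∀ i, LocalData d (n i)}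

/-- Cauchy–Schwarz for a semidefinite quadratic form. Applied pointwise, only the fields active at x
are counted, which yields the overlap constant. -/
theorem quadratic_sum_le {ι : Type*} {B : Matrix (Fin d) (Fin d) ℝ} (hB : B.IsSymm)
    (hpos : ∀ ξ : Fin d → ℝ, 0 ≤ (B *ᵥ ξ) ⬝ᵥ ξ) (s : Finset ι) (z : ι → Fin d → ℝ) :
    (B *ᵥ ∑ i ∈ s, z i) ⬝ᵥ ∑ i ∈ s, z i ≤ s.card * ∑ i ∈ s, (B *ᵥ z i) ⬝ᵥ z i := by
  have hc : ∀ ξ ζ : Fin d → ℝ, (B *ᵥ ξ) ⬝ᵥ ζ = (B *ᵥ ζ) ⬝ᵥ ξ := fun ξ ζ => by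
    rw [dotProduct_comm, Matrix.dotProduct_mulVec, ← Matrix.mulVec_transpose, hB.eq]
  have h2 : ∀ ξ ζ : Fin d → ℝ, (B *ᵥ ξ) ⬝ᵥ ζ ≤ ((B *ᵥ ξ) ⬝ᵥ ξ + (B *ᵥ ζ) ⬝ᵥ ζ) / 2 :=
    fun ξ ζ => by
      have := hpos (ξ - ζ)
      rw [Matrix.mulVec_sub, sub_dotProduct, dotProduct_sub, dotProduct_sub, hc ζ ξ] at this
      linarith
  rw [Matrix.mulVec_sum, sum_dotProduct]
  simp only [dotProduct_sum]
  calc _ ≤ ∑ i ∈ s, ∑ j ∈ s, ((B *ᵥ z i) ⬝ᵥ z i + (B *ᵥ z j) ⬝ᵥ z j) / 2 :=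
        Finset.sum_le_sum fun i _ => Finset.sum_le_sum fun j _ => h2 _ _
    _ = _ := by
        simp only [add_div, Finset.sum_add_distrib, Finset.sum_const, nsmul_eq_mul,
          ← Finset.sum_div, ← Finset.mul_sum]
        ring

/-- Sums of fields with finite overlap. -/
theorem IsElliptic.aint_sum_le (hA : IsElliptic Ω A αmin αmax) {W : Fin M → Set (E d)} {κ : ℕ}
    (hΩ : IsOpen Ω) (hκ : ∀ x ∈ Ω, {i | x ∈ W i}.ncard ≤ κ) {Z : Fin M → E d → E d}
    (hZ : ∀ i, MemLp (Z i) 2 (volume.restrict Ω))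
    (hZ0 : ∀ i, ∀ᵐ x ∂volume.restrict Ω, x ∉ W i → Z i x = 0) :
    aint A Ω (∑ i, Z i) (∑ i, Z i) ≤ κ * ∑ i, aint A Ω (Z i) (Z i) := by
  classical
  have hi : ∀ i, Integrable (density A (Z i) (Z i)) (volume.restrict Ω) := fun i =>
    hA.integrable_density (hZ i) (hZ i)
  have hs := memLp_finsetSum' Finset.univ fun i _ => hZ i
  simp only [aint]
  rw [← integral_finsetSum _ fun i _ => hi i, ← integral_const_mul]
  refine integral_mono_ae (hA.integrable_density hs hs)
    ((integrable_finsetSum _ fun i _ => hi i).const_mul _) ?_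
  filter_upwards [hA.symm, hA.bounds, ae_all_iff.2 hZ0, ae_restrict_mem hΩ.measurableSet]
    with x h1 h2 h3 h4
  have hpos : ∀ ξ : Fin d → ℝ, 0 ≤ (A x *ᵥ ξ) ⬝ᵥ ξ := fun ξ => le_trans
    (mul_nonneg hA.pos.le (by rw [dotProduct]; exact Finset.sum_nonneg fun _ _ => mul_self_nonneg _))
    (h2 ξ).1
  set I : Finset (Fin M) := Finset.univ.filter fun i => x ∈ W i with hI
  have hcard : I.card ≤ κ := by
    have := hκ x h4
    rwa [Set.ncard_eq_toFinset_card', show {i | x ∈ W i}.toFinset = I by ext; simp [hI]] at this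
  have e1 : ((∑ i, Z i) x).ofLp = ∑ i ∈ I, (Z i x).ofLp := by
    rw [Finset.sum_apply, WithLp.ofLp_sum]
    refine (Finset.sum_subset (Finset.subset_univ I) fun i _ hiI => ?_).symm
    rw [h3 i (by simpa [hI] using hiI)]; rfl
  have e2 := quadratic_sum_le h1 hpos I fun i => (Z i x).ofLp
  have e3 : ∑ i ∈ I, (A x *ᵥ (Z i x).ofLp) ⬝ᵥ (Z i x).ofLp ≤ ∑ i, density A (Z i) (Z i) x :=
    Finset.sum_le_sum_of_subset_of_nonneg (Finset.subset_univ I) fun i _ _ => hpos _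
  have e4 : 0 ≤ ∑ i, density A (Z i) (Z i) x := Finset.sum_nonneg fun i _ => hpos _
  calc density A (∑ i, Z i) (∑ i, Z i) x
      ≤ I.card * ∑ i ∈ I, (A x *ᵥ (Z i x).ofLp) ⬝ᵥ (Z i x).ofLp := by rw [density, e1]; exact e2
    _ ≤ (I.card : ℝ) * ∑ i, density A (Z i) (Z i) x := by gcongr
    _ ≤ κ * ∑ i, density A (Z i) (Z i) x := by gcongr

/-- Sums of energies over sets with finite overlap. -/
theorem IsElliptic.sum_aint_le (hA : IsElliptic Ω A αmin αmax) {W : Fin M → Set (E d)} {κ : ℕ}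
    (hΩ : IsOpen Ω) (hW : ∀ i, IsOpen (W i)) (hWΩ : ∀ i, W i ⊆ Ω)
    (hκ : ∀ x ∈ Ω, {i | x ∈ W i}.ncard ≤ κ) (hG : MemLp G 2 (volume.restrict Ω)) :
    ∑ i, aint A (W i) G G ≤ κ * aint A Ω G G := by
  classical
  have hi := hA.integrable_density hG hG
  have e : ∀ i, aint A (W i) G G = ∫ x in Ω, (W i).indicator (density A G G) x := fun i => by
    rw [integral_indicator (hW i).measurableSet, Measure.restrict_restrict_of_subset (hWΩ i)]
    rfl
  simp only [e]
  rw [← integral_finsetSum _ fun i _ => hi.indicator (hW i).measurableSet, aint,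
    ← integral_const_mul]
  refine integral_mono_ae (integrable_finsetSum _ fun i _ => hi.indicator (hW i).measurableSet)
    (hi.const_mul _) ?_
  filter_upwards [hA.density_nonneg G, ae_restrict_mem hΩ.measurableSet] with x h1 h2
  have hcard := hκ x h2
  rw [Set.ncard_eq_toFinset_card'] at hcard
  have : ∑ i, (W i).indicator (density A G G) x = {i | x ∈ W i}.toFinset.card * density A G G x := by
    simp only [Set.indicator_apply, ← Finset.sum_filter, Finset.sum_const, nsmul_eq_mul]
    congr 3
    ext; simp
  rw [this]
  gcongr

theorem globalSpace_sub {s t : E d → ℝ} (hs : s ∈ globalSpace P L) (ht : t ∈ globalSpace P L) :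
    s - t ∈ globalSpace P L := by
  obtain ⟨φ, hφ, rfl⟩ := hs
  obtain ⟨ψ, hψ, rfl⟩ := ht
  exact ⟨fun i => φ i - ψ i, fun i => Submodule.sub_mem _ (hφ i) (hψ i), by
    simp [mul_sub]⟩

theorem globalSpace_hasH10 (hΩ : IsOpen Ω) (hΩf : volume Ω ≠ ⊤) (hA : IsElliptic Ω A αmin αmax)
    (hP : ∀ i, (P i).Admissible Ω) (hL : ∀ i, (L i).Solves Ω A f g (P i)) {s : E d → ℝ}
    (hs : s ∈ globalSpace P L) : ∃ G, HasH10 Ω s G := by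
  obtain ⟨φ, hφ, rfl⟩ := hs
  choose Z hZ using fun i => (hL i).hasH10 (hP i) hΩ hΩf hA (hφ i)
  exact ⟨_, HasH10.sum _ fun i _ => hZ i⟩

theorem maxWidth_ne_top (hΩ : IsOpen Ω) (hΩf : volume Ω ≠ ⊤) (hA : IsElliptic Ω A αmin αmax)
    (hP : ∀ i, (P i).Admissible Ω) : maxWidth Ω A P n ≠ ⊤ := by
  classical
  have h : ∀ i m, (P i).nWidth Ω A m ≠ ⊤ := fun i m => by
    obtain ⟨kχ, kη, Cχ, Cη, -, -, hχR⟩ := (hP i).exists_cutoffs hΩf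
    exact ((hP i).isRing hΩ hA hχR).nWidth_ne_top (hP i) hΩ m
  -- A supremum of finitely many finite widths is bounded by their sum.
  refine ne_top_of_le_ne_top (ENNReal.sum_ne_top.2 fun i (_ : i ∈ Finset.univ) => h i _)
    (iSup_le fun i => Finset.single_le_sum (f := fun i => (P i).nWidth Ω A
      (@ite _ ((P i).IsBoundary Ω) (Classical.propDecidable _) (n i) (n i - 1)))
      (fun _ _ => zero_le) (Finset.mem_univ i))

/-- Approximation of the solution from the affine space of the method. -/
theorem exists_global_approx (hΩ : IsOpen Ω) (hΩf : volume Ω ≠ ⊤) (hA : IsElliptic Ω A αmin αmax)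
    (hg : MemH1 Ω g) (hu : IsWeakSolution Ω A f g u) (hGu : HasWG Ω u Gu)
    (hP : ∀ i, (P i).Admissible Ω) (hχ : ∀ x ∈ Ω, ∑ i, (P i).χ x = 1) {κ κs : ℕ}
    (hκ : ∀ x ∈ Ω, {i | x ∈ (P i).W}.ncard ≤ κ) (hκs : ∀ x ∈ Ω, {i | x ∈ (P i).Ws}.ncard ≤ κs)
    (hn : ∀ i, 1 ≤ n i) (hL : ∀ i, (L i).Solves Ω A f g (P i)) :
    ∃ s ∈ globalSpace P L, ∃ Z, HasH10 Ω (u - globalParticular Ω P L - s) Z ∧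
      aint A Ω Z Z ≤ κ * κs * (maxWidth Ω A P n).toReal ^ 2 * aint A Ω Gu Gu := by
  choose φ hφ Z hZ hZle hZ0 using fun i =>
    (hL i).exists_approx (hP i) hΩ hΩf hA hu hGu hg (hn i)
  refine ⟨∑ i, (P i).χ * φ i, ⟨φ, hφ, rfl⟩, ∑ i, Z i, ?_, ?_⟩
  · refine (HasH10.sum Finset.univ fun i _ => hZ i).congr ?_ Filter.EventuallyEq.rfl
    filter_upwards [ae_restrict_mem hΩ.measurableSet] with x hx
    have := hχ x hx
    -- By the partition of unity u = ∑ χ_i u on Ω, so the global error is the sum of the local ones.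
    simp only [globalParticular, Finset.sum_apply, Pi.mul_apply, Pi.sub_apply, mul_sub,
      Finset.sum_sub_distrib, ← Finset.sum_mul, this, one_mul]
  · refine (hA.aint_sum_le hΩ hκ (fun i => (hZ i).memLp_grad) hZ0).trans ?_
    have hw := maxWidth_ne_top (n := n) hΩ hΩf hA hP
    have hle : ∀ i, aint A Ω (Z i) (Z i) ≤
        (maxWidth Ω A P n).toReal ^ 2 * aint A (P i).Ws Gu Gu := fun i => by
      refine (hZle i).trans (mul_le_mul_of_nonneg_right ?_
        ((hA.mono (hP i).Ws_subset).aint_self_nonneg Gu))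
      refine pow_le_pow_left₀ ENNReal.toReal_nonneg (ENNReal.toReal_mono hw ?_) 2
      exact le_iSup (fun i => (P i).nWidth Ω A
        (@ite _ ((P i).IsBoundary Ω) (Classical.propDecidable _) (n i) (n i - 1))) i
    have h1 := hA.sum_aint_le hΩ (fun i => (hP i).isOpen_Ws) (fun i => (hP i).Ws_subset) hκs
      hGu.memLp_grad
    calc (κ : ℝ) * ∑ i, aint A Ω (Z i) (Z i)
        ≤ κ * ∑ i, (maxWidth Ω A P n).toReal ^ 2 * aint A (P i).Ws Gu Gu := by
          gcongr with i _; exact hle i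
      _ = κ * ((maxWidth Ω A P n).toReal ^ 2 * ∑ i, aint A (P i).Ws Gu Gu) := by
          rw [← Finset.mul_sum]
      _ ≤ κ * ((maxWidth Ω A P n).toReal ^ 2 * (κs * aint A Ω Gu Gu)) := by gcongr
      _ = _ := by ring

/-- Quasi-optimality of the method. -/
theorem IsGFEMSolution.aint_le (hΩ : IsOpen Ω) (hΩf : volume Ω ≠ ⊤)
    (hA : IsElliptic Ω A αmin αmax) (hu : IsWeakSolution Ω A f g u)
    (hP : ∀ i, (P i).Admissible Ω) (hL : ∀ i, (L i).Solves Ω A f g (P i)) {uG : E d → ℝ}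
    (huG : IsGFEMSolution Ω A f P L uG) {s : E d → ℝ} (hs : s ∈ globalSpace P L) {Z : E d → E d}
    (hZ : HasH10 Ω (u - globalParticular Ω P L - s) Z) :
    form A Ω (u - uG) (u - uG) ≤ aint A Ω Z Z := by
  obtain ⟨us, hus, huGe, heq⟩ := huG
  have ht := globalSpace_sub hs hus
  obtain ⟨Gs, hGs⟩ := globalSpace_hasH10 hΩ hΩf hA hP hL hs
  obtain ⟨Gt, hGt⟩ := globalSpace_hasH10 hΩ hΩf hA hP hL ht
  have hGu := hu.memH1.hasWG
  set Gu := weakGrad Ω u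
  have hup : HasWG Ω (globalParticular Ω P L) (Gu - Z - Gs) := by
    have := (hGu.sub hZ.toHasWG).sub hGs.toHasWG
    rwa [show u - (u - globalParticular Ω P L - s) - s = globalParticular Ω P L by abel] at this
  have hGus : HasWG Ω us (Gs - Gt) := by
    have := hGs.toHasWG.sub hGt.toHasWG
    rwa [sub_sub_cancel] at this
  have herr : HasWG Ω (u - uG) (Z + Gt) := by
    refine (hZ.toHasWG.add hGt.toHasWG).congr ?_ Filter.EventuallyEq.rfl
    filter_upwards [huGe] with x hx
    simp only [Pi.add_apply, Pi.sub_apply, hx]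
    ring
  -- Galerkin orthogonality. With t = s - u^s in the discrete space, u - u^G is the candidate error
  -- plus t and is orthogonal to t, so it has at most the energy of the candidate error.
  have hort : aint A Ω (Z + Gt) Gt = 0 := by
    have h1 := heq _ ht
    rw [← hu.eq _ (hGt.memH10 hΩ), form_eq_aint hΩ hGus hGt.toHasWG,
      form_eq_aint hΩ hGu hGt.toHasWG, form_eq_aint hΩ hup hGt.toHasWG,
      ← hA.aint_sub_left hGu.memLp_grad hup.memLp_grad hGt.memLp_grad, ← sub_eq_zero,
      ← hA.aint_sub_left hGus.memLp_grad (hGu.sub hup).memLp_grad hGt.memLp_grad,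
      show Gs - Gt - (Gu - (Gu - Z - Gs)) = (-1 : ℝ) • (Z + Gt) by
        rw [neg_one_smul]; abel, aint_smul_left] at h1
    linarith
  rw [form_eq_aint hΩ herr herr]
  have h2 := hA.aint_sub_self herr.memLp_grad hGt.memLp_grad
  rw [add_sub_cancel_right, hort] at h2
  linarith [hA.aint_self_nonneg Gt]

end

end RingGFEM

end

/-! ### Céa's argument combined with the approximation estimate. -/

theorem mainTheorem3 {d M : ℕ} (hd : d = 2 ∨ d = 3)
    (Ω : Set (RingGFEM.E d)) (hΩ : RingGFEM.IsLipschitzDomain Ω)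
    (A : RingGFEM.E d → Matrix (Fin d) (Fin d) ℝ) (αmin αmax : ℝ)
    (hA : RingGFEM.IsElliptic Ω A αmin αmax)
    (f g u : RingGFEM.E d → ℝ) (hf : MemLp f 2 (volume.restrict Ω)) (hg : RingGFEM.MemH1 Ω g)
    (hu : RingGFEM.IsWeakSolution Ω A f g u)
    (P : Fin M → RingGFEM.Patch d) (hP : ∀ i, (P i).Admissible Ω)
    (hcover : ⋃ i, (P i).W = Ω) (hχ : ∀ x ∈ Ω, ∑ i, (P i).χ x = 1)
    (κ κs : ℕ) (hκ : ∀ x ∈ Ω, {i | x ∈ (P i).W}.ncard ≤ κ)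
    (hκs : ∀ x ∈ Ω, {i | x ∈ (P i).Ws}.ncard ≤ κs)
    (n : Fin M → ℕ) (hn : ∀ i, 1 ≤ n i)
    (L : ∀ i, RingGFEM.LocalData d (n i)) (hL : ∀ i, (L i).Solves Ω A f g (P i))
    (uG : RingGFEM.E d → ℝ) (huG : RingGFEM.IsGFEMSolution Ω A f P L uG) :
    RingGFEM.maxWidth Ω A P n ≠ ⊤ ∧
      RingGFEM.energyNorm A Ω (u - uG) ≤
        Real.sqrt ((κ : ℝ) * κs) * (RingGFEM.maxWidth Ω A P n).toReal *
          RingGFEM.energyNorm A Ω u := by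
  have hΩo := hΩ.isOpen
  have hΩf : volume Ω ≠ ⊤ := hΩ.isBounded.measure_lt_top.ne
  have hGu := hu.memH1.hasWG
  refine ⟨RingGFEM.maxWidth_ne_top hΩo hΩf hA hP, ?_⟩
  obtain ⟨s, hs, Z, hZ, hle⟩ :=
    RingGFEM.exists_global_approx hΩo hΩf hA hg hu hGu hP hχ hκ hκs hn hL
  have h1 := (huG.aint_le hΩo hΩf hA hu hP hL hs hZ).trans hle
  rw [← RingGFEM.form_eq_aint hΩo hGu hGu] at h1
  rw [RingGFEM.energyNorm, RingGFEM.energyNorm]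
  refine (Real.sqrt_le_sqrt h1).trans_eq ?_
  rw [Real.sqrt_mul (by positivity), Real.sqrt_mul (by positivity),
    Real.sqrt_sq ENNReal.toReal_nonneg]
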